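/- Let $\mathbb H_{\mathbb C}$ be the algebra of complex $2\times 2$ matrices, $N(Z)=\det Z$, and let $e_0,e_1,e_2,e_3$ be the quaternionic units $$e_0=\begin{pmatrix}1&0\\0&1\end{pmatrix},\quad e_1=\begin{pmatrix}0&-i\\-i&0\end{pmatrix},\quad e_2=\begin{pmatrix}0&-1\\1&0\end{pmatrix},\quad e_3=\begin{pmatrix}-i&0\\0&i\end{pmatrix},\qquad \tilde e_0=-ie_0 .$$ Minkowski space is $\mathbb M=\{Z: Z^*=-Z\}=\{y^0\tilde e_0+y^1e_1+y^2e_2+y^3e_3:\ y^j\in\mathbb R\}$, on which $N(Y)=-(y^0)^2+(y^1)^2+(y^2)^2+(y^3)^2$, $i\operatorname{Tr}Y=2y^0$, and $\|Y\|$ is the Euclidean norm of $(y^0,\dots,y^3)$. Let $C^+=\{Y\in\mathbb M: N(Y)<0,\ i\operatorname{Tr}Y<0\}$, $\mathbb T^\pm=\mathbb M\pm iC^+$, $\mathbb D^+=\{Z: ZZ^*<1\}$, $\mathbb D^-=\{Z: ZZ^*>1\}$, and let $\square=\partial_0^2+\partial_1^2+\partial_2^2+\partial_3^2$ be the holomorphic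 wave operator, $\partial_j$ being the complex derivative in the direction $e_j$. For a function $\phi$ on $\mathbb T^\pm$ put $$(\pi\phi)(Z)=N(iZ-1)^{-1}\,\phi\bigl((Z-i)(Z+i)^{-1}\bigr),\qquad Z\in\mathbb D^\pm .$$ Let $\mathcal H(\mathbb M)^+$ be the space of holomorphic functions $\phi$ on $\mathbb T^+$ with $\square\phi=0$ such that $\pi\phi$ extends from $\mathbb D^+$ to a holomorphic function on a neighborhood of the closure of $\mathbb D^+$. Let $\mathcal H(\mathbb M)^-$ be the space of holomorphic functions $\phi$ on $\mathbb T^-$ with $\square\phi=0$ such that $\pi\phi$ extends from $\mathbb D^-$ to a function $\psi$ that is holomorphic on a neighborhood of the closure of $\mathbb D^-$ in $\mathbb H_{\mathbb C}$ and regular at infinity, i.e. $N(Z)^{-1}\psi(Z^{-1})$ extends holomorphically to a neighborhood of $0$. For $R>0$ let $H'_R=\{Y\in\mathbb M: N(Y)=-R^2\}$, oriented as the boundary of $\{Y\in\mathbb M:N(Y)>-R^2\}$, where $\mathbb M$ is oriented by $(\tilde e_0,e_1,e_2,e_3)$, and let $dS$ be the Euclidean volume form on $H'_R$ that is positive on $(e_1,e_2,e_3)$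 at the two vertices $y^0=\pm R$. Thus $\int_{H'_R}F\,dS$ is the integral of $F$ with respect to Euclidean surface measure over the sheet $i\operatorname{Tr}Y>0$ minus the one over the sheet $i\operatorname{Tr}Y<0$. Let $\widetilde{\deg}=1+\sum_{j=0}^3y^j\,\partial/\partial y^j$ on functions on $\mathbb M$. **Theorem.** Let $\phi\in\mathcal H(\mathbb M)^\pm$. Then $\phi$ has a limit from $\mathbb T^\pm$ at every point $Y\in\mathbb M$, again denoted $\phi(Y)$, and $\phi$ is differentiable on $\mathbb M$. For all $Z\in\mathbb T^\pm$ and all $R>0$ the following integrals converge absolutely, and $$\phi(Z)=\mp\frac{i}{2\pi^2}\int_{Y\in H'_R}\frac{R^2+N(Z)}{N(Y-Z)^2}\,\phi(Y)\,\frac{dS}{\|Y\|}=\pm\frac{i}{2\pi^2}\int_{Y\in H'_R}\frac{(\widetilde{\deg}\,\phi)(Y)}{N(Y-Z)}\,\frac{dS}{\|Y\|},$$ with the upper signs for $\mathcal H(\mathbb M)^+$, $\mathbb T^+$ and the lower signs for $\mathcal H(\mathbb M)^-$, $\mathbb T^-$. -/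

import Mathlib

open Complex MeasureTheory Filter Topology

noncomputable section

namespace ComplexQuaternion

open scoped ComplexOrder

/-- The algebra of complexified quaternions, realized as complex `2 × 2` matrices. -/
abbrev HC : Type := Matrix (Fin 2) (Fin 2) ℂ

/-- The complex quadratic form `N(Z) = det Z`. -/
def N (Z : HC) : ℂ := Z.det

/-- The quaternionic units `e₀, e₁, e₂, e₃` as matrices. -/
def e : Fin 4 → HC :=
  ![!![1, 0; 0, 1], !![0, -I; -I, 0], !![0, -1; 1, 0], !![-I, 0; 0, I]]

/-- Minkowski space as a real form of the complexified quaternions. -/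
def Mink : Set HC := {Z | Z.conjTranspose = -Z}

/-- Coordinates on Minkowski space:
`y⁰ ẽ₀ + y¹ e₁ + y² e₂ + y³ e₃`, with `ẽ₀ = -i e₀`.
The Euclidean structure of the coordinate space is the one for which
`ẽ₀, e₁, e₂, e₃` is orthonormal. -/
def mink (y : EuclideanSpace ℝ (Fin 4)) : HC :=
  (y 0 : ℂ) • (-I • e 0) + (y 1 : ℂ) • e 1 + (y 2 : ℂ) • e 2 + (y 3 : ℂ) • e 3

theorem mink_eq (y : EuclideanSpace ℝ (Fin 4)) :
    mink y = !![-I * y 0 - I * y 3, -I * y 1 - y 2; -I * y 1 + y 2, -I * y 0 + I * y 3] := by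
  ext i j
  fin_cases i <;> fin_cases j <;> simp [mink, e] <;> ring

theorem N_mink (y : EuclideanSpace ℝ (Fin 4)) :
    N (mink y) = ((-(y 0) ^ 2 + (y 1) ^ 2 + (y 2) ^ 2 + (y 3) ^ 2 : ℝ) : ℂ) := by
  rw [mink_eq, N, Matrix.det_fin_two_of]
  push_cast
  linear_combination ((y 0 : ℂ) ^ 2 - (y 3 : ℂ) ^ 2 - (y 1 : ℂ) ^ 2) * Complex.I_sq

theorem trace_mink (y : EuclideanSpace ℝ (Fin 4)) :
    I * (mink y).trace = ((2 * y 0 : ℝ) : ℂ) := by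
  rw [mink_eq, Matrix.trace_fin_two_of]
  push_cast
  linear_combination (-2 * (y 0 : ℂ)) * Complex.I_sq

theorem range_mink : Set.range mink = Mink := by
  ext Z
  constructor
  · rintro ⟨y, rfl⟩
    rw [mink_eq]
    ext i j
    fin_cases i <;> fin_cases j <;> simp [Matrix.conjTranspose_apply] <;> ring
  · intro h
    have h00 := congrFun (congrFun h 0) 0
    have h01 := congrFun (congrFun h 0) 1
    have h11 := congrFun (congrFun h 1) 1
    simp only [Matrix.conjTranspose_apply, Matrix.neg_apply, RCLike.star_def] at h00 h01 h11
    rw [Complex.ext_iff] at h00 h01 h11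
    simp at h00 h01 h11
    refine ⟨!₂[-((Z 0 0).im + (Z 1 1).im) / 2, -(Z 0 1).im, -(Z 0 1).re,
      ((Z 1 1).im - (Z 0 0).im) / 2], ?_⟩
    rw [mink_eq]
    ext i j
    fin_cases i <;> fin_cases j <;> apply Complex.ext <;> simp <;> linarith

/-- The open cone `C⁺ = {Y ∈ M : N(Y) < 0, i Tr Y < 0}` (both quantities are real on `M`). -/
def coneC : Set HC := {Y | Y ∈ Mink ∧ (N Y).re < 0 ∧ (I * Y.trace).re < 0}

/-- The tube domain `T⁺ = M + i C⁺`. -/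
def Tplus : Set HC := {Z | ∃ Y ∈ Mink, ∃ V ∈ coneC, Z = Y + I • V}

/-- The tube domain `T⁻ = M - i C⁺`. -/
def Tminus : Set HC := {Z | ∃ Y ∈ Mink, ∃ V ∈ coneC, Z = Y - I • V}

/-- The domain `D⁺ = {Z : Z Z* < 1}`. -/
def Dplus : Set HC := {Z | (1 - Z * Z.conjTranspose).PosDef}

/-- The domain `D⁻ = {Z : Z Z* > 1}`. -/
def Dminus : Set HC := {Z | (Z * Z.conjTranspose - 1).PosDef}

/-- The action on scalar functions: for `h⁻¹ = (a b; c d)`,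
`(π⁰(h) φ)(Z) = N(cZ + d)⁻¹ φ((aZ + b)(cZ + d)⁻¹)`. -/
def piZero (a b c d : HC) (φ : HC → ℂ) (Z : HC) : ℂ :=
  (N (c * Z + d))⁻¹ * φ ((a * Z + b) * (c * Z + d)⁻¹)

/-- The Cayley transform of functions: `π⁰(γ⁻¹) φ` with `γ = (i 1; i -1)`, i.e.
`N(iZ - 1)⁻¹ φ((Z - i)(Z + i)⁻¹)`. -/
def cayley (φ : HC → ℂ) : HC → ℂ := piZero (I • 1) 1 (I • 1) (-1) φ

/-- The inversion of functions: `N(Z)⁻¹ φ(Z⁻¹)`. -/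
def inversion (φ : HC → ℂ) : HC → ℂ := piZero 0 1 1 0 φ

/-- The holomorphic wave operator `□ = ∂₀² + ∂₁² + ∂₂² + ∂₃²`, where `∂ⱼ` is the complex
derivative in the direction `eⱼ`. On Minkowski space, where `∂/∂y⁰ = -i ∂₀`, it is
`-∂²/(∂y⁰)² + ∂²/(∂y¹)² + ∂²/(∂y²)² + ∂²/(∂y³)²`. -/
def box (φ : HC → ℂ) (Z : HC) : ℂ :=
  ∑ j : Fin 4, fderiv ℂ (fun W => fderiv ℂ φ W (e j)) Z (e j)

/-- The function `ψ` is regular at infinity: its inversion extends holomorphically to a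
neighborhood of the origin. -/
def RegularAtInfinity (ψ : HC → ℂ) : Prop :=
  ∃ (V : Set HC) (χ : HC → ℂ), IsOpen V ∧ 0 ∈ V ∧ DifferentiableOn ℂ χ V ∧
    ∀ W ∈ V, N W ≠ 0 → χ W = inversion ψ W

/-- The space `H(M)⁺`; only the values of `φ` on `T⁺` matter. -/
def HMplus : Set (HC → ℂ) :=
  {φ | DifferentiableOn ℂ φ Tplus ∧ (∀ Z ∈ Tplus, box φ Z = 0) ∧
    ∃ (U : Set HC) (ψ : HC → ℂ), IsOpen U ∧ closure Dplus ⊆ U ∧ DifferentiableOn ℂ ψ U ∧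
      ∀ Z ∈ Dplus, ψ Z = cayley φ Z}

/-- The space `H(M)⁻`; only the values of `φ` on `T⁻` matter. -/
def HMminus : Set (HC → ℂ) :=
  {φ | DifferentiableOn ℂ φ Tminus ∧ (∀ Z ∈ Tminus, box φ Z = 0) ∧
    ∃ (U : Set HC) (ψ : HC → ℂ), IsOpen U ∧ closure Dminus ⊆ U ∧ DifferentiableOn ℂ ψ U ∧
      (∀ Z ∈ Dminus, ψ Z = cayley φ Z) ∧ RegularAtInfinity ψ}

/-- The boundary value at the point of `M` with coordinates `y` of a function `φ` on the
tube domain `T`. -/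
def boundaryValue (T : Set HC) (φ : HC → ℂ) (y : EuclideanSpace ℝ (Fin 4)) : ℂ :=
  limUnder (𝓝[T] (mink y)) φ

/-- The degree operator plus identity on functions on Minkowski space:
`1 + ∑ yⁱ ∂/∂yⁱ`. -/
def degTilde (f : EuclideanSpace ℝ (Fin 4) → ℂ) (y : EuclideanSpace ℝ (Fin 4)) : ℂ :=
  f y + ∑ i : Fin 4, (y i : ℂ) * fderiv ℝ f y (EuclideanSpace.single i 1)

/-- The point `(h(x), x)` of the graph of `h`. -/
def graphMap (h : EuclideanSpace ℝ (Fin 3) → ℝ) (x : EuclideanSpace ℝ (Fin 3)) :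
    EuclideanSpace ℝ (Fin 4) :=
  !₂[h x, x 0, x 1, x 2]

/-- The Euclidean surface measure on the graph of `h`:
`dS = √(1 + |∇h|²) dx¹ dx² dx³`. -/
def graphSurfaceMeasure (h : EuclideanSpace ℝ (Fin 3) → ℝ) :
    Measure (EuclideanSpace ℝ (Fin 4)) :=
  (volume.withDensity
    (fun x => ENNReal.ofReal (Real.sqrt (1 + ‖gradient h x‖ ^ 2)))).map (graphMap h)

/-- The two-sheeted hyperboloid `N(Y) = -R²`, in coordinates. -/
def hyperboloid (R : ℝ) : Set (EuclideanSpace ℝ (Fin 4)) :=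
  {y | N (mink y) = ((-R ^ 2 : ℝ) : ℂ)}

/-- The upper sheet of the hyperboloid is the graph of this function, the lower sheet the graph
of its negative. -/
def sheet (R : ℝ) (x : EuclideanSpace ℝ (Fin 3)) : ℝ := Real.sqrt (R ^ 2 + ‖x‖ ^ 2)

theorem hyperboloid_eq (R : ℝ) :
    hyperboloid R =
      Set.range (graphMap (sheet R)) ∪ Set.range (graphMap (fun x => -sheet R x)) := by
  have key : ∀ x : EuclideanSpace ℝ (Fin 3), (sheet R x) ^ 2 =
      R ^ 2 + (x 0 ^ 2 + x 1 ^ 2 + x 2 ^ 2) := by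
    intro x
    rw [sheet, Real.sq_sqrt (by positivity), EuclideanSpace.real_norm_sq_eq, Fin.sum_univ_three]
  ext y
  simp only [hyperboloid, Set.mem_ofPred_eq, N_mink, Complex.ofReal_inj, Set.mem_union,
    Set.mem_range]
  constructor
  · intro h
    have h2 : (y 0) ^ 2 = (sheet R !₂[y 1, y 2, y 3]) ^ 2 := by
      rw [key]; simp; linarith
    rcases sq_eq_sq_iff_eq_or_eq_neg.1 h2 with h3 | h3
    · left
      refine ⟨!₂[y 1, y 2, y 3], ?_⟩
      ext i
      fin_cases i <;> simp [graphMap, h3]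
    · right
      refine ⟨!₂[y 1, y 2, y 3], ?_⟩
      ext i
      fin_cases i <;> simp [graphMap, h3]
  · rintro (⟨x, rfl⟩ | ⟨x, rfl⟩) <;> simp [graphMap, key] <;> ring

/-- The Euclidean surface measure on the two-sheeted hyperboloid `N(Y) = -R²`. -/
def hyperboloidMeasure (R : ℝ) : Measure (EuclideanSpace ℝ (Fin 4)) :=
  graphSurfaceMeasure (sheet R) + graphSurfaceMeasure (fun x => -sheet R x)

/-- The orientation sign of the hyperboloid: `+1` on the sheet where `i Tr Y > 0` and `-1` on the
sheet where `i Tr Y < 0`. -/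
def orientationSign (y : EuclideanSpace ℝ (Fin 4)) : ℝ := Real.sign (I * (mink y).trace).re

/-- The density, relative to the Euclidean surface measure, of the scalar 3-form `dS / ‖Y‖` on the
hyperboloid: the form is positive on `(e₁, e₂, e₃)` at both vertices, and the hyperboloid is
oriented as the boundary of `{N(Y) > -R²}`. -/
def oneOverNorm (y : EuclideanSpace ℝ (Fin 4)) : ℂ := ((orientationSign y / ‖y‖ : ℝ) : ℂ)

end ComplexQuaternion

end

open ComplexQuaternion

/-! ### Holomorphic functions on a finite-dimensional complex space are smooth. -/

section SeveralComplexVariables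

variable {E : Type*} [NormedAddCommGroup E] [NormedSpace ℂ E] [FiniteDimensional ℂ E]

/-! Reduction to kernels. The Cayley transform carries `Tplus` onto `Dplus` and the points of M into
the unitary group, so both formulas become linear statements about the function χ = πφ near the
unitary group. There the integrands decay like ‖Y‖⁻³ on the hyperboloid and are controlled by χ and
its first derivatives on the compact unitary group (`exists_norm_integrand_le`). The wave equation
passes to χ (`harmonicOn_cayley`). It makes a k-th order derivative depend only on how often each
row and column index occurs, so the k-th homogeneous Taylor part of χ at 0 is a combination of
powers q^k of the linear forms q(P) = (s,1) P (t,1)ᵀ (`exists_iterD_replicate_eq_sum`). The Taylor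
series converges geometrically on the unitary group together with its first derivatives
(`exists_homogeneous_expansion`), hence it may be integrated term by term and it is enough to treat
χ = q^k. The generating function 1/(1 - λq) of these powers corresponds on the tube to a multiple of
1/N(Z - A), where A lies in `Tminus` for small λ (`lift_block`). So everything follows from the
kernel 1/N(Y - A) by comparing powers of λ (`reproduced_linForm_pow`).

The kernel (`integral_poissonKernel_div`). The identity 1/N(W) = π⁻¹ ∫ (x* W x)⁻² dζ with x = (1, ζ)
(`integral_inv_sesq_sq`) writes 1/N(Y - A) as a superposition of functions constant on parallel null
hyperplanes. By Fubini, homogeneity and an SU(2) rotation only x = (1, 0) remains, where the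
function depends on τ = y⁰ + y³ alone. With η = y¹ + iy² the oriented form dS/‖Y‖ becomes dτ dη/τ on
both sheets at once, the sign of τ supplying the orientation. Since τN(Y - Z) is a quadratic
polynomial in η, the η-integral is explicit; the remaining rational function of τ has a single pole
in the lower half plane, at iZ₀₀, and this pole gives the value (`integral_integral_horoF`).

The second formula. On N(Y) = -R² the operator `degTilde` turns 1/N(Y - A) into (R² + N(A))/N(Y -
A)². Thus the second integral is the first with Z and A interchanged; the substitution Y ↦ -Y
restores the order and reverses the orientation, whence the opposite sign.

The space H(M)⁻ reduces to the first case by Z ↦ -Z, which is P ↦ -P⁻¹ on the Cayley side. -/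

omit [FiniteDimensional ℂ E] in
theorem norm_fderiv_le_of_forall_ball {f : E → ℂ} {U : Set E} (hU : IsOpen U)
    (hf : DifferentiableOn ℂ f U) {z : E} {δ M : ℝ} (hδ : 0 < δ)
    (hz : Metric.closedBall z δ ⊆ U) (hM : ∀ w ∈ Metric.closedBall z δ, ‖f w‖ ≤ M) :
    ‖fderiv ℂ f z‖ ≤ M / δ := by
  have hM0 : 0 ≤ M := (norm_nonneg _).trans (hM z (Metric.mem_closedBall_self hδ.le))
  refine ContinuousLinearMap.opNorm_le_bound _ (by positivity) fun v => ?_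
  by_cases hv : v = 0
  · simp [hv]
  have hv' : 0 < ‖v‖ := norm_pos_iff.2 hv
  have hline : ∀ ζ : ℂ, HasDerivAt (fun ζ : ℂ => z + ζ • v) v ζ := fun ζ => by
    simpa using ((hasDerivAt_id ζ).smul_const v).const_add z
  have hmem : ∀ ζ ∈ Metric.closedBall (0 : ℂ) (δ / ‖v‖), z + ζ • v ∈ Metric.closedBall z δ := by
    intro ζ hζ
    rw [mem_closedBall_zero_iff, le_div_iff₀ hv'] at hζ
    simpa [mem_closedBall_iff_norm, norm_smul] using hζ
  have hd : ∀ ζ ∈ Metric.closedBall (0 : ℂ) (δ / ‖v‖),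
      HasDerivAt (fun ζ : ℂ => f (z + ζ • v)) (fderiv ℂ f (z + ζ • v) v) ζ := fun ζ hζ =>
    ((hf.differentiableAt (hU.mem_nhds (hz (hmem ζ hζ)))).hasFDerivAt).comp_hasDerivAt ζ (hline ζ)
  have hr : 0 < δ / ‖v‖ := by positivity
  have h0 := (hd 0 (Metric.mem_closedBall_self hr.le)).deriv
  rw [zero_smul, add_zero] at h0
  rw [← h0]
  have := norm_deriv_le_of_forall_mem_sphere_norm_le (f := fun ζ : ℂ => f (z + ζ • v)) hr
    (c := 0) (C := M) ⟨fun ζ hζ => ((hd ζ (Metric.ball_subset_closedBall hζ)).differentiableAt).differentiableWithinAt, fun ζ hζ => by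
      rw [closure_ball _ hr.ne'] at hζ
      exact (hd ζ hζ).continuousAt.continuousWithinAt⟩
    (fun ζ hζ => hM _ (hmem ζ (Metric.sphere_subset_closedBall hζ)))
  refine this.trans (le_of_eq ?_)
  field_simp

/-- Cauchy's formula on the complex line through z in the direction v writes the derivative as a
circle integral in which z enters only through f. That integral is differentiated under the integral
sign, with the Cauchy estimate as dominating bound. -/
theorem differentiableOn_fderiv_apply {f : E → ℂ} {U : Set E} (hU : IsOpen U)
    (hf : DifferentiableOn ℂ f U) (v : E) :
    DifferentiableOn ℂ (fun z => fderiv ℂ f z v) U := by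
  have : ProperSpace E := FiniteDimensional.proper ℂ E
  borelize E
  intro z₀ hz₀
  refine DifferentiableAt.differentiableWithinAt ?_
  -- Three radii δ are needed: one for moving z, one for the circle in the direction v, one for the
  -- ball of the Cauchy estimate.
  obtain ⟨δ, hδ, hball⟩ : ∃ δ > 0, Metric.closedBall z₀ (3 * δ) ⊆ U := by
    obtain ⟨ε, hε, h⟩ := Metric.nhds_basis_closedBall.mem_iff.1 (hU.mem_nhds hz₀)
    exact ⟨ε / 3, by positivity, by convert h using 2; ring⟩
  obtain ⟨M, hM⟩ := (isCompact_closedBall z₀ (3 * δ)).exists_bound_of_continuousOn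
    (hf.continuousOn.mono hball)
  have hM0 : 0 ≤ M := (norm_nonneg _).trans
    (hM z₀ (Metric.mem_closedBall_self (by positivity)))
  obtain ⟨r, hr, hrv⟩ : ∃ r : ℝ, 0 < r ∧ r * ‖v‖ ≤ δ :=
    ⟨δ / (‖v‖ + 1), by positivity, by
      rw [div_mul_eq_mul_div, div_le_iff₀ (by positivity)]; nlinarith [norm_nonneg v]⟩
  have hmem : ∀ z ∈ Metric.ball z₀ δ, ∀ ζ : ℂ, ‖ζ‖ ≤ r →
      Metric.closedBall (z + ζ • v) δ ⊆ Metric.closedBall z₀ (3 * δ) := by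
    intro z hz ζ hζ
    refine Metric.closedBall_subset_closedBall' ?_
    have h1 : dist (z + ζ • v) z ≤ δ := by
      rw [dist_eq_norm, add_sub_cancel_left, norm_smul]
      exact (mul_le_mul_of_nonneg_right hζ (norm_nonneg v)).trans hrv
    have := dist_triangle (z + ζ • v) z z₀
    have := (Metric.mem_ball.1 hz)
    linarith
  have hself : ∀ z ∈ Metric.ball z₀ δ, ∀ ζ : ℂ, ‖ζ‖ ≤ r →
      z + ζ • v ∈ Metric.closedBall z₀ (3 * δ) := fun z hz ζ hζ =>
    hmem z hz ζ hζ (Metric.mem_closedBall_self hδ.le)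
  have hcirc : ∀ θ : ℝ, ‖circleMap 0 r θ‖ = r := fun θ => by simp [abs_of_pos hr]
  set k : ℝ → ℂ := fun θ => deriv (circleMap 0 r) θ * ((circleMap 0 r θ) ^ 2)⁻¹ with hk
  have hkc : Continuous k := by
    have h0 : ∀ θ, circleMap 0 r θ ≠ 0 := fun θ => circleMap_ne_center hr.ne'
    simp only [hk, deriv_circleMap]
    exact ((continuous_circleMap 0 r).mul continuous_const).mul
      (((continuous_circleMap 0 r).pow 2).inv₀ fun θ => pow_ne_zero 2 (h0 θ))
  have hkn : ∀ θ, ‖k θ‖ = r⁻¹ := fun θ => by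
    simp only [hk, deriv_circleMap, norm_mul, norm_inv, norm_pow, hcirc, norm_I]
    field_simp
  have hrep : ∀ z ∈ Metric.ball z₀ δ, fderiv ℂ f z v =
      (2 * Real.pi * I : ℂ)⁻¹ * ∫ θ in (0 : ℝ)..2 * Real.pi, k θ * f (z + circleMap 0 r θ • v) := by
    intro z hz
    have hline : ∀ ζ : ℂ, HasDerivAt (fun ζ : ℂ => z + ζ • v) v ζ := fun ζ => by
      simpa using ((hasDerivAt_id ζ).smul_const v).const_add z
    have hO : IsOpen ((fun ζ : ℂ => z + ζ • v) ⁻¹' U) :=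
      hU.preimage (continuous_const.add (continuous_id.smul continuous_const))
    have hd : ∀ ζ ∈ (fun ζ : ℂ => z + ζ • v) ⁻¹' U,
        HasDerivAt (fun ζ : ℂ => f (z + ζ • v)) (fderiv ℂ f (z + ζ • v) v) ζ := fun ζ hζ =>
      ((hf.differentiableAt (hU.mem_nhds hζ)).hasFDerivAt).comp_hasDerivAt ζ (hline ζ)
    have hsub : Metric.closedBall (0 : ℂ) r ⊆ (fun ζ : ℂ => z + ζ • v) ⁻¹' U := fun ζ hζ =>
      hball (hself z hz ζ (mem_closedBall_zero_iff.1 hζ))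
    have h0 := (hd 0 (hsub (Metric.mem_closedBall_self hr.le))).deriv
    rw [zero_smul, add_zero] at h0
    have := two_pi_I_inv_smul_circleIntegral_sub_sq_inv_smul_of_differentiable hO hsub
      (fun ζ hζ => (hd ζ hζ).differentiableAt.differentiableWithinAt) (Metric.mem_ball_self hr)
    rw [← h0, ← this, circleIntegral, smul_eq_mul]
    congr 1
    refine intervalIntegral.integral_congr fun θ _ => ?_
    simp [hk, mul_assoc]
  have hev : (fun z => fderiv ℂ f z v) =ᶠ[𝓝 z₀] fun z =>
      (2 * Real.pi * I : ℂ)⁻¹ *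
        ∫ θ in (0 : ℝ)..2 * Real.pi, k θ * f (z + circleMap 0 r θ • v) :=
    Filter.eventually_of_mem (Metric.ball_mem_nhds z₀ hδ) hrep
  refine DifferentiableAt.congr_of_eventuallyEq ?_ hev
  refine DifferentiableAt.const_mul ?_ _
  have hcont : ∀ z ∈ Metric.ball z₀ δ,
      Continuous fun θ : ℝ => k θ * f (z + circleMap 0 r θ • v) := fun z hz => by
    refine hkc.mul ?_
    refine continuous_iff_continuousAt.2 fun θ => ?_
    refine ContinuousAt.comp (f := fun θ => z + circleMap 0 r θ • v) (g := f)
      (hf.continuousOn.continuousAt (hU.mem_nhds (hball (hself z hz _ (hcirc θ).le)))) ?_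
    exact (continuous_const.add ((continuous_circleMap 0 r).smul continuous_const)).continuousAt
  refine (intervalIntegral.hasFDerivAt_integral_of_dominated_of_fderiv_le
    (F' := fun z θ => k θ • fderiv ℂ f (z + circleMap 0 r θ • v))
    (bound := fun _ => r⁻¹ * (M / δ)) (Metric.ball_mem_nhds z₀ hδ) ?_ ?_ ?_ ?_ ?_ ?_).differentiableAt
  · exact Filter.eventually_of_mem (Metric.ball_mem_nhds z₀ hδ)
      fun z hz => (hcont z hz).aestronglyMeasurable
  · exact (hcont z₀ (Metric.mem_ball_self hδ)).intervalIntegrable _ _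
  · refine (hkc.aestronglyMeasurable).smul ?_
    refine Measurable.aestronglyMeasurable ?_
    refine (measurable_fderiv ℂ f).comp ?_
    exact (continuous_const.add ((continuous_circleMap 0 r).smul continuous_const)).measurable
  · refine Filter.Eventually.of_forall fun θ _ z hz => ?_
    rw [norm_smul, hkn]
    refine mul_le_mul_of_nonneg_left ?_ (by positivity)
    exact norm_fderiv_le_of_forall_ball hU hf hδ ((hmem z hz _ (hcirc θ).le).trans hball)
      fun w hw => hM w (hmem z hz _ (hcirc θ).le hw)
  · exact intervalIntegrable_const
  · refine Filter.Eventually.of_forall fun θ _ z hz => ?_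
    have h1 := (hf.differentiableAt
      (hU.mem_nhds (hball (hself z hz _ (hcirc θ).le)))).hasFDerivAt
    have h2 : HasFDerivAt (fun z => z + circleMap 0 r θ • v) (ContinuousLinearMap.id ℂ E) z :=
      (hasFDerivAt_id z).add_const _
    have h3 := (h1.comp z h2).const_smul (k θ)
    rw [ContinuousLinearMap.comp_id] at h3
    exact h3

theorem contDiffOn_nat_of_differentiableOn {U : Set E} (hU : IsOpen U) (n : ℕ) :
    ∀ {f : E → ℂ}, DifferentiableOn ℂ f U → ContDiffOn ℂ n f U := by
  induction n with
  | zero => intro f hf; exact contDiffOn_zero.2 hf.continuousOn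
  | succ n ih =>
    intro f hf
    rw [Nat.cast_succ, contDiffOn_succ_iff_fderiv_of_isOpen hU]
    refine ⟨hf, by simp, contDiffOn_clm_apply.2 fun v => ?_⟩
    exact ih (differentiableOn_fderiv_apply hU hf v)

end SeveralComplexVariables

/-! ### Integrals over the real line by primitives with complex logarithms. -/

section LineIntegrals

theorem ofReal_sub_ne_zero_of_im_ne_zero {z : ℂ} (hz : z.im ≠ 0) (t : ℝ) : (t : ℂ) - z ≠ 0 := by
  intro h
  apply hz
  have := congrArg Complex.im h
  simpa using this

theorem exists_norm_inv_ofReal_sub_le {z : ℂ} (hz : z.im ≠ 0) :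
    ∃ C : ℝ, 0 < C ∧ ∀ t : ℝ, ‖((t : ℂ) - z)⁻¹‖ ≤ C * (1 + |t|)⁻¹ := by
  have him : 0 < |z.im| := abs_pos.2 hz
  refine ⟨(1 + ‖z‖ + |z.im|) / |z.im|, by positivity, fun t => ?_⟩
  have h0 : 0 < ‖(t : ℂ) - z‖ := norm_pos_iff.2 (ofReal_sub_ne_zero_of_im_ne_zero hz t)
  have h1 : |z.im| ≤ ‖(t : ℂ) - z‖ := by
    simpa using Complex.abs_im_le_norm ((t : ℂ) - z)
  have h2 : |t| ≤ ‖(t : ℂ) - z‖ + ‖z‖ := by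
    have := norm_add_le ((t : ℂ) - z) z
    rwa [sub_add_cancel, Complex.norm_real, Real.norm_eq_abs] at this
  rw [norm_inv, div_mul_eq_mul_div, inv_eq_one_div, div_le_div_iff₀ h0 him, one_mul,
    mul_assoc]
  rw [← div_eq_inv_mul, mul_div_assoc', le_div_iff₀ (by positivity)]
  nlinarith [norm_nonneg z, mul_nonneg (norm_nonneg z) (sub_nonneg.2 h1)]

theorem tendsto_ofReal_sub_inv_atTop (z : ℂ) :
    Tendsto (fun t : ℝ => ((t : ℂ) - z)⁻¹) atTop (𝓝 0) := by
  refine tendsto_inv₀_cobounded.comp ?_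
  refine tendsto_norm_atTop_iff_cobounded.1 ?_
  refine tendsto_atTop_mono (f := fun t : ℝ => t - ‖z‖) (fun t => ?_)
    (tendsto_atTop_add_const_right _ _ tendsto_id)
  have := norm_sub_norm_le (t : ℂ) z
  rw [Complex.norm_real, Real.norm_eq_abs] at this
  linarith [le_abs_self t]

theorem tendsto_ofReal_sub_inv_atBot (z : ℂ) :
    Tendsto (fun t : ℝ => ((t : ℂ) - z)⁻¹) atBot (𝓝 0) := by
  have := ((tendsto_ofReal_sub_inv_atTop (-z)).comp tendsto_neg_atBot_atTop).neg
  rw [neg_zero] at this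
  refine this.congr fun t => ?_
  simp only [Function.comp_apply, ofReal_neg]
  rw [← inv_neg]
  congr 1
  ring

theorem tendsto_neg_one_sub_div (z : ℂ) :
    Tendsto (fun r : ℝ => (-1 : ℂ) - z / r) atTop (𝓝 (-1)) := by
  have h : Tendsto (fun r : ℝ => z * ((r : ℂ) - 0)⁻¹) atTop (𝓝 (z * 0)) :=
    (tendsto_ofReal_sub_inv_atTop 0).const_mul z
  have := h.const_sub (-1 : ℂ)
  simpa [div_eq_mul_inv] using this

/-- Asymptotics of the logarithm along a horizontal line, to the right. -/
theorem tendsto_log_ofReal_sub_atTop (z : ℂ) :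
    Tendsto (fun t : ℝ => log ((t : ℂ) - z) - Real.log t) atTop (𝓝 0) := by
  have h1 : Tendsto (fun r : ℝ => (1 : ℂ) - z / r) atTop (𝓝 1) := by
    have h : Tendsto (fun r : ℝ => z * ((r : ℂ) - 0)⁻¹) atTop (𝓝 (z * 0)) :=
      (tendsto_ofReal_sub_inv_atTop 0).const_mul z
    have := h.const_sub (1 : ℂ)
    simpa [div_eq_mul_inv] using this
  have h2 : Tendsto (fun r : ℝ => log ((1 : ℂ) - z / r)) atTop (𝓝 0) := by
    have := (continuousAt_clog (x := 1) one_mem_slitPlane).tendsto.comp h1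
    rw [log_one] at this
    exact this
  refine h2.congr' ?_
  filter_upwards [eventually_gt_atTop 0, h1.eventually_ne one_ne_zero] with t ht hne
  have : (t : ℂ) - z = (t : ℂ) * (1 - z / t) := by
    have : (t : ℂ) ≠ 0 := by exact_mod_cast ht.ne'
    field_simp
  rw [this, log_ofReal_mul ht hne]
  ring

/-- For t < 0 one has t - z = (-t)(-1 - z/(-t)), so the limit is that of the principal logarithm at
-1. The set s records the side of the branch cut from which -1 is approached. -/
theorem log_ofReal_sub_atBot_aux {z : ℂ} {l : ℂ} {s : Set ℂ}
    (hs : ∀ᶠ r : ℝ in atTop, (-1 : ℂ) - z / r ∈ s) (hl : Tendsto log (𝓝[s] (-1)) (𝓝 l)) :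
    Tendsto (fun t : ℝ => log ((t : ℂ) - z) - Real.log (-t)) atBot (𝓝 l) := by
  have h2 : Tendsto (fun r : ℝ => log ((-1 : ℂ) - z / r)) atTop (𝓝 l) :=
    hl.comp (tendsto_nhdsWithin_iff.2 ⟨tendsto_neg_one_sub_div z, hs⟩)
  refine (h2.comp tendsto_neg_atBot_atTop).congr' ?_
  filter_upwards [eventually_lt_atBot 0, ((tendsto_neg_one_sub_div z).comp
    tendsto_neg_atBot_atTop).eventually_ne (neg_ne_zero.2 one_ne_zero)] with t ht hne
  have : (t : ℂ) - z = ((-t : ℝ) : ℂ) * (-1 - z / ((-t : ℝ) : ℂ)) := by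
    have : (t : ℂ) ≠ 0 := by exact_mod_cast ht.ne
    push_cast
    field_simp
    ring
  simp only [Function.comp_apply] at hne ⊢
  rw [this, log_ofReal_mul (by linarith) hne]
  ring

theorem tendsto_log_ofReal_sub_atBot_of_im_neg {z : ℂ} (hz : z.im < 0) :
    Tendsto (fun t : ℝ => log ((t : ℂ) - z) - Real.log (-t)) atBot (𝓝 (Real.pi * I)) := by
  refine log_ofReal_sub_atBot_aux (s := {w | 0 ≤ w.im}) ?_ ?_
  · filter_upwards [eventually_gt_atTop 0] with r hr
    simp only [sub_im, neg_im, one_im, neg_zero, zero_sub, Left.nonneg_neg_iff,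
      div_ofReal_im]
    exact (div_neg_of_neg_of_pos hz hr).le
  · have := tendsto_log_nhdsWithin_im_nonneg_of_re_neg_of_im_zero (z := -1) (by simp) (by simp)
    simpa using this

theorem tendsto_log_ofReal_sub_atBot_of_im_pos {z : ℂ} (hz : 0 < z.im) :
    Tendsto (fun t : ℝ => log ((t : ℂ) - z) - Real.log (-t)) atBot (𝓝 (-(Real.pi * I))) := by
  refine log_ofReal_sub_atBot_aux (s := {w | w.im < 0}) ?_ ?_
  · filter_upwards [eventually_gt_atTop 0] with r hr
    simp only [sub_im, neg_im, one_im, neg_zero, zero_sub, neg_neg_iff_pos,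
      div_ofReal_im]
    exact div_pos hz hr
  · have := tendsto_log_nhdsWithin_im_neg_of_re_neg_of_im_zero (z := -1) (by simp) (by simp)
    simpa using this

theorem hasDerivAt_log_ofReal_sub {z : ℂ} (hz : z.im ≠ 0) (t : ℝ) :
    HasDerivAt (fun t : ℝ => log ((t : ℂ) - z)) ((t : ℂ) - z)⁻¹ t := by
  have h := ((Complex.ofRealCLM.hasDerivAt (x := t)).sub_const z).clog_real (f := fun t : ℝ => (t : ℂ) - z)
    (mem_slitPlane_iff.2 (Or.inr (by simpa using hz)))
  simpa [one_div] using h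

theorem integrable_mul_inv_ofReal_sub {z w : ℂ} (hz : z.im ≠ 0) (hw : w.im ≠ 0) :
    Integrable fun t : ℝ => ((t : ℂ) - z)⁻¹ * ((t : ℂ) - w)⁻¹ := by
  obtain ⟨C, hC, h1⟩ := exists_norm_inv_ofReal_sub_le hz
  obtain ⟨D, hD, h2⟩ := exists_norm_inv_ofReal_sub_le hw
  refine (integrable_inv_one_add_sq.const_mul (C * D)).mono' ?_ (Eventually.of_forall fun t => ?_)
  · refine Continuous.aestronglyMeasurable ?_
    exact ((continuous_ofReal.sub continuous_const).inv₀
      (ofReal_sub_ne_zero_of_im_ne_zero hz)).mul ((continuous_ofReal.sub continuous_const).inv₀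
      (ofReal_sub_ne_zero_of_im_ne_zero hw))
  · rw [norm_mul]
    refine (mul_le_mul (h1 t) (h2 t) (norm_nonneg _) (by positivity)).trans ?_
    rw [mul_mul_mul_comm]
    refine mul_le_mul_of_nonneg_left ?_ (by positivity)
    rw [← mul_inv]
    refine inv_anti₀ (by positivity) ?_
    nlinarith [abs_nonneg t, sq_abs t]

theorem integrable_inv_mul_inv_sq {z w : ℂ} (hz : z.im ≠ 0) (hw : w.im ≠ 0) :
    Integrable fun t : ℝ => ((t : ℂ) - z)⁻¹ * (((t : ℂ) - w) ^ 2)⁻¹ := by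
  obtain ⟨D, hD, h2⟩ := exists_norm_inv_ofReal_sub_le hw
  refine ((integrable_mul_inv_ofReal_sub hz hw).norm.const_mul D).mono' ?_
    (Eventually.of_forall fun t => ?_)
  · refine Continuous.aestronglyMeasurable ?_
    exact ((continuous_ofReal.sub continuous_const).inv₀
      (ofReal_sub_ne_zero_of_im_ne_zero hz)).mul
      (((continuous_ofReal.sub continuous_const).pow 2).inv₀
      fun t => pow_ne_zero 2 (ofReal_sub_ne_zero_of_im_ne_zero hw t))
  · rw [pow_two, mul_inv, ← mul_assoc, norm_mul, mul_comm]
    refine mul_le_mul_of_nonneg_right ((h2 t).trans ?_) (norm_nonneg _)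
    refine mul_le_of_le_one_right hD.le (inv_le_one_of_one_le₀ ?_)
    linarith [abs_nonneg t]

/-- By partial fractions the integrand has a primitive in terms of log(t - z) - log(t - w). It
vanishes at +∞, so the value comes only from the jump l at -∞: 2πi if z and w lie on opposite sides
of the real line in the order used below, 0 if on the same side. -/
theorem integral_inv_mul_inv_sq_aux {z w l : ℂ} (hz : z.im ≠ 0) (hw : w.im ≠ 0) (hzw : z ≠ w)
    (hl : Tendsto (fun t : ℝ => log ((t : ℂ) - z) - log ((t : ℂ) - w)) atBot (𝓝 l)) :
    ∫ t : ℝ, ((t : ℂ) - z)⁻¹ * (((t : ℂ) - w) ^ 2)⁻¹ = -l / (z - w) ^ 2 := by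
  have hzw' : z - w ≠ 0 := sub_ne_zero.2 hzw
  set G : ℝ → ℂ := fun t => (log ((t : ℂ) - z) - log ((t : ℂ) - w)) / (z - w) ^ 2 +
    (z - w)⁻¹ * ((t : ℂ) - w)⁻¹ with hG
  have hderiv : ∀ t : ℝ, HasDerivAt G (((t : ℂ) - z)⁻¹ * (((t : ℂ) - w) ^ 2)⁻¹) t := by
    intro t
    have h1 := hasDerivAt_log_ofReal_sub hz t
    have h2 := hasDerivAt_log_ofReal_sub hw t
    have hz0 := ofReal_sub_ne_zero_of_im_ne_zero hz t
    have hw0 := ofReal_sub_ne_zero_of_im_ne_zero hw t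
    have h3 := ((Complex.ofRealCLM.hasDerivAt (x := t)).sub_const w).fun_inv hw0
    have h4 := ((h1.sub h2).div_const ((z - w) ^ 2)).add (h3.const_mul (z - w)⁻¹)
    refine h4.congr_deriv ?_
    simp only [ofRealCLM_apply, ofReal_one]
    field_simp
    ring
  have htop : Tendsto G atTop (𝓝 0) := by
    have h := (tendsto_log_ofReal_sub_atTop z).sub (tendsto_log_ofReal_sub_atTop w)
    have := (h.div_const ((z - w) ^ 2)).add
      ((tendsto_ofReal_sub_inv_atTop w).const_mul (z - w)⁻¹)
    simpa [hG] using this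
  have hbot : Tendsto G atBot (𝓝 (l / (z - w) ^ 2)) := by
    have := (hl.div_const ((z - w) ^ 2)).add
      ((tendsto_ofReal_sub_inv_atBot w).const_mul (z - w)⁻¹)
    simpa [hG] using this
  rw [integral_of_hasDerivAt_of_tendsto hderiv (integrable_inv_mul_inv_sq hz hw) hbot htop]
  ring

theorem integral_inv_mul_inv_sq {z w : ℂ} (hz : z.im < 0) (hw : 0 < w.im) :
    ∫ t : ℝ, ((t : ℂ) - z)⁻¹ * (((t : ℂ) - w) ^ 2)⁻¹ = -(2 * Real.pi * I) / (z - w) ^ 2 := by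
  refine integral_inv_mul_inv_sq_aux hz.ne hw.ne' (fun h => ?_) ?_
  · rw [h] at hz; linarith
  · have := (tendsto_log_ofReal_sub_atBot_of_im_neg hz).sub
      (tendsto_log_ofReal_sub_atBot_of_im_pos hw)
    simp only [sub_sub_sub_cancel_right] at this
    convert this using 2
    ring

theorem integral_inv_mul_inv_sq_eq_zero {z w : ℂ} (hz : 0 < z.im) (hw : 0 < w.im) :
    ∫ t : ℝ, ((t : ℂ) - z)⁻¹ * (((t : ℂ) - w) ^ 2)⁻¹ = 0 := by
  -- The partial fractions degenerate when the poles coincide; then -1/2 (t - z)⁻² is a primitive.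
  by_cases hzw : z = w
  · subst hzw
    have hderiv : ∀ t : ℝ, HasDerivAt (fun t : ℝ => -(1 / 2) * (((t : ℂ) - z)⁻¹) ^ 2)
        (((t : ℂ) - z)⁻¹ * (((t : ℂ) - z) ^ 2)⁻¹) t := by
      intro t
      have hz0 := ofReal_sub_ne_zero_of_im_ne_zero hz.ne' t
      have h3 := ((Complex.ofRealCLM.hasDerivAt (x := t)).sub_const z).fun_inv hz0
      refine ((h3.fun_pow 2).const_mul (-(1 / 2) : ℂ)).congr_deriv ?_
      simp only [ofRealCLM_apply, ofReal_one, Nat.cast_ofNat, Nat.add_one_sub_one, pow_one]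
      field_simp
    have h0 : ∀ {l : Filter ℝ}, Tendsto (fun t : ℝ => ((t : ℂ) - z)⁻¹) l (𝓝 0) →
        Tendsto (fun t : ℝ => -(1 / 2) * (((t : ℂ) - z)⁻¹) ^ 2) l (𝓝 0) := fun h => by
      simpa using (h.pow 2).const_mul (-(1 / 2) : ℂ)
    rw [integral_of_hasDerivAt_of_tendsto hderiv (integrable_inv_mul_inv_sq hz.ne' hz.ne')
      (h0 (tendsto_ofReal_sub_inv_atBot z)) (h0 (tendsto_ofReal_sub_inv_atTop z)), sub_zero]
  · have := (tendsto_log_ofReal_sub_atBot_of_im_pos hz).sub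
      (tendsto_log_ofReal_sub_atBot_of_im_pos hw)
    simp only [sub_sub_sub_cancel_right, sub_self] at this
    rw [integral_inv_mul_inv_sq_aux hz.ne' hw.ne' hzw this]
    simp

theorem integral_inv_sq_add {s : ℂ} (hs : 0 < s.re) :
    Integrable (fun t : ℝ => (((t : ℂ) ^ 2 + s ^ 2) ^ 2)⁻¹) ∧
    ∫ t : ℝ, (((t : ℂ) ^ 2 + s ^ 2) ^ 2)⁻¹ = Real.pi / (2 * s ^ 3) := by
  have hz : 0 < (I * s).im := by simpa using hs
  have hw : (-(I * s)).im < 0 := by simpa using hs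
  have hs0 : s ≠ 0 := fun h => by simp [h] at hs
  have hfac : ∀ t : ℝ, (t : ℂ) ^ 2 + s ^ 2 = ((t : ℂ) - I * s) * ((t : ℂ) - -(I * s)) := by
    intro t
    linear_combination (s ^ 2) * I_sq
  have hne : ∀ t : ℝ, (t : ℂ) ^ 2 + s ^ 2 ≠ 0 := fun t => by
    rw [hfac]
    exact mul_ne_zero (ofReal_sub_ne_zero_of_im_ne_zero hz.ne' t)
      (ofReal_sub_ne_zero_of_im_ne_zero hw.ne t)
  have hint : Integrable (fun t : ℝ => (((t : ℂ) ^ 2 + s ^ 2) ^ 2)⁻¹) := by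
    obtain ⟨C, hC, h1⟩ := exists_norm_inv_ofReal_sub_le hz.ne'
    obtain ⟨D, hD, h2⟩ := exists_norm_inv_ofReal_sub_le hw.ne
    refine ((integrable_mul_inv_ofReal_sub hz.ne' hw.ne).norm.const_mul (C * D)).mono' ?_
      (Eventually.of_forall fun t => ?_)
    · refine Continuous.aestronglyMeasurable ?_
      exact (((continuous_ofReal.pow 2).add continuous_const).pow 2).inv₀
        fun t => pow_ne_zero 2 (hne t)
    · rw [pow_two, mul_inv, norm_mul, hfac, mul_inv]
      refine mul_le_mul_of_nonneg_right ?_ (norm_nonneg _)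
      rw [norm_mul]
      have h3 : (1 + |t|)⁻¹ ≤ 1 := inv_le_one_of_one_le₀ (by linarith [abs_nonneg t])
      exact mul_le_mul ((h1 t).trans (mul_le_of_le_one_right hC.le h3))
        ((h2 t).trans (mul_le_of_le_one_right hD.le h3)) (norm_nonneg _) hC.le
  refine ⟨hint, ?_⟩
  -- The usual primitive, with arctan(t/s)/s replaced by logarithms with branch points ±is so that
  -- it makes sense for complex s.
  set G : ℝ → ℂ := fun t => (2 * s ^ 2)⁻¹ * ((t : ℂ) * ((t : ℂ) ^ 2 + s ^ 2)⁻¹ +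
    (log ((t : ℂ) - I * s) - log ((t : ℂ) - -(I * s))) / (2 * I * s)) with hG
  have hderiv : ∀ t : ℝ, HasDerivAt G (((t : ℂ) ^ 2 + s ^ 2) ^ 2)⁻¹ t := by
    intro t
    have h1 := hasDerivAt_log_ofReal_sub hz.ne' t
    have h2 := hasDerivAt_log_ofReal_sub hw.ne t
    have hz0 := ofReal_sub_ne_zero_of_im_ne_zero hz.ne' t
    have hw0 := ofReal_sub_ne_zero_of_im_ne_zero hw.ne t
    have h3 := Complex.ofRealCLM.hasDerivAt (x := t)
    have h4 := (h3.fun_pow 2).add_const (s ^ 2)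
    have h5 := h3.mul (h4.fun_inv (hne t))
    have h6 := (h5.add ((h1.sub h2).div_const (2 * I * s))).const_mul (2 * s ^ 2)⁻¹
    refine h6.congr_deriv ?_
    simp only [ofRealCLM_apply, ofReal_one]
    have h7 : ((t : ℂ) - I * s)⁻¹ - ((t : ℂ) - -(I * s))⁻¹ =
        2 * I * s * ((t : ℂ) ^ 2 + s ^ 2)⁻¹ := by
      rw [hfac]; field_simp; ring
    rw [h7]
    have := hne t
    field_simp
    ring
  have hlim : ∀ {l : Filter ℝ}, (∀ z : ℂ, Tendsto (fun t : ℝ => ((t : ℂ) - z)⁻¹) l (𝓝 0)) →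
      Tendsto (fun t : ℝ => (t : ℂ) * ((t : ℂ) ^ 2 + s ^ 2)⁻¹) l (𝓝 0) := by
    intro l h
    have h1 := ((h (I * s)).add (h (-(I * s)))).div_const 2
    simp only [add_zero, zero_div] at h1
    refine h1.congr fun t => ?_
    have hz0 := ofReal_sub_ne_zero_of_im_ne_zero hz.ne' t
    have hw0 := ofReal_sub_ne_zero_of_im_ne_zero hw.ne t
    rw [hfac]
    field_simp
    ring
  have htop : Tendsto G atTop (𝓝 0) := by
    have h := (tendsto_log_ofReal_sub_atTop (I * s)).sub (tendsto_log_ofReal_sub_atTop (-(I * s)))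
    have := ((hlim tendsto_ofReal_sub_inv_atTop).add (h.div_const (2 * I * s))).const_mul
      (2 * s ^ 2)⁻¹
    simpa [hG] using this
  have hbot : Tendsto G atBot
      (𝓝 ((2 * s ^ 2)⁻¹ * (0 + (-(Real.pi * I) - Real.pi * I) / (2 * I * s)))) := by
    have h := (tendsto_log_ofReal_sub_atBot_of_im_pos hz).sub
      (tendsto_log_ofReal_sub_atBot_of_im_neg hw)
    simp only [sub_sub_sub_cancel_right] at h
    exact ((hlim tendsto_ofReal_sub_inv_atBot).add (h.div_const (2 * I * s))).const_mul
      (2 * s ^ 2)⁻¹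
  rw [integral_of_hasDerivAt_of_tendsto hderiv hint hbot htop]
  have := I_ne_zero
  field_simp
  ring

end LineIntegrals

/-! ### The integral of the inverse square of a quadratic function over the complex plane. -/

section PlaneIntegral

theorem exists_sqrt_of_mem_slitPlane {D : ℂ} (hD : D ∈ slitPlane) :
    0 < (exp (log D / 2)).re ∧ exp (log D / 2) ^ 2 = D := by
  constructor
  · rw [exp_re]
    refine mul_pos (Real.exp_pos _) (Real.cos_pos_of_mem_Ioo ?_)
    have h1 : (log D / 2).im = arg D / 2 := by
      rw [show log D / 2 = log D / ((2 : ℝ) : ℂ) by norm_num, div_ofReal_im, log_im]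
    have h2 := neg_pi_lt_arg D
    have h3 : arg D < Real.pi := lt_of_le_of_ne (arg_le_pi D) (mem_slitPlane_iff_arg.1 hD).1
    rw [h1]
    constructor <;> linarith
  · rw [← exp_nat_mul]
    have : D ≠ 0 := slitPlane_ne_zero hD
    rw [show ((2 : ℕ) : ℂ) * (log D / 2) = log D by push_cast; ring, exp_log this]

/-- Let s be the principal root of the quadratic D. Completing the square gives s² = (x + iκ)² + (B
+ κ²), so (x + iκ)/s has derivative (B + κ²)/s³. As s/|x| → 1, this function runs from -1 to 1. -/
theorem integral_inv_sqrt_cube {κ : ℝ} {B : ℂ} {c : ℝ} (hc : 0 < c)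
    (hslit : ∀ x : ℝ, (x : ℂ) ^ 2 + 2 * I * κ * x + B ∈ slitPlane)
    (hbound : ∀ x : ℝ, c * (1 + x ^ 2) ≤ ‖(x : ℂ) ^ 2 + 2 * I * κ * x + B‖) :
    ∫ x : ℝ, (exp (log ((x : ℂ) ^ 2 + 2 * I * κ * x + B) / 2) ^ 3)⁻¹ = 2 / (B + κ ^ 2) := by
  set D : ℝ → ℂ := fun x => (x : ℂ) ^ 2 + 2 * I * κ * x + B with hD
  set s : ℝ → ℂ := fun x => exp (log (D x) / 2) with hs
  have hs2 : ∀ x, s x ^ 2 = D x := fun x => (exists_sqrt_of_mem_slitPlane (hslit x)).2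
  have hs0 : ∀ x, s x ≠ 0 := fun x => exp_ne_zero _
  have hne : B + (κ : ℂ) ^ 2 ≠ 0 := by
    intro h
    have h0 := hslit 0
    rw [eq_neg_of_add_eq_zero_left h] at h0
    rcases h0 with h0 | h0
    · simp [← ofReal_pow] at h0
      nlinarith [sq_nonneg κ]
    · simp [← ofReal_pow] at h0
  have hDc : Continuous D := by fun_prop
  have hsc : Continuous s := by
    refine continuous_exp.comp (Continuous.div_const ?_ 2)
    exact hDc.clog hslit
  have hDd : ∀ x : ℝ, HasDerivAt D (2 * (x + I * κ)) x := by
    intro x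
    have h3 := Complex.ofRealCLM.hasDerivAt (x := x)
    refine (((h3.fun_pow 2).add (h3.const_mul (2 * I * κ))).add_const B).congr_deriv ?_
    simp only [ofRealCLM_apply, ofReal_one, Nat.cast_ofNat, Nat.add_one_sub_one, pow_one]
    ring
  have hsd : ∀ x : ℝ, HasDerivAt s ((x + I * κ) / s x) x := by
    intro x
    have h1 := ((hDd x).clog_real (hslit x)).div_const 2
    refine h1.cexp.congr_deriv ?_
    change s x * _ = _
    rw [← hs2 x]
    have := hs0 x
    field_simp
  set G : ℝ → ℂ := fun x => (B + (κ : ℂ) ^ 2)⁻¹ * ((x + I * κ) / s x) with hG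
  have hderiv : ∀ x, HasDerivAt G ((s x ^ 3)⁻¹) x := by
    intro x
    have h3 := (Complex.ofRealCLM.hasDerivAt (x := x)).add_const (I * κ)
    refine ((h3.div (hsd x) (hs0 x)).const_mul (B + (κ : ℂ) ^ 2)⁻¹).congr_deriv ?_
    have h := hs0 x
    simp only [ofRealCLM_apply, ofReal_one]
    have h2 : s x ^ 2 = (x + I * κ) ^ 2 + (B + (κ : ℂ) ^ 2) := by
      rw [hs2]
      simp only [hD]
      linear_combination (-(κ : ℂ) ^ 2) * I_sq
    field_simp
    linear_combination h2
  have hint : Integrable fun x => (s x ^ 3)⁻¹ := by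
    refine (integrable_inv_one_add_sq.const_mul (c⁻¹ * (Real.sqrt c)⁻¹)).mono'
      ((hsc.pow 3).inv₀ fun x => pow_ne_zero 3 (hs0 x)).aestronglyMeasurable
      (Eventually.of_forall fun x => ?_)
    have h1 : c * (1 + x ^ 2) ≤ ‖s x‖ ^ 2 := by
      rw [← norm_pow, hs2]; exact hbound x
    have h2 : Real.sqrt c ≤ ‖s x‖ := by
      refine Real.sqrt_le_iff.2 ⟨norm_nonneg _, ?_⟩
      nlinarith [sq_nonneg x]
    have h3 : 0 < Real.sqrt c := Real.sqrt_pos.2 hc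
    rw [norm_inv, norm_pow, ← mul_inv, ← mul_inv]
    refine inv_anti₀ (mul_pos (mul_pos hc h3) (by positivity)) ?_
    rw [pow_succ, mul_right_comm]
    exact mul_le_mul h1 h2 h3.le (sq_nonneg _)
  -- behaviour at infinity
  have hratio : ∀ {l : Filter ℝ}, Tendsto (fun t : ℝ => ((t : ℂ) - 0)⁻¹) l (𝓝 0) →
      (∀ᶠ x in l, x ≠ 0) → Tendsto (fun x : ℝ => s x / |x|) l (𝓝 1) := by
    intro l hl hl0
    rw [show (fun t : ℝ => ((t : ℂ) - 0)⁻¹) = fun t : ℝ => (t : ℂ)⁻¹ by simp] at hl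
    have h1 : Tendsto (fun x : ℝ => D x / ((x ^ 2 : ℝ) : ℂ)) l (𝓝 1) := by
      have := ((hl.const_mul (2 * I * κ)).add ((hl.pow 2).const_mul B)).const_add 1
      simp only [mul_zero, add_zero, ne_eq, OfNat.ofNat_ne_zero, not_false_eq_true,
        zero_pow] at this
      refine this.congr' ?_
      filter_upwards [hl0] with x hx
      have : (x : ℂ) ≠ 0 := by exact_mod_cast hx
      simp only [hD]
      push_cast
      field_simp
      ring
    have h2 : Tendsto (fun x : ℝ => exp (log (D x / ((x ^ 2 : ℝ) : ℂ)) / 2)) l (𝓝 1) := by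
      have h4 : ContinuousAt (fun w : ℂ => exp (log w / 2)) 1 :=
        ((continuousAt_clog one_mem_slitPlane).div_const 2).cexp
      have := h4.tendsto.comp h1
      simp only [log_one, zero_div, exp_zero] at this
      exact this
    refine h2.congr' ?_
    filter_upwards [hl0] with x hx
    have hx2 : 0 < (x ^ 2)⁻¹ := by positivity
    have habs : (0 : ℝ) < |x| := abs_pos.2 hx
    rw [div_eq_mul_inv (D x), ← ofReal_inv, mul_comm, log_ofReal_mul hx2
      (slitPlane_ne_zero (hslit x)), add_div, exp_add, mul_comm]
    simp only [hs]
    rw [div_eq_mul_inv]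
    congr 1
    rw [show ((Real.log (x ^ 2)⁻¹ : ℝ) : ℂ) / 2 = ((-Real.log |x| : ℝ) : ℂ) by
      rw [Real.log_inv, ← sq_abs, Real.log_pow]; push_cast; ring]
    rw [← ofReal_exp, Real.exp_neg, Real.exp_log habs, ofReal_inv]
  have hG2 : ∀ {l : Filter ℝ} {ε : ℂ}, Tendsto (fun t : ℝ => ((t : ℂ) - 0)⁻¹) l (𝓝 0) →
      (∀ᶠ x : ℝ in l, x ≠ 0) → (∀ᶠ x : ℝ in l, (x : ℂ) = ε * (|x| : ℝ)) →
      Tendsto G l (𝓝 ((B + (κ : ℂ) ^ 2)⁻¹ * ε)) := by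
    intro l ε hl hl0 hsgn
    refine Tendsto.const_mul _ ?_
    have h1 := hratio hl hl0
    have h2 : Tendsto (fun x : ℝ => ε * (1 + I * κ * ((x : ℂ) - 0)⁻¹)) l (𝓝 ε) := by
      simpa using ((hl.const_mul (I * κ)).const_add 1).const_mul ε
    have h3 := h2.div h1 one_ne_zero
    rw [div_one] at h3
    refine h3.congr' ?_
    filter_upwards [hl0, hsgn] with x hx hx2
    have hx' : (x : ℂ) ≠ 0 := by exact_mod_cast hx
    have habs : ((|x| : ℝ) : ℂ) ≠ 0 := by exact_mod_cast (abs_pos.2 hx).ne'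
    have := hs0 x
    simp only [Pi.div_apply, sub_zero]
    field_simp
    linear_combination (-(x : ℂ) - I * κ) * hx2
  have htop := hG2 (ε := 1) (tendsto_ofReal_sub_inv_atTop 0) (eventually_ne_atTop 0) (by
    filter_upwards [eventually_ge_atTop 0] with x hx
    rw [abs_of_nonneg hx, one_mul])
  have hbot := hG2 (ε := -1) (tendsto_ofReal_sub_inv_atBot 0) (eventually_ne_atBot 0) (by
    filter_upwards [eventually_le_atBot 0] with x hx
    rw [abs_of_nonpos hx]; push_cast; ring)
  rw [integral_of_hasDerivAt_of_tendsto hderiv hint hbot htop]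
  field_simp
  ring

theorem integrable_inv_sq_of_le {E : Type*} [NormedAddCommGroup E] [NormedSpace ℝ E]
    [FiniteDimensional ℝ E] [MeasurableSpace E] [BorelSpace E] (μ : Measure E)
    [μ.IsAddHaarMeasure] (hE : Module.finrank ℝ E < 4) {Q : E → ℂ} (hQ : Continuous Q) {c : ℝ}
    (hc : 0 < c) (hbound : ∀ ζ, c * (1 + ‖ζ‖ ^ 2) ≤ ‖Q ζ‖) :
    Integrable (fun ζ => (Q ζ ^ 2)⁻¹) μ := by
  have h4 : (Module.finrank ℝ E : ℝ) < 4 := by exact_mod_cast hE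
  have h0 : ∀ ζ, Q ζ ≠ 0 := fun ζ => norm_pos_iff.1 ((by positivity : 0 < c * (1 + ‖ζ‖ ^ 2)).trans_le (hbound ζ))
  refine ((integrable_rpow_neg_one_add_norm_sq (μ := μ) h4).const_mul ((c ^ 2)⁻¹)).mono'
    ((hQ.pow 2).inv₀ fun ζ => pow_ne_zero 2 (h0 ζ)).aestronglyMeasurable
    (Eventually.of_forall fun ζ => ?_)
  have h5 : (1 + ‖ζ‖ ^ 2) ^ (-(4 : ℝ) / 2) = ((1 + ‖ζ‖ ^ 2) ^ 2)⁻¹ := by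
    rw [show (-(4 : ℝ) / 2) = -((2 : ℕ) : ℝ) by norm_num, Real.rpow_neg (by positivity),
      Real.rpow_natCast]
  rw [h5, norm_inv, norm_pow, ← mul_inv, ← mul_pow]
  exact inv_anti₀ (by positivity) (pow_le_pow_left₀ (by positivity) (hbound ζ) 2)

theorem integral_inv_quadratic_sq_of_normal_form {κ : ℝ} {B : ℂ} {c : ℝ} (hc : 0 < c)
    (hbound : ∀ ζ : ℂ, c * (1 + ‖ζ‖ ^ 2) ≤ ‖(‖ζ‖ : ℂ) ^ 2 + 2 * I * κ * ζ.re + B‖) :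
    ∫ ζ : ℂ, (((‖ζ‖ : ℂ) ^ 2 + 2 * I * κ * ζ.re + B) ^ 2)⁻¹ = Real.pi / (B + κ ^ 2) := by
  have hint : Integrable fun ζ : ℂ => (((‖ζ‖ : ℂ) ^ 2 + 2 * I * κ * ζ.re + B) ^ 2)⁻¹ :=
    integrable_inv_sq_of_le volume (by rw [Complex.finrank_real_complex]; norm_num) (by fun_prop)
      hc hbound
  have hmp := Complex.volume_preserving_equiv_real_prod.symm
  have hnorm : ∀ x y : ℝ, (‖(⟨x, y⟩ : ℂ)‖) ^ 2 = x ^ 2 + y ^ 2 := fun x y => by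
    rw [← normSq_eq_norm_sq, normSq_mk]; ring
  -- If D = D(x) were real and at most 0, the quadratic would vanish at x + i√(-D), against the
  -- lower bound. Hence the principal square root is available in the outer integral.
  have hslit : ∀ x : ℝ, (x : ℂ) ^ 2 + 2 * I * κ * x + B ∈ slitPlane := by
    intro x
    by_contra h
    rw [mem_slitPlane_iff, not_or, not_lt, not_not] at h
    set D := (x : ℂ) ^ 2 + 2 * I * κ * x + B with hD
    have h1 := hbound ⟨x, Real.sqrt (-D.re)⟩
    have h2 : (‖(⟨x, Real.sqrt (-D.re)⟩ : ℂ)‖ : ℂ) ^ 2 = (x : ℂ) ^ 2 + ((-D.re : ℝ) : ℂ) := by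
      rw [← ofReal_pow, hnorm, Real.sq_sqrt (by linarith)]; push_cast; ring
    have h3 : D = (D.re : ℂ) := Complex.ext rfl (by simpa using h.2)
    rw [h2] at h1
    have h4 : (x : ℂ) ^ 2 + ((-D.re : ℝ) : ℂ) + 2 * I * κ * x + B = 0 := by
      rw [ofReal_neg, ← h3, hD]; ring
    rw [h4, norm_zero] at h1
    have : 0 < c * (1 + ‖(⟨x, Real.sqrt (-D.re)⟩ : ℂ)‖ ^ 2) := by positivity
    linarith
  have hbd : ∀ x : ℝ, c * (1 + x ^ 2) ≤ ‖(x : ℂ) ^ 2 + 2 * I * κ * x + B‖ := by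
    intro x
    have := hbound x
    simpa [← ofReal_pow] using this
  rw [← hmp.integral_comp' (g := fun ζ : ℂ => (((‖ζ‖ : ℂ) ^ 2 + 2 * I * κ * ζ.re + B) ^ 2)⁻¹)]
  rw [Measure.volume_eq_prod, integral_prod]
  swap
  · rw [← Measure.volume_eq_prod]
    exact (hmp.integrable_comp_emb (MeasurableEquiv.measurableEmbedding _)).2 hint
  have hinner : ∀ x : ℝ, ∫ y : ℝ, (((‖measurableEquivRealProd.symm (x, y)‖ : ℂ) ^ 2 +
      2 * I * κ * (measurableEquivRealProd.symm (x, y)).re + B) ^ 2)⁻¹ =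
      (Real.pi / 2) * (exp (log ((x : ℂ) ^ 2 + 2 * I * κ * x + B) / 2) ^ 3)⁻¹ := by
    intro x
    obtain ⟨h1, h2⟩ := exists_sqrt_of_mem_slitPlane (hslit x)
    have := (integral_inv_sq_add h1).2
    rw [h2] at this
    have h5 : ∀ y : ℝ, (((‖measurableEquivRealProd.symm (x, y)‖ : ℂ) ^ 2 +
      2 * I * κ * (measurableEquivRealProd.symm (x, y)).re + B) ^ 2)⁻¹ =
      (((y : ℂ) ^ 2 + ((x : ℂ) ^ 2 + 2 * I * κ * x + B)) ^ 2)⁻¹ := by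
      intro y
      rw [show measurableEquivRealProd.symm (x, y) = ⟨x, y⟩ from rfl, ← ofReal_pow, hnorm]
      push_cast
      congr 2
      ring
    simp_rw [h5]
    rw [this]
    have := exp_ne_zero (log ((x : ℂ) ^ 2 + 2 * I * κ * x + B) / 2)
    field_simp
  simp_rw [hinner]
  rw [integral_const_mul, integral_inv_sqrt_cube hc hslit hbd]
  ring

/-- The plane integral of the inverse square of a quadratic function without zeros. -/
theorem integral_inv_quadratic_sq {p α β B : ℂ} {c : ℝ} (hp : p ≠ 0) (hc : 0 < c)
    (hbound : ∀ ζ : ℂ, c * (1 + ‖ζ‖ ^ 2) ≤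
      ‖p * (‖ζ‖ : ℂ) ^ 2 + α * ζ + β * (starRingEnd ℂ) ζ + B‖) :
    ∫ ζ : ℂ, ((p * (‖ζ‖ : ℂ) ^ 2 + α * ζ + β * (starRingEnd ℂ) ζ + B) ^ 2)⁻¹ =
      Real.pi / (p * B - α * β) := by
  -- The linear part is p(2 Re(c₁ζ) + 2i Im(dζ)). Translating by the conjugate of c₁ completes the
  -- square and absorbs the real part, and a rotation taking d to i‖d‖ turns the rest into 2iκ Re ζ
  -- with κ = ‖d‖.
  set c₁ : ℂ := (α / p + (starRingEnd ℂ) (β / p)) / 2 with hc₁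
  set d : ℂ := (α / p - (starRingEnd ℂ) (β / p)) / 2 with hd
  have hα : α = p * (c₁ + d) := by rw [hc₁, hd]; field_simp; ring
  have hβ : β = p * ((starRingEnd ℂ) c₁ - (starRingEnd ℂ) d) := by
    rw [hc₁, hd]; simp [map_ofNat]; field_simp; ring
  obtain ⟨u, hu⟩ : ∃ u : Circle, d * u = I * ‖d‖ := by
    by_cases h0 : d = 0
    · exact ⟨1, by simp [h0]⟩
    · have h1 : (‖d‖ : ℂ) ≠ 0 := by exact_mod_cast (norm_pos_iff.2 h0).ne'
      refine ⟨⟨I * ‖d‖ / d, ?_⟩, ?_⟩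
      · refine mem_sphere_zero_iff_norm.2 ?_
        have h2 : ‖d‖ ≠ 0 := (norm_pos_iff.2 h0).ne'
        simp [h2]
      · field_simp
  set B' : ℂ := B / p - c₁ * (starRingEnd ℂ) c₁ - d * (starRingEnd ℂ) c₁ +
    (starRingEnd ℂ) d * c₁ with hB'
  have hkey : ∀ ζ : ℂ, p * (‖(u : ℂ) * ζ - (starRingEnd ℂ) c₁‖ : ℂ) ^ 2 +
      α * ((u : ℂ) * ζ - (starRingEnd ℂ) c₁) +
      β * (starRingEnd ℂ) ((u : ℂ) * ζ - (starRingEnd ℂ) c₁) + B =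
      p * ((‖ζ‖ : ℂ) ^ 2 + 2 * I * (‖d‖ : ℝ) * ζ.re + B') := by
    intro ζ
    have hu1 : (u : ℂ) * (starRingEnd ℂ) (u : ℂ) = 1 := by
      rw [mul_conj]; simp
    have hu2 : (starRingEnd ℂ) d * (starRingEnd ℂ) (u : ℂ) = -(I * ‖d‖) := by
      rw [← map_mul, hu]; simp
    rw [← mul_conj', ← mul_conj', re_eq_add_conj, hα, hβ, hB']
    simp only [map_sub, map_mul, conj_conj]
    field_simp
    linear_combination (p * ζ * (starRingEnd ℂ) ζ) * hu1 + p * ζ * hu -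
      p * (starRingEnd ℂ) ζ * hu2
  have hbound' : ∃ c' : ℝ, 0 < c' ∧ ∀ ζ : ℂ, c' * (1 + ‖ζ‖ ^ 2) ≤
      ‖(‖ζ‖ : ℂ) ^ 2 + 2 * I * (‖d‖ : ℝ) * ζ.re + B'‖ := by
    refine ⟨c / (2 * (1 + ‖c₁‖ ^ 2) * ‖p‖), by have := norm_pos_iff.2 hp; positivity,
      fun ζ => ?_⟩
    have h1 := hbound ((u : ℂ) * ζ - (starRingEnd ℂ) c₁)
    rw [hkey, norm_mul] at h1
    have hp' := norm_pos_iff.2 hp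
    have h2 : ‖ζ‖ ≤ ‖(u : ℂ) * ζ - (starRingEnd ℂ) c₁‖ + ‖c₁‖ := by
      have := norm_add_le ((u : ℂ) * ζ - (starRingEnd ℂ) c₁) ((starRingEnd ℂ) c₁)
      rwa [sub_add_cancel, norm_mul, Circle.norm_coe, one_mul, RCLike.norm_conj] at this
    rw [div_mul_eq_mul_div, div_le_iff₀ (by positivity)]
    have h3 : 1 + ‖ζ‖ ^ 2 ≤ 2 * (1 + ‖c₁‖ ^ 2) *
        (1 + ‖(u : ℂ) * ζ - (starRingEnd ℂ) c₁‖ ^ 2) := by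
      have := pow_le_pow_left₀ (norm_nonneg _) h2 2
      nlinarith [sq_nonneg (‖(u : ℂ) * ζ - (starRingEnd ℂ) c₁‖ - ‖c₁‖),
        mul_nonneg (sq_nonneg ‖c₁‖) (sq_nonneg ‖(u : ℂ) * ζ - (starRingEnd ℂ) c₁‖)]
    calc c * (1 + ‖ζ‖ ^ 2) ≤ c * (2 * (1 + ‖c₁‖ ^ 2) *
        (1 + ‖(u : ℂ) * ζ - (starRingEnd ℂ) c₁‖ ^ 2)) := by gcongr
      _ = (2 * (1 + ‖c₁‖ ^ 2)) *
        (c * (1 + ‖(u : ℂ) * ζ - (starRingEnd ℂ) c₁‖ ^ 2)) := by ring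
      _ ≤ (2 * (1 + ‖c₁‖ ^ 2)) * (‖p‖ * ‖(‖ζ‖ : ℂ) ^ 2 + 2 * I * (‖d‖ : ℝ) * ζ.re + B'‖) := by
        gcongr
      _ = _ := by ring
  obtain ⟨c', hc', hb'⟩ := hbound'
  rw [← integral_sub_right_eq_self _ ((starRingEnd ℂ) c₁)]
  have hrot := (rotation u).measurePreserving
  rw [← hrot.integral_comp (rotation u).toHomeomorph.measurableEmbedding]
  simp only [rotation_apply]
  simp_rw [hkey, mul_pow, mul_inv]
  rw [integral_const_mul, integral_inv_quadratic_sq_of_normal_form hc' hb']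
  have hfin : B' + (‖d‖ : ℂ) ^ 2 = (p * B - α * β) / p ^ 2 := by
    rw [← mul_conj', hα, hβ, hB']
    field_simp
    ring
  rw [hfin]
  field_simp

end PlaneIntegral

/-! ### The tubes as sets of matrices with definite Hermitian part, and 1/N as an integral of plane
waves. -/

namespace ComplexQuaternion

/-- The sesquilinear form `x* M x` at `x = (a, b)`. -/
def sesq (M : HC) (a b : ℂ) : ℂ :=
  (starRingEnd ℂ) a * (M 0 0 * a + M 0 1 * b) + (starRingEnd ℂ) b * (M 1 0 * a + M 1 1 * b)

/-- The real part of the form `x* M x` is bounded below by `δ |x|²`. -/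
def Accretive (δ : ℝ) (M : HC) : Prop :=
  ∀ a b : ℂ, δ * (‖a‖ ^ 2 + ‖b‖ ^ 2) ≤ (sesq M a b).re

theorem N_eq (M : HC) : N M = M 0 0 * M 1 1 - M 0 1 * M 1 0 := Matrix.det_fin_two M

theorem N_neg (M : HC) : N (-M) = N M := by simp [N_eq]

theorem sesq_sub (M M' : HC) (a b : ℂ) : sesq (M - M') a b = sesq M a b - sesq M' a b := by
  simp [sesq]; ring

theorem sesq_add (M M' : HC) (a b : ℂ) : sesq (M + M') a b = sesq M a b + sesq M' a b := by
  simp [sesq]; ring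

theorem sesq_neg (M : HC) (a b : ℂ) : sesq (-M) a b = -sesq M a b := by
  simp [sesq]; ring

theorem sesq_mink_re (y : EuclideanSpace ℝ (Fin 4)) (a b : ℂ) : (sesq (mink y) a b).re = 0 := by
  rw [mink_eq]
  simp [sesq]
  ring

theorem Accretive.mink_sub {δ : ℝ} {M : HC} (h : Accretive δ (-M))
    (y : EuclideanSpace ℝ (Fin 4)) : Accretive δ (mink y - M) := by
  intro a b
  rw [sub_eq_add_neg, sesq_add, add_re, sesq_mink_re, zero_add]
  exact h a b

/-- A column x of the adjugate satisfies Mx = N(M)e for a basis vector e. Testing the form on x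
gives δ|x|² ≤ |N(M)||x|, and the two columns contain all entries of M up to sign. -/
theorem Accretive.mul_norm_le_norm_N {δ : ℝ} {M : HC} (hδ : 0 < δ) (h : Accretive δ M)
    (i j : Fin 2) : δ * ‖M i j‖ ≤ ‖N M‖ := by
  have key : ∀ a b : ℂ, (δ * (‖a‖ ^ 2 + ‖b‖ ^ 2) ≤ ‖N M‖ * ‖a‖ ∨
      δ * (‖a‖ ^ 2 + ‖b‖ ^ 2) ≤ ‖N M‖ * ‖b‖) → δ * ‖a‖ ≤ ‖N M‖ ∧ δ * ‖b‖ ≤ ‖N M‖ := by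
    intro a b hab
    have ha := norm_nonneg a
    have hb := norm_nonneg b
    have hN := norm_nonneg (N M)
    have sq : ∀ {u v : ℝ}, 0 ≤ u → 0 ≤ v → δ * (u ^ 2 + v ^ 2) ≤ ‖N M‖ * u →
        δ * u ≤ ‖N M‖ ∧ δ * v ≤ ‖N M‖ := by
      intro u v hu hv huv
      have h1 : δ * u ≤ ‖N M‖ := by
        rcases hu.eq_or_lt with h0 | h0
        · simp [← h0]
        · refine le_of_mul_le_mul_right ?_ h0
          nlinarith [sq_nonneg v, mul_nonneg hδ.le (sq_nonneg v)]
      refine ⟨h1, ?_⟩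
      refine le_of_pow_le_pow_left₀ two_ne_zero hN ?_
      have h2 : δ * (δ * v ^ 2) ≤ δ * (‖N M‖ * u) := by
        refine mul_le_mul_of_nonneg_left ?_ hδ.le
        nlinarith [mul_nonneg hδ.le (sq_nonneg u)]
      nlinarith [mul_le_mul_of_nonneg_left h1 hN]
    rcases hab with hab | hab
    · exact sq ha hb hab
    · rw [add_comm] at hab
      exact (sq hb ha hab).symm
  have h1 := h (M 1 1) (-M 1 0)
  have h2 := h (-M 0 1) (M 0 0)
  have e1 : sesq M (M 1 1) (-M 1 0) = (starRingEnd ℂ) (M 1 1) * N M := by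
    rw [sesq, N_eq]; simp; ring
  have e2 : sesq M (-M 0 1) (M 0 0) = (starRingEnd ℂ) (M 0 0) * N M := by
    rw [sesq, N_eq]; simp; ring
  rw [e1] at h1
  rw [e2] at h2
  have h1' := key _ _ (Or.inl (h1.trans ((re_le_norm _).trans (by
    rw [norm_mul, RCLike.norm_conj, mul_comm]))))
  have h2' := key _ _ (Or.inr (h2.trans ((re_le_norm _).trans (by
    rw [norm_mul, RCLike.norm_conj, mul_comm]))))
  rw [norm_neg] at h1' h2'
  fin_cases i <;> fin_cases j
  · exact h2'.2
  · exact h2'.1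
  · exact h1'.2
  · exact h1'.1

theorem Accretive.sq_le_norm_N {δ : ℝ} {M : HC} (hδ : 0 < δ) (h : Accretive δ M) :
    δ ^ 2 ≤ ‖N M‖ := by
  have h1 := h.mul_norm_le_norm_N hδ 0 0
  have h2 := h 1 0
  have h3 : sesq M 1 0 = M 0 0 := by simp [sesq]
  rw [h3] at h2
  have h4 := re_le_norm (M 0 0)
  norm_num at h2
  nlinarith

theorem Accretive.N_ne_zero {δ : ℝ} {M : HC} (hδ : 0 < δ) (h : Accretive δ M) : N M ≠ 0 :=
  norm_pos_iff.1 ((by positivity : 0 < δ ^ 2).trans_le (h.sq_le_norm_N hδ))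

theorem Accretive.norm_sesq {δ : ℝ} {M : HC} (h : Accretive δ M) (a b : ℂ) :
    δ * (‖a‖ ^ 2 + ‖b‖ ^ 2) ≤ ‖sesq M a b‖ := (h a b).trans (re_le_norm _)

theorem norm_le_sum_entries (y : EuclideanSpace ℝ (Fin 4)) :
    ‖y‖ ≤ ∑ i, ∑ j, ‖mink y i j‖ := by
  refine le_of_pow_le_pow_left₀ two_ne_zero (by positivity) ?_
  have h : ∑ i, ∑ j, ‖mink y i j‖ ^ 2 = 2 * ‖y‖ ^ 2 := by
    rw [EuclideanSpace.real_norm_sq_eq, mink_eq]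
    simp only [Fin.sum_univ_two, Fin.sum_univ_four, ← normSq_eq_norm_sq, normSq_apply]
    simp
    ring
  simp only [Fin.sum_univ_two] at h ⊢
  nlinarith [sq_nonneg ‖y‖, norm_nonneg (mink y 0 0), norm_nonneg (mink y 0 1),
    norm_nonneg (mink y 1 0), norm_nonneg (mink y 1 1),
    mul_nonneg (norm_nonneg (mink y 0 0)) (norm_nonneg (mink y 0 1)),
    mul_nonneg (norm_nonneg (mink y 0 0)) (norm_nonneg (mink y 1 0)),
    mul_nonneg (norm_nonneg (mink y 0 0)) (norm_nonneg (mink y 1 1)),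
    mul_nonneg (norm_nonneg (mink y 0 1)) (norm_nonneg (mink y 1 0)),
    mul_nonneg (norm_nonneg (mink y 0 1)) (norm_nonneg (mink y 1 1)),
    mul_nonneg (norm_nonneg (mink y 1 0)) (norm_nonneg (mink y 1 1))]

theorem norm_mink_apply_le (y : EuclideanSpace ℝ (Fin 4)) (i j : Fin 2) :
    ‖mink y i j‖ ≤ 2 * ‖y‖ := by
  refine le_of_pow_le_pow_left₀ two_ne_zero (by positivity) ?_
  rw [mul_pow, EuclideanSpace.real_norm_sq_eq, mink_eq, ← normSq_eq_norm_sq, normSq_apply,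
    Fin.sum_univ_four]
  fin_cases i <;> fin_cases j <;> simp <;>
    nlinarith [sq_nonneg (y 0 - y 3), sq_nonneg (y 0 + y 3), sq_nonneg (y 1), sq_nonneg (y 2),
      sq_nonneg (y 0), sq_nonneg (y 3)]

/-- A point Y of M is anti-Hermitian and does not change the real part of the form, so Y - Z is
accretive with the same δ for every Y and its entries are at most |N(Y - Z)|/δ. This linear lower
bound, which is only linear because of the null directions, is the source of all decay estimates. -/
theorem Accretive.exists_le_norm_N_mink_sub {δ : ℝ} {Z : HC} (hδ : 0 < δ) (h : Accretive δ (-Z)) :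
    ∃ c : ℝ, 0 < c ∧ ∀ y, c * (1 + ‖y‖) ≤ ‖N (mink y - Z)‖ := by
  set S : ℝ := ∑ i, ∑ j, ‖Z i j‖ with hS
  have hS0 : 0 ≤ S := by positivity
  have hC : 0 < 4 / δ + (1 + S) / δ ^ 2 := by positivity
  refine ⟨(4 / δ + (1 + S) / δ ^ 2)⁻¹, inv_pos.2 hC, fun y => ?_⟩
  rw [inv_mul_le_iff₀ hC]
  have hM := h.mink_sub y
  have h1 := norm_le_sum_entries y
  have h2 : ∀ i j, ‖mink y i j‖ ≤ ‖N (mink y - Z)‖ / δ + ‖Z i j‖ := by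
    intro i j
    have h3 := hM.mul_norm_le_norm_N hδ i j
    have h4 : ‖(mink y - Z) i j‖ ≤ ‖N (mink y - Z)‖ / δ := by
      rw [le_div_iff₀ hδ, mul_comm]; exact h3
    have h5 := norm_add_le ((mink y - Z) i j) (Z i j)
    rw [Matrix.sub_apply, sub_add_cancel, ← Matrix.sub_apply] at h5
    linarith
  have h6 : ‖y‖ ≤ 4 * (‖N (mink y - Z)‖ / δ) + S := by
    have := h2 0 0
    have := h2 0 1
    have := h2 1 0
    have := h2 1 1
    simp only [hS, Fin.sum_univ_two] at h1 ⊢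
    linarith
  have h7 := hM.sq_le_norm_N hδ
  have h8 : (1 + S) ≤ (1 + S) / δ ^ 2 * ‖N (mink y - Z)‖ := by
    rw [div_mul_eq_mul_div, le_div_iff₀ (by positivity)]
    exact mul_le_mul_of_nonneg_left h7 (by positivity)
  have h9 : 4 * (‖N (mink y - Z)‖ / δ) = 4 / δ * ‖N (mink y - Z)‖ := by ring
  rw [add_mul]
  linarith

theorem two_mul_re_sesq_neg (Z : HC) (a b : ℂ) :
    2 * (sesq (-Z) a b).re = -((Z 0 0 + Z 1 1).re * (‖a‖ ^ 2 + ‖b‖ ^ 2) +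
      (Z 0 0 - Z 1 1).re * (‖a‖ ^ 2 - ‖b‖ ^ 2) +
      (Z 0 1 + Z 1 0).re * (2 * (a.re * b.re + a.im * b.im)) +
      (Z 1 0 - Z 0 1).im * (2 * (a.re * b.im - a.im * b.re))) := by
  rw [← normSq_eq_norm_sq, ← normSq_eq_norm_sq, normSq_apply, normSq_apply]
  simp [sesq]
  ring

/-- Positivity of the form `-Re x* Z x` in terms of the entries of `Z`. -/
theorem lt_of_re_sesq_neg_pos {Z : HC} (h : ∀ a b : ℂ, a ≠ 0 ∨ b ≠ 0 → 0 < (sesq (-Z) a b).re) :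
    (Z 0 0 + Z 1 1).re < 0 ∧ (Z 0 0 - Z 1 1).re ^ 2 + (Z 0 1 + Z 1 0).re ^ 2 +
      (Z 1 0 - Z 0 1).im ^ 2 < (Z 0 0 + Z 1 1).re ^ 2 := by
  have hform := two_mul_re_sesq_neg Z
  set v0 := (Z 0 0 + Z 1 1).re with hv0
  set v3 := (Z 0 0 - Z 1 1).re with hv3
  set v1 := (Z 0 1 + Z 1 0).re with hv1
  set v2 := (Z 1 0 - Z 0 1).im with hv2
  have h1 := h 1 0 (Or.inl one_ne_zero)
  have h2 := h 0 1 (Or.inr one_ne_zero)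
  have e1 := hform 1 0
  have e2 := hform 0 1
  simp only [norm_one, norm_zero, one_re, one_im, zero_re, zero_im] at e1 e2
  have h5 : v0 + v3 < 0 := by linarith
  refine ⟨by linarith, ?_⟩
  -- On this vector twice the form equals -(v0 + v3)(v0² - v1² - v2² - v3²), and v0 + v3 < 0.
  have h3 := h ⟨-v1, v2⟩ ((v0 + v3 : ℝ) : ℂ) (Or.inr (by exact_mod_cast h5.ne))
  have e3 := hform ⟨-v1, v2⟩ ((v0 + v3 : ℝ) : ℂ)
  simp only [← normSq_eq_norm_sq, normSq_apply, ofReal_re, ofReal_im] at e3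
  by_contra hcon
  push Not at hcon
  nlinarith [mul_nonneg_of_nonpos_of_nonpos h5.le
    (by linarith : v0 ^ 2 - (v3 ^ 2 + v1 ^ 2 + v2 ^ 2) ≤ 0)]

theorem accretive_neg_iff (Z : HC) : (∃ δ, 0 < δ ∧ Accretive δ (-Z)) ↔
    (Z 0 0 + Z 1 1).re < 0 ∧ (Z 0 0 - Z 1 1).re ^ 2 + (Z 0 1 + Z 1 0).re ^ 2 +
      (Z 1 0 - Z 0 1).im ^ 2 < (Z 0 0 + Z 1 1).re ^ 2 := by
  constructor
  · rintro ⟨δ, hδ, h⟩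
    refine lt_of_re_sesq_neg_pos fun a b hab => lt_of_lt_of_le (mul_pos hδ ?_) (h a b)
    rcases hab with hab | hab
    · have := norm_pos_iff.2 hab
      positivity
    · have := norm_pos_iff.2 hab
      positivity
  · have hform := two_mul_re_sesq_neg Z
    set v0 := (Z 0 0 + Z 1 1).re with hv0
    set v3 := (Z 0 0 - Z 1 1).re with hv3
    set v1 := (Z 0 1 + Z 1 0).re with hv1
    set v2 := (Z 1 0 - Z 0 1).im with hv2
    rintro ⟨h1, h2⟩
    set r := Real.sqrt (v3 ^ 2 + v1 ^ 2 + v2 ^ 2) with hr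
    have hr0 : 0 ≤ r := Real.sqrt_nonneg _
    have hr2 : r ^ 2 = v3 ^ 2 + v1 ^ 2 + v2 ^ 2 := Real.sq_sqrt (by positivity)
    have hrlt : r < -v0 := by
      refine lt_of_pow_lt_pow_left₀ 2 (by linarith) ?_
      rw [hr2]; linarith
    -- The smaller eigenvalue of the Hermitian part of -Z.
    refine ⟨(-v0 - r) / 2, by linarith, fun a b => ?_⟩
    have hf := hform a b
    set A := ‖a‖ ^ 2 with hA
    set B := ‖b‖ ^ 2 with hB
    have hA' : A = a.re * a.re + a.im * a.im := by
      rw [hA, ← normSq_eq_norm_sq, normSq_apply]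
    have hB' : B = b.re * b.re + b.im * b.im := by
      rw [hB, ← normSq_eq_norm_sq, normSq_apply]
    set P := 2 * (a.re * b.re + a.im * b.im) with hP
    set Q := 2 * (a.re * b.im - a.im * b.re) with hQ
    -- The identity behind the Hopf map; with it the lower bound is the Cauchy–Schwarz inequality in
    -- ℝ³.
    have hsq : (A - B) ^ 2 + P ^ 2 + Q ^ 2 = (A + B) ^ 2 := by
      rw [hA', hB', hP, hQ]; ring
    have hcs : v3 * (A - B) + v1 * P + v2 * Q ≤ r * (A + B) := by
      refine le_of_pow_le_pow_left₀ two_ne_zero (by positivity) ?_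
      rw [mul_pow, hr2, ← hsq]
      nlinarith [sq_nonneg (v3 * P - v1 * (A - B)), sq_nonneg (v3 * Q - v2 * (A - B)),
        sq_nonneg (v1 * Q - v2 * P)]
    nlinarith

/-- In Z = Y + iV the summand Y is anti-Hermitian and iV is Hermitian. The two inequalities defining
`coneC` say that iV is negative definite. -/
theorem mem_Tplus_iff (Z : HC) : Z ∈ Tplus ↔ ∃ δ, 0 < δ ∧ Accretive δ (-Z) := by
  rw [accretive_neg_iff]
  constructor
  · rintro ⟨Y, hY, V, ⟨hV, hN, hT⟩, rfl⟩
    rw [← range_mink] at hY hV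
    obtain ⟨y, rfl⟩ := hY
    obtain ⟨v, rfl⟩ := hV
    rw [N_mink, ofReal_re] at hN
    rw [trace_mink, ofReal_re] at hT
    simp only [mink_eq, Matrix.add_apply, Matrix.smul_apply, smul_eq_mul]
    simp
    constructor <;> nlinarith
  · rintro ⟨h1, h2⟩
    refine ⟨mink !₂[-(Z 0 0 + Z 1 1).im / 2, -(Z 0 1 + Z 1 0).im / 2, (Z 1 0 - Z 0 1).re / 2,
      -(Z 0 0 - Z 1 1).im / 2], ?_, mink !₂[(Z 0 0 + Z 1 1).re / 2, (Z 0 1 + Z 1 0).re / 2,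
      (Z 1 0 - Z 0 1).im / 2, (Z 0 0 - Z 1 1).re / 2], ⟨?_, ?_, ?_⟩, ?_⟩
    · rw [← range_mink]; exact Set.mem_range_self _
    · rw [← range_mink]; exact Set.mem_range_self _
    · rw [N_mink, ofReal_re]
      simp at h2 ⊢
      nlinarith
    · rw [trace_mink, ofReal_re]
      simp at h1 ⊢
      linarith
    · rw [mink_eq, mink_eq]
      ext i j
      fin_cases i <;> fin_cases j <;> apply Complex.ext <;> simp <;> ring

theorem neg_mem_Mink {Y : HC} (h : Y ∈ Mink) : -Y ∈ Mink := by
  have h' : Y.conjTranspose = -Y := h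
  change (-Y).conjTranspose = -(-Y)
  rw [Matrix.conjTranspose_neg, h']

theorem neg_mem_Tplus_iff (Z : HC) : -Z ∈ Tplus ↔ Z ∈ Tminus := by
  constructor
  · rintro ⟨Y, hY, V, hV, h⟩
    exact ⟨-Y, neg_mem_Mink hY, V, hV, by rw [← neg_neg Z, h]; abel⟩
  · rintro ⟨Y, hY, V, hV, h⟩
    exact ⟨-Y, neg_mem_Mink hY, V, hV, by rw [h]; abel⟩

theorem mem_Tminus_iff (Z : HC) : Z ∈ Tminus ↔ ∃ δ, 0 < δ ∧ Accretive δ Z := by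
  rw [← neg_mem_Tplus_iff, mem_Tplus_iff, neg_neg]

theorem isOpen_Tplus : IsOpen Tplus := by
  have : Tplus = {Z : HC | (Z 0 0 + Z 1 1).re < 0 ∧ (Z 0 0 - Z 1 1).re ^ 2 +
      (Z 0 1 + Z 1 0).re ^ 2 + (Z 1 0 - Z 0 1).im ^ 2 < (Z 0 0 + Z 1 1).re ^ 2} := by
    ext Z
    rw [mem_Tplus_iff, accretive_neg_iff]
    rfl
  rw [this]
  have hc : ∀ i j, Continuous fun Z : HC => Z i j := fun i j => continuous_id.matrix_elem i j
  refine IsOpen.and (isOpen_lt ?_ continuous_const) (isOpen_lt ?_ ?_)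
  · exact continuous_re.comp ((hc 0 0).add (hc 1 1))
  · exact (((continuous_re.comp ((hc 0 0).sub (hc 1 1))).pow 2).add
      ((continuous_re.comp ((hc 0 1).add (hc 1 0))).pow 2)).add
      ((continuous_im.comp ((hc 1 0).sub (hc 0 1))).pow 2)
  · exact (continuous_re.comp ((hc 0 0).add (hc 1 1))).pow 2

/-- The plane integral representation of `1 / N(W)`. -/
theorem integral_inv_sesq_sq {δ : ℝ} {W : HC} (hδ : 0 < δ) (h : Accretive δ W) :
    Integrable (fun ζ : ℂ => (sesq W 1 ζ ^ 2)⁻¹) ∧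
    ∫ ζ : ℂ, (sesq W 1 ζ ^ 2)⁻¹ = Real.pi / N W := by
  have e : ∀ ζ : ℂ, sesq W 1 ζ = W 1 1 * (‖ζ‖ : ℂ) ^ 2 + W 0 1 * ζ +
      W 1 0 * (starRingEnd ℂ) ζ + W 0 0 := by
    intro ζ
    rw [← mul_conj', sesq]
    simp
    ring
  have hb : ∀ ζ : ℂ, δ * (1 + ‖ζ‖ ^ 2) ≤ ‖sesq W 1 ζ‖ := fun ζ => by
    simpa using h.norm_sesq 1 ζ
  have hp : W 1 1 ≠ 0 := by
    have h2 := h.norm_sesq 0 1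
    have h3 : sesq W 0 1 = W 1 1 := by simp [sesq]
    rw [h3] at h2
    norm_num at h2
    exact norm_pos_iff.1 (hδ.trans_le h2)
  constructor
  · refine integrable_inv_sq_of_le volume (by rw [Complex.finrank_real_complex]; norm_num)
      ?_ hδ hb
    have : Continuous fun ζ : ℂ => sesq W 1 ζ := by
      simp only [sesq]
      fun_prop
    exact this
  · simp_rw [e] at hb ⊢
    rw [integral_inv_quadratic_sq hp hδ hb, N_eq]
    congr 1
    ring

end ComplexQuaternion

namespace ComplexQuaternion

/-! ### The substitution τ = ±√(m + t²) + t and an integrable majorant on the hyperboloid. -/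

section HyperbolicSubstitution

variable {m : ℝ}

theorem abs_lt_sqrt_add_sq (hm : 0 < m) (t : ℝ) : |t| < Real.sqrt (m + t ^ 2) := by
  rw [← Real.sqrt_sq_eq_abs]
  exact Real.sqrt_lt_sqrt (sq_nonneg t) (by linarith)

theorem image_sqrt_add (hm : 0 < m) :
    (fun t : ℝ => Real.sqrt (m + t ^ 2) + t) '' Set.univ = Set.Ioi 0 := by
  ext τ
  simp only [Set.image_univ, Set.mem_range, Set.mem_Ioi]
  constructor
  · rintro ⟨t, rfl⟩
    linarith [abs_lt_sqrt_add_sq hm t, neg_abs_le t]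
  · intro hτ
    refine ⟨(τ - m / τ) / 2, ?_⟩
    have : m + ((τ - m / τ) / 2) ^ 2 = ((τ + m / τ) / 2) ^ 2 := by
      field_simp; ring
    rw [this, Real.sqrt_sq (by positivity)]
    ring

theorem hasDerivAt_sqrt_add (hm : 0 < m) (t : ℝ) :
    HasDerivAt (fun t : ℝ => Real.sqrt (m + t ^ 2) + t)
      ((Real.sqrt (m + t ^ 2) + t) / Real.sqrt (m + t ^ 2)) t := by
  have h0 : 0 < m + t ^ 2 := by positivity
  have h1 := ((((hasDerivAt_id t).fun_pow 2).const_add m).sqrt h0.ne').add (hasDerivAt_id t)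
  refine h1.congr_deriv ?_
  have := Real.sqrt_pos.2 h0
  simp
  field_simp
  ring

theorem injOn_sqrt_add (hm : 0 < m) :
    Set.InjOn (fun t : ℝ => Real.sqrt (m + t ^ 2) + t) Set.univ := by
  have : StrictMono (fun t : ℝ => Real.sqrt (m + t ^ 2) + t) :=
    strictMono_of_hasDerivAt_pos (hasDerivAt_sqrt_add hm) fun t =>
      div_pos (by linarith [abs_lt_sqrt_add_sq hm t, neg_abs_le t]) (Real.sqrt_pos.2 (by positivity))
  exact this.injective.injOn

theorem abs_deriv_smul_sqrt_add (hm : 0 < m) (Φ : ℝ → ℂ) (t : ℝ) :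
    |(Real.sqrt (m + t ^ 2) + t) / Real.sqrt (m + t ^ 2)| •
      (Φ (Real.sqrt (m + t ^ 2) + t) / ((Real.sqrt (m + t ^ 2) + t : ℝ) : ℂ)) =
      Φ (Real.sqrt (m + t ^ 2) + t) / ((Real.sqrt (m + t ^ 2) : ℝ) : ℂ) := by
  have h1 : 0 < Real.sqrt (m + t ^ 2) + t := by
    linarith [abs_lt_sqrt_add_sq hm t, neg_abs_le t]
  have h2 : 0 < Real.sqrt (m + t ^ 2) := Real.sqrt_pos.2 (by positivity)
  rw [abs_of_pos (div_pos h1 h2), real_smul, ofReal_div]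
  have h3 : ((Real.sqrt (m + t ^ 2) + t : ℝ) : ℂ) ≠ 0 := by exact_mod_cast h1.ne'
  have h4 : ((Real.sqrt (m + t ^ 2) : ℝ) : ℂ) ≠ 0 := by exact_mod_cast h2.ne'
  field_simp

/-- For τ = √(m + t²) + t one has dτ/τ = dt/√(m + t²), and t ↦ τ is a bijection from ℝ onto the
positive half line. -/
theorem integral_comp_sqrt_add (hm : 0 < m) (Φ : ℝ → ℂ) :
    ∫ t : ℝ, Φ (Real.sqrt (m + t ^ 2) + t) / ((Real.sqrt (m + t ^ 2) : ℝ) : ℂ) =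
      ∫ τ in Set.Ioi (0 : ℝ), Φ τ / τ := by
  rw [← image_sqrt_add hm, integral_image_eq_integral_abs_deriv_smul MeasurableSet.univ
    (fun t _ => (hasDerivAt_sqrt_add hm t).hasDerivWithinAt) (injOn_sqrt_add hm)
    (fun τ => Φ τ / (τ : ℂ)), setIntegral_univ]
  simp_rw [abs_deriv_smul_sqrt_add hm]

theorem integrable_comp_sqrt_add (hm : 0 < m) {Φ : ℝ → ℂ}
    (h : Integrable fun τ : ℝ => Φ τ / τ) :
    Integrable fun t : ℝ => Φ (Real.sqrt (m + t ^ 2) + t) / ((Real.sqrt (m + t ^ 2) : ℝ) : ℂ) := by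
  have h1 : IntegrableOn (fun τ : ℝ => Φ τ / τ) (Set.Ioi 0) := h.integrableOn
  rw [← image_sqrt_add hm, integrableOn_image_iff_integrableOn_abs_deriv_smul MeasurableSet.univ
    (fun t _ => (hasDerivAt_sqrt_add hm t).hasDerivWithinAt) (injOn_sqrt_add hm)
    (fun τ => Φ τ / (τ : ℂ)), integrableOn_univ] at h1
  simp_rw [abs_deriv_smul_sqrt_add hm] at h1
  exact h1

/-- The hyperbolic substitution on both branches. -/
theorem integral_sub_comp_sqrt_add (hm : 0 < m) {Φ : ℝ → ℂ}
    (h : Integrable fun τ : ℝ => Φ τ / τ) :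
    ∫ t : ℝ, (Φ (Real.sqrt (m + t ^ 2) + t) / ((Real.sqrt (m + t ^ 2) : ℝ) : ℂ) -
      Φ (-Real.sqrt (m + t ^ 2) + t) / ((Real.sqrt (m + t ^ 2) : ℝ) : ℂ)) =
      ∫ τ : ℝ, Φ τ / τ := by
  -- The lower branch is the upper branch at -t for the reflected function, so it covers τ < 0; the
  -- minus sign between the branches matches the sign of 1/τ.
  have e : ∀ t : ℝ, Φ (-Real.sqrt (m + t ^ 2) + t) / ((Real.sqrt (m + t ^ 2) : ℝ) : ℂ) =
      (fun s : ℝ => (fun τ => Φ (-τ)) (Real.sqrt (m + s ^ 2) + s) /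
        ((Real.sqrt (m + s ^ 2) : ℝ) : ℂ)) (-t) := fun t => by
    simp only [even_two.neg_pow, neg_add_rev, neg_neg]
    rw [add_comm]
  have h' : Integrable fun τ : ℝ => (fun τ => Φ (-τ)) τ / (τ : ℂ) := by
    refine h.comp_neg.neg.congr (Eventually.of_forall fun τ => ?_)
    simp [div_neg]
  simp_rw [e]
  rw [integral_sub (integrable_comp_sqrt_add hm h) (integrable_comp_sqrt_add hm h').comp_neg,
    integral_neg_eq_self (fun s : ℝ => (fun τ => Φ (-τ)) (Real.sqrt (m + s ^ 2) + s) /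
        ((Real.sqrt (m + s ^ 2) : ℝ) : ℂ)) volume, integral_comp_sqrt_add hm,
    integral_comp_sqrt_add hm (fun τ => Φ (-τ))]
  have h2 : ∫ τ in Set.Ioi (0 : ℝ), Φ (-τ) / τ = -∫ τ in Set.Iic (0 : ℝ), Φ τ / τ := by
    have := integral_comp_neg_Ioi 0 (fun τ : ℝ => Φ τ / τ)
    rw [neg_zero] at this
    rw [← this, ← integral_neg]
    congr 1
    ext τ
    simp [div_neg]
  rw [h2, sub_neg_eq_add, add_comm, intervalIntegral.integral_Iic_add_Ioi h.integrableOn h.integrableOn]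

end HyperbolicSubstitution

/-- The splitting of `ℝ³` into the third coordinate and the plane of the first two. -/
def splitCoord (x : EuclideanSpace ℝ (Fin 3)) : ℝ × ℂ := (x 2, ⟨x 0, x 1⟩)

theorem splitCoord_eq : splitCoord = ⇑((MeasurableEquiv.toLp 2 (Fin 3 → ℝ)).symm.trans
    ((MeasurableEquiv.piFinSuccAbove (fun _ => ℝ) 2).trans
      (MeasurableEquiv.prodCongr (MeasurableEquiv.refl ℝ) measurableEquivPi.symm))) := by
  ext x
  · rfl
  · exact mk_eq_add_mul_I (x 0) (x 1)

theorem measurableEmbedding_splitCoord : MeasurableEmbedding splitCoord := by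
  rw [splitCoord_eq]; exact MeasurableEquiv.measurableEmbedding _

theorem measurePreserving_splitCoord : MeasurePreserving splitCoord := by
  rw [splitCoord_eq]
  exact (((MeasurePreserving.id volume).prod Complex.volume_preserving_equiv_pi.symm).comp
    (volume_preserving_piFinSuccAbove (fun _ : Fin 3 => ℝ) 2)).comp
    (EuclideanSpace.volume_preserving_symm_measurableEquiv_toLp (Fin 3))

theorem norm_sq_eq_splitCoord (x : EuclideanSpace ℝ (Fin 3)) :
    ‖x‖ ^ 2 = (splitCoord x).1 ^ 2 + ‖(splitCoord x).2‖ ^ 2 := by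
  rw [EuclideanSpace.real_norm_sq_eq, Fin.sum_univ_three, ← normSq_eq_norm_sq, splitCoord,
    normSq_mk]
  ring

theorem sheet_eq (R : ℝ) (x : EuclideanSpace ℝ (Fin 3)) :
    sheet R x = Real.sqrt (R ^ 2 + ‖(splitCoord x).2‖ ^ 2 + (splitCoord x).1 ^ 2) := by
  rw [sheet, norm_sq_eq_splitCoord]
  congr 1
  ring

/-- The common majorant of the kernel times a plane wave. The wave alone does not decay along its
null direction, which is why only this anisotropic decay is available. -/
theorem integrable_inv_sheet_sq_mul {R : ℝ} (hR : 0 < R) :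
    Integrable fun x : EuclideanSpace ℝ (Fin 3) =>
      (sheet R x ^ 2 * (R ^ 2 + ‖(splitCoord x).2‖ ^ 2))⁻¹ := by
  have h1 : Integrable fun t : ℝ => (1 + ‖t‖ ^ 2) ^ (-(3 / 2 : ℝ) / 2) :=
    integrable_rpow_neg_one_add_norm_sq (by simp; norm_num)
  have h2 : Integrable fun η : ℂ => (1 + ‖η‖ ^ 2) ^ (-(5 / 2 : ℝ) / 2) :=
    integrable_rpow_neg_one_add_norm_sq (by rw [Complex.finrank_real_complex]; norm_num)
  have h3 := h1.mul_prod h2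
  set c := min 1 (R ^ 2) with hc
  have hc0 : 0 < c := lt_min one_pos (by positivity)
  have h4 : Integrable fun z : ℝ × ℂ =>
      ((R ^ 2 + ‖z.2‖ ^ 2 + z.1 ^ 2) * (R ^ 2 + ‖z.2‖ ^ 2))⁻¹ := by
    refine (h3.const_mul ((c ^ 2)⁻¹)).mono' ?_ (Eventually.of_forall fun z => ?_)
    · refine Continuous.aestronglyMeasurable (Continuous.inv₀ (by fun_prop) fun z => ?_)
      positivity
    · have hA : 0 < 1 + ‖z.1‖ ^ 2 := by positivity
      have hB : 0 < 1 + ‖z.2‖ ^ 2 := by positivity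
      set A := 1 + ‖z.1‖ ^ 2 with hA'
      set B := 1 + ‖z.2‖ ^ 2 with hB'
      have e1 : c * B ≤ R ^ 2 + ‖z.2‖ ^ 2 := by
        have h5 := min_le_left 1 (R ^ 2)
        have h6 := min_le_right 1 (R ^ 2)
        rw [hB', mul_add, mul_one]
        exact add_le_add h6 (mul_le_of_le_one_left (sq_nonneg _) h5)
      have e2 : c * A ≤ R ^ 2 + ‖z.2‖ ^ 2 + z.1 ^ 2 := by
        have h5 := min_le_left 1 (R ^ 2)
        have h6 := min_le_right 1 (R ^ 2)
        rw [hA', mul_add, mul_one, Real.norm_eq_abs, sq_abs]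
        have := mul_le_of_le_one_left (sq_nonneg z.1) h5
        have := sq_nonneg ‖z.2‖
        linarith
      have e3 : c * B ≤ R ^ 2 + ‖z.2‖ ^ 2 + z.1 ^ 2 := by linarith [sq_nonneg z.1]
      set M := R ^ 2 + ‖z.2‖ ^ 2 + z.1 ^ 2 with hM
      have hMpos : 0 < M := by positivity
      -- M dominates both cA and cB, hence their weighted geometric mean. The weights leave A^(-3/4)
      -- on the line and B^(-5/4) on the plane, both integrable.
      have e4 : c * (A ^ (3 / 4 : ℝ) * B ^ (1 / 4 : ℝ)) ≤ M := by
        have h7 : (c * A) ^ (3 / 4 : ℝ) * (c * B) ^ (1 / 4 : ℝ) ≤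
            M ^ (3 / 4 : ℝ) * M ^ (1 / 4 : ℝ) := by gcongr
        rw [← Real.rpow_add hMpos, Real.mul_rpow hc0.le hA.le, Real.mul_rpow hc0.le hB.le,
          mul_mul_mul_comm, ← Real.rpow_add hc0] at h7
        norm_num at h7
        exact h7
      rw [Real.norm_of_nonneg (by positivity)]
      have e5 : (c ^ 2)⁻¹ * (A ^ (-(3 / 2 : ℝ) / 2) * B ^ (-(5 / 2 : ℝ) / 2)) =
          (c * (A ^ (3 / 4 : ℝ) * B ^ (1 / 4 : ℝ)) * (c * B))⁻¹ := by
        rw [show (-(3 / 2 : ℝ) / 2) = -(3 / 4) by norm_num,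
          show (-(5 / 2 : ℝ) / 2) = -(1 / 4 + 1) by norm_num, Real.rpow_neg hA.le,
          Real.rpow_neg hB.le, Real.rpow_add hB, Real.rpow_one]
        field_simp
      rw [e5]
      exact inv_anti₀ (by positivity) (mul_le_mul e4 e1 (by positivity) hMpos.le)
  refine ((measurePreserving_splitCoord.integrable_comp_emb measurableEmbedding_splitCoord).2
    h4).congr (Eventually.of_forall fun x => ?_)
  simp only [Function.comp_apply]
  rw [sheet_eq, Real.sq_sqrt (by positivity)]

end ComplexQuaternion

/-! ### The reproducing integral in horospherical coordinates. -/

namespace ComplexQuaternion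

/-- The point of the hyperboloid `N(Y) = -R²` with horospherical coordinates `(τ, η)`. -/
noncomputable def horoPoint (R τ : ℝ) (η : ℂ) : EuclideanSpace ℝ (Fin 4) :=
  !₂[(τ + (R ^ 2 + ‖η‖ ^ 2) / τ) / 2, η.re, η.im, (τ - (R ^ 2 + ‖η‖ ^ 2) / τ) / 2]

/-- `τ N(Y - Z)` at the point `Y` with horospherical coordinates `(τ, η)`. -/
noncomputable def horoQ (Z : HC) (R τ : ℝ) (η : ℂ) : ℂ :=
  I * Z 0 0 * (‖η‖ : ℂ) ^ 2 + (-(I * τ * Z 0 1)) * η + (-(I * τ * Z 1 0)) * (starRingEnd ℂ) η +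
    (I * τ ^ 2 * Z 1 1 + I * Z 0 0 * R ^ 2 + τ * (N Z - R ^ 2))

/-- On the hyperboloid N(Y) is constant, so N(Y - Z) is affine in Y, whose coordinates contain η
linearly and |η|² only through |η|²/τ. After multiplication by τ it is a quadratic function of η of
the shape required by `integral_inv_quadratic_sq`. -/
theorem mul_N_mink_horoPoint_sub (Z : HC) (R : ℝ) {τ : ℝ} (hτ : τ ≠ 0) (η : ℂ) :
    τ * N (mink (horoPoint R τ η) - Z) = horoQ Z R τ η := by
  have hτ' : (τ : ℂ) ≠ 0 := by exact_mod_cast hτ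
  have h1 : (‖η‖ : ℂ) ^ 2 = (η.re : ℂ) ^ 2 + (η.im : ℂ) ^ 2 := by
    rw [← ofReal_pow, ← normSq_eq_norm_sq, normSq_apply]; push_cast; ring
  have h2 : (starRingEnd ℂ) η = η.re - η.im * I := by
    apply Complex.ext <;> simp
  have h3 : -(I * τ * Z 0 1) * η = -(I * τ * Z 0 1) * (η.re + η.im * I) := by rw [re_add_im]
  rw [horoQ, h1, h2, h3, N_eq, N_eq, mink_eq]
  simp only [horoPoint, Matrix.sub_apply, Matrix.of_apply, Matrix.cons_val', Matrix.cons_val_zero,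
    Matrix.cons_val_one, Matrix.cons_val_fin_one, PiLp.toLp_apply, Matrix.cons_val]
  push_cast
  rw [h1]
  field_simp
  ring_nf
  simp only [I_sq]
  ring

theorem sesq_mink_one_zero (y : EuclideanSpace ℝ (Fin 4)) :
    sesq (mink y) 1 0 = -(I * (y 0 + y 3)) := by
  rw [mink_eq]; simp [sesq]; ring

theorem sheet_sq (R : ℝ) (x : EuclideanSpace ℝ (Fin 3)) : sheet R x ^ 2 = R ^ 2 + ‖x‖ ^ 2 :=
  Real.sq_sqrt (by positivity)

theorem sheet_pos {R : ℝ} (hR : 0 < R) (x : EuclideanSpace ℝ (Fin 3)) : 0 < sheet R x :=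
  Real.sqrt_pos.2 (by positivity)

theorem graphMap_eq_horoPoint {R : ℝ} (x : EuclideanSpace ℝ (Fin 3)) {h : ℝ}
    {g : EuclideanSpace ℝ (Fin 3) → ℝ} (hg : g x = h)
    (hh : h ^ 2 = R ^ 2 + ‖x‖ ^ 2) (h0 : h + (splitCoord x).1 ≠ 0) :
    graphMap g x = horoPoint R (h + (splitCoord x).1) (splitCoord x).2 := by
  have h1 : (R ^ 2 + ‖(splitCoord x).2‖ ^ 2) / (h + (splitCoord x).1) = h - (splitCoord x).1 := by
    rw [div_eq_iff h0]
    rw [norm_sq_eq_splitCoord] at hh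
    linarith
  rw [horoPoint, h1, graphMap, hg]
  ext i
  fin_cases i
  · simp
  · simp [splitCoord]
  · simp [splitCoord]
  · simp [splitCoord]

/-- Since τy⁰ = (τ² + R² + |η|²)/2, the linear lower bound for |N(Y - Z)| becomes quadratic after
multiplication by τ. -/
theorem exists_le_norm_horoQ {Z : HC} {c : ℝ} (hc : 0 < c)
    (h : ∀ y, c * (1 + ‖y‖) ≤ ‖N (mink y - Z)‖) (R : ℝ) {τ : ℝ} (hτ : τ ≠ 0) (η : ℂ) :
    c / 2 * (τ ^ 2 + R ^ 2 + ‖η‖ ^ 2) ≤ ‖horoQ Z R τ η‖ := by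
  rw [← mul_N_mink_horoPoint_sub Z R hτ, norm_mul, norm_real, Real.norm_eq_abs]
  set y := horoPoint R τ η with hy
  have h1 : |y 0| ≤ ‖y‖ := by
    have := PiLp.norm_apply_le y 0
    simpa using this
  have h2 : τ * y 0 = (τ ^ 2 + R ^ 2 + ‖η‖ ^ 2) / 2 := by
    simp [hy, horoPoint]; field_simp; ring
  have h3 : (τ ^ 2 + R ^ 2 + ‖η‖ ^ 2) / 2 ≤ |τ| * |y 0| := by
    rw [← h2, ← abs_mul]; exact le_abs_self _
  have h4 := mul_le_mul_of_nonneg_left (h y) (abs_nonneg τ)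
  have h5 : c * (|τ| * |y 0|) ≤ |τ| * (c * (1 + ‖y‖)) := by
    have := abs_nonneg τ
    calc c * (|τ| * |y 0|) = |τ| * (c * |y 0|) := by ring
      _ ≤ |τ| * (c * (1 + ‖y‖)) := by gcongr; linarith
  nlinarith [mul_le_mul_of_nonneg_left h3 hc.le]

/-- The kernel times the test function in horospherical coordinates. -/
noncomputable def horoF (Z : HC) (R : ℝ) (α : ℂ) (η : ℂ) (τ : ℝ) : ℂ :=
  (R ^ 2 + N Z) * (τ ^ 2 * (horoQ Z R τ η ^ 2)⁻¹) * ((-(I * τ) - α) ^ 2)⁻¹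

theorem horoF_eq (Z : HC) (R : ℝ) (α : ℂ) {τ : ℝ} (hτ : τ ≠ 0) (η : ℂ) :
    horoF Z R α η τ = (R ^ 2 + N Z) / N (mink (horoPoint R τ η) - Z) ^ 2 *
      ((sesq (mink (horoPoint R τ η)) 1 0 - α) ^ 2)⁻¹ := by
  have hτ' : (τ : ℂ) ≠ 0 := by exact_mod_cast hτ
  have h1 : ((horoPoint R τ η) 0 : ℂ) + (horoPoint R τ η) 3 = τ := by
    simp [horoPoint]; ring
  rw [horoF, sesq_mink_one_zero, h1, ← mul_N_mink_horoPoint_sub Z R hτ]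
  congr 1
  rw [mul_pow, mul_inv, mul_inv_cancel_left₀ (pow_ne_zero 2 hτ'), div_eq_mul_inv]

theorem norm_inv_sq_neg_I_mul_sub_le {δ B : ℝ} {α : ℂ} (hδ : 0 < δ) (hα : δ ≤ α.re)
    (hB : ‖α‖ ≤ B) (τ : ℝ) :
    ‖((-(I * τ) - α) ^ 2)⁻¹‖ ≤ ((1 + B + B) / δ) ^ 2 * ((1 + |τ|) ^ 2)⁻¹ := by
  have h0 : δ ≤ ‖-(I * τ) - α‖ := by
    refine hα.trans ?_
    have := abs_re_le_norm (-(I * τ) - α)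
    simp at this
    exact (le_abs_self _).trans this
  have h1 : |τ| ≤ ‖-(I * τ) - α‖ + B := by
    have := norm_add_le (-(I * τ) - α) α
    rw [sub_add_cancel, norm_neg, norm_mul, norm_I, one_mul, norm_real, Real.norm_eq_abs] at this
    linarith
  have hB0 : 0 ≤ B := (norm_nonneg _).trans hB
  have h2 : δ * (1 + |τ|) ≤ (1 + B + B) * ‖-(I * τ) - α‖ := by
    have h3 : δ ≤ B := hα.trans ((re_le_norm α).trans hB)
    nlinarith
  rw [norm_inv, norm_pow, ← inv_pow, ← inv_pow, ← mul_pow]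
  refine pow_le_pow_left₀ (by positivity) ?_ 2
  have h4 : 0 < ‖-(I * τ) - α‖ := hδ.trans_le h0
  rw [← div_eq_mul_inv, inv_eq_one_div, div_div, div_le_div_iff₀ h4 (by positivity), one_mul]
  exact h2

section HoroIntegral

variable {Z : HC} {R : ℝ} {α : ℂ} {c : ℝ}

/-- With M = τ² + R² + |η|², the factor |τ|/|Q|² is at most a constant times M^(1/2)/M² = M^(-3/2),
integrable in η; the double pole at iα supplies the decay in τ. This justifies integrating over η
before τ. -/
theorem norm_horoF_div_le (hR : 0 < R) (hα : 0 < α.re) (hc : 0 < c)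
    (hQ : ∀ τ : ℝ, τ ≠ 0 → ∀ η : ℂ, c * (τ ^ 2 + R ^ 2 + ‖η‖ ^ 2) ≤ ‖horoQ Z R τ η‖) :
    ∃ C : ℝ, ∀ (η : ℂ) (τ : ℝ),
      ‖horoF Z R α η τ / τ‖ ≤ C * ((1 + ‖η‖ ^ 2) ^ (-(3 : ℝ) / 2) * (1 + τ ^ 2)⁻¹) := by
  set b := min 1 (R ^ 2) with hb
  have hb0 : 0 < b := lt_min one_pos (by positivity)
  set D := ((1 + ‖α‖ + ‖α‖) / α.re) ^ 2 with hD
  refine ⟨‖(R : ℂ) ^ 2 + N Z‖ * ((c ^ 2)⁻¹ * b ^ (-(3 : ℝ) / 2)) * D, fun η τ => ?_⟩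
  rcases eq_or_ne τ 0 with rfl | hτ
  · simp only [ofReal_zero, div_zero, norm_zero]
    positivity
  have h1 := norm_inv_sq_neg_I_mul_sub_le hα le_rfl le_rfl τ
  set M := τ ^ 2 + R ^ 2 + ‖η‖ ^ 2 with hM
  have hM0 : 0 < M := by positivity
  have h2 : ‖(τ : ℂ) ^ 2 * (horoQ Z R τ η ^ 2)⁻¹ / τ‖ ≤
      (c ^ 2)⁻¹ * b ^ (-(3 : ℝ) / 2) * (1 + ‖η‖ ^ 2) ^ (-(3 : ℝ) / 2) := by
    have h3 : ‖(τ : ℂ) ^ 2 * (horoQ Z R τ η ^ 2)⁻¹ / τ‖ = |τ| / ‖horoQ Z R τ η‖ ^ 2 := by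
      have : |τ| ≠ 0 := abs_ne_zero.2 hτ
      rw [norm_div, norm_mul, norm_inv, norm_pow, norm_pow, norm_real, Real.norm_eq_abs]
      field_simp
    rw [h3]
    have h4 : |τ| ≤ M ^ (1 / 2 : ℝ) := by
      rw [← Real.sqrt_eq_rpow]
      refine Real.le_sqrt_of_sq_le ?_
      rw [sq_abs, hM]
      nlinarith [sq_nonneg R, sq_nonneg ‖η‖]
    have h5 : b * (1 + ‖η‖ ^ 2) ≤ M := by
      have h5 := min_le_left 1 (R ^ 2)
      have h6 := min_le_right 1 (R ^ 2)
      have := mul_le_of_le_one_left (sq_nonneg ‖η‖) h5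
      rw [hM]
      nlinarith [sq_nonneg τ]
    calc |τ| / ‖horoQ Z R τ η‖ ^ 2 ≤ M ^ (1 / 2 : ℝ) / (c * M) ^ 2 := by
          gcongr
          exact hQ τ hτ η
      _ = (c ^ 2)⁻¹ * M ^ (-(3 : ℝ) / 2) := by
          rw [show (-(3 : ℝ) / 2) = 1 / 2 - (2 : ℕ) by norm_num, Real.rpow_sub hM0,
            Real.rpow_natCast]
          field_simp
      _ ≤ (c ^ 2)⁻¹ * (b * (1 + ‖η‖ ^ 2)) ^ (-(3 : ℝ) / 2) := by
          refine mul_le_mul_of_nonneg_left ?_ (by positivity)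
          exact Real.rpow_le_rpow_of_nonpos (by positivity) h5 (by norm_num)
      _ = _ := by rw [Real.mul_rpow hb0.le (by positivity)]; ring
  have h6 : horoF Z R α η τ / τ = ((R : ℂ) ^ 2 + N Z) *
      ((τ : ℂ) ^ 2 * (horoQ Z R τ η ^ 2)⁻¹ / τ) * ((-(I * τ) - α) ^ 2)⁻¹ := by
    rw [horoF]; ring
  have h7 : ((1 + |τ|) ^ 2)⁻¹ ≤ (1 + τ ^ 2)⁻¹ := by
    refine inv_anti₀ (by positivity) ?_
    nlinarith [abs_nonneg τ, sq_abs τ]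
  rw [h6, norm_mul, norm_mul]
  calc ‖(R : ℂ) ^ 2 + N Z‖ * ‖(τ : ℂ) ^ 2 * (horoQ Z R τ η ^ 2)⁻¹ / τ‖ *
        ‖((-(I * τ) - α) ^ 2)⁻¹‖
      ≤ ‖(R : ℂ) ^ 2 + N Z‖ * ((c ^ 2)⁻¹ * b ^ (-(3 : ℝ) / 2) *
        (1 + ‖η‖ ^ 2) ^ (-(3 : ℝ) / 2)) * (D * (1 + τ ^ 2)⁻¹) := by
        gcongr
        exact h1.trans (mul_le_mul_of_nonneg_left h7 (by positivity))
    _ = _ := by ring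

theorem measurable_horoF_div : Measurable fun p : ℂ × ℝ => horoF Z R α p.1 p.2 / p.2 := by
  simp only [horoF, horoQ]
  fun_prop

theorem integrable_horoF_div (hR : 0 < R) (hα : 0 < α.re) (hc : 0 < c)
    (hQ : ∀ τ : ℝ, τ ≠ 0 → ∀ η : ℂ, c * (τ ^ 2 + R ^ 2 + ‖η‖ ^ 2) ≤ ‖horoQ Z R τ η‖) :
    Integrable (fun p : ℂ × ℝ => horoF Z R α p.1 p.2 / p.2) ∧
      ∀ η, Integrable fun τ : ℝ => horoF Z R α η τ / τ := by
  obtain ⟨C, hC⟩ := norm_horoF_div_le (Z := Z) hR hα hc hQ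
  constructor
  · have h2 : Integrable fun η : ℂ => (1 + ‖η‖ ^ 2) ^ (-(3 : ℝ) / 2) :=
      integrable_rpow_neg_one_add_norm_sq (by rw [Complex.finrank_real_complex]; norm_num)
    exact ((h2.mul_prod integrable_inv_one_add_sq).const_mul C).mono'
      measurable_horoF_div.aestronglyMeasurable (Eventually.of_forall fun p => hC p.1 p.2)
  · intro η
    refine ((integrable_inv_one_add_sq.const_mul ((1 + ‖η‖ ^ 2) ^ (-(3 : ℝ) / 2))).const_mul
      C).mono' ?_ (Eventually.of_forall fun τ => hC η τ)
    exact (measurable_horoF_div.comp (measurable_const.prodMk measurable_id)).aestronglyMeasurable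

theorem integral_horoF_div_right (hR : 0 < R) (hZ : (Z 0 0).re < 0) (hc : 0 < c)
    (hQ : ∀ τ : ℝ, τ ≠ 0 → ∀ η : ℂ, c * (τ ^ 2 + R ^ 2 + ‖η‖ ^ 2) ≤ ‖horoQ Z R τ η‖)
    {τ : ℝ} (hτ : τ ≠ 0) :
    ∫ η : ℂ, horoF Z R α η τ / τ = Real.pi * (((R : ℂ) ^ 2 + N Z) * τ /
      ((τ - I * Z 0 0) * (N Z * τ + I * Z 0 0 * R ^ 2))) * ((τ - I * α) ^ 2)⁻¹ := by
  have hτ' : (τ : ℂ) ≠ 0 := by exact_mod_cast hτ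
  have hp : I * Z 0 0 ≠ 0 := mul_ne_zero I_ne_zero fun h => by simp [h] at hZ
  have hb0 : 0 < min 1 (R ^ 2) := lt_min one_pos (by positivity)
  have h1 := integral_inv_quadratic_sq (α := -(I * τ * Z 0 1)) (β := -(I * τ * Z 1 0))
    (B := I * τ ^ 2 * Z 1 1 + I * Z 0 0 * R ^ 2 + τ * (N Z - R ^ 2)) hp (mul_pos hc hb0) (fun η => by
      refine le_trans ?_ (hQ τ hτ η)
      rw [mul_assoc]
      refine mul_le_mul_of_nonneg_left ?_ hc.le
      have h5 := min_le_left 1 (R ^ 2)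
      have h6 := min_le_right 1 (R ^ 2)
      have := mul_le_of_le_one_left (sq_nonneg ‖η‖) h5
      nlinarith [sq_nonneg τ])
  have h2 : ∀ η : ℂ, horoF Z R α η τ / τ = (((R : ℂ) ^ 2 + N Z) * τ * ((-(I * τ) - α) ^ 2)⁻¹) *
      ((I * Z 0 0 * (‖η‖ : ℂ) ^ 2 + (-(I * τ * Z 0 1)) * η + (-(I * τ * Z 1 0)) *
        (starRingEnd ℂ) η + (I * τ ^ 2 * Z 1 1 + I * Z 0 0 * R ^ 2 + τ * (N Z - R ^ 2))) ^ 2)⁻¹ := by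
    intro η
    rw [horoF, horoQ]
    field_simp
  simp_rw [h2]
  rw [integral_const_mul, h1]
  -- The discriminant produced by the plane integral splits into two factors linear in τ.
  have h3 : I * Z 0 0 * (I * τ ^ 2 * Z 1 1 + I * Z 0 0 * R ^ 2 + τ * (N Z - R ^ 2)) -
      -(I * τ * Z 0 1) * -(I * τ * Z 1 0) =
      -((τ - I * Z 0 0) * (N Z * τ + I * Z 0 0 * R ^ 2)) := by
    have hN := N_eq Z
    linear_combination (τ ^ 2 * (Z 0 0 * Z 1 1 - Z 0 1 * Z 1 0)) * I_sq + (τ : ℂ) ^ 2 * hN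
  have h4 : (-(I * τ) - α) ^ 2 = -(τ - I * α) ^ 2 := by
    linear_combination (τ ^ 2 + α ^ 2) * I_sq
  rw [h3, h4, inv_neg, div_neg]
  ring

/-- The reproducing identity for null plane functions, in horospherical coordinates. -/
theorem integral_integral_horoF (hR : 0 < R) (hα : 0 < α.re) (hZ : (Z 0 0).re < 0)
    (hN : N Z ≠ 0) (hZN : (Z 0 0 / N Z).re < 0) (hc : 0 < c)
    (hQ : ∀ τ : ℝ, τ ≠ 0 → ∀ η : ℂ, c * (τ ^ 2 + R ^ 2 + ‖η‖ ^ 2) ≤ ‖horoQ Z R τ η‖) :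
    ∫ η : ℂ, ∫ τ : ℝ, horoF Z R α η τ / τ = 2 * Real.pi ^ 2 * I / (Z 0 0 - α) ^ 2 := by
  rw [integral_integral_swap (integrable_horoF_div hR hα hc hQ).1]
  -- Partial fractions in τ. The numerator R² + N(Z) of the kernel is exactly what makes the
  -- coefficient at the pole iZ₀₀ equal to 1.
  have h1 : ∀ᵐ τ : ℝ, ∫ η : ℂ, horoF Z R α η τ / τ = Real.pi * (((τ : ℂ) - I * Z 0 0)⁻¹ *
      (((τ : ℂ) - I * α) ^ 2)⁻¹) + Real.pi * R ^ 2 / N Z *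
      (((τ : ℂ) - -(I * Z 0 0 * R ^ 2 / N Z))⁻¹ * (((τ : ℂ) - I * α) ^ 2)⁻¹) := by
    have h0 : ∀ᵐ τ : ℝ, τ ≠ 0 := by simp [ae_iff]
    filter_upwards [h0] with τ hτ
    rw [integral_horoF_div_right hR hZ hc hQ hτ]
    have e1 : (τ : ℂ) - I * Z 0 0 ≠ 0 :=
      ofReal_sub_ne_zero_of_im_ne_zero (by simpa using hZ.ne) τ
    have e2 : (τ : ℂ) - -(I * Z 0 0 * R ^ 2 / N Z) ≠ 0 := by
      refine ofReal_sub_ne_zero_of_im_ne_zero ?_ τ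
      rw [show -(I * Z 0 0 * R ^ 2 / N Z) = ((-R ^ 2 : ℝ) : ℂ) * (I * (Z 0 0 / N Z)) by
        push_cast; ring, im_ofReal_mul, I_mul_im]
      exact mul_ne_zero (by simpa using hR.ne') hZN.ne
    have e3 : (τ : ℂ) - -(I * Z 0 0 * R ^ 2 / N Z) = (N Z * τ + I * Z 0 0 * R ^ 2) / N Z := by
      field_simp; ring
    have e4 : N Z * τ + I * Z 0 0 * R ^ 2 ≠ 0 := fun h => e2 (by rw [e3, h, zero_div])
    rw [e3, inv_div]
    generalize (((τ : ℂ) - I * α) ^ 2)⁻¹ = v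
    have e5 : ((R : ℂ) ^ 2 + N Z) * τ / ((τ - I * Z 0 0) * (N Z * τ + I * Z 0 0 * R ^ 2)) =
        ((τ : ℂ) - I * Z 0 0)⁻¹ + R ^ 2 / (N Z * τ + I * Z 0 0 * R ^ 2) := by
      rw [inv_eq_one_div, div_add_div _ _ e1 e4]
      congr 1
      ring
    have e6 : Real.pi * (R : ℂ) ^ 2 / N Z * (N Z / (N Z * τ + I * Z 0 0 * R ^ 2) * v) =
        Real.pi * (R ^ 2 / (N Z * τ + I * Z 0 0 * R ^ 2)) * v := by
      field_simp
    rw [e5, e6]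
    ring
  rw [integral_congr_ae h1]
  -- Of the two simple poles only iZ₀₀ lies opposite the double pole iα, so the other partial
  -- fraction integrates to zero.
  have him1 : (I * Z 0 0).im < 0 := by simpa using hZ
  have him2 : 0 < (I * α).im := by simpa using hα
  have him3 : 0 < (-(I * Z 0 0 * R ^ 2 / N Z)).im := by
    rw [show -(I * Z 0 0 * R ^ 2 / N Z) = ((-R ^ 2 : ℝ) : ℂ) * (I * (Z 0 0 / N Z)) by
        push_cast; ring, im_ofReal_mul, I_mul_im]
    exact mul_pos_of_neg_of_neg (by nlinarith) hZN
  rw [integral_add ((integrable_inv_mul_inv_sq him1.ne him2.ne').const_mul _)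
    ((integrable_inv_mul_inv_sq him3.ne' him2.ne').const_mul _), integral_const_mul,
    integral_const_mul, integral_inv_mul_inv_sq him1 him2,
    integral_inv_mul_inv_sq_eq_zero him3 him2, mul_zero, add_zero, ← mul_sub, mul_pow, I_sq,
    neg_one_mul, div_neg]
  ring

end HoroIntegral

end ComplexQuaternion

/-! ### The kernel against one plane wave, integrated over the two sheets. -/

namespace ComplexQuaternion

theorem continuous_mink : Continuous mink := by
  have : mink = fun y => !![-I * y 0 - I * y 3, -I * y 1 - y 2;
      -I * y 1 + y 2, -I * y 0 + I * y 3] := funext mink_eq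
  rw [this]
  refine continuous_matrix fun i j => ?_
  fin_cases i <;> fin_cases j <;> simp <;> fun_prop

theorem continuous_N : Continuous N := by
  have : N = fun M => M 0 0 * M 1 1 - M 0 1 * M 1 0 := funext N_eq
  rw [this]
  have hc : ∀ i j, Continuous fun Z : HC => Z i j := fun i j => continuous_id.matrix_elem i j
  exact ((hc 0 0).mul (hc 1 1)).sub ((hc 0 1).mul (hc 1 0))

theorem continuous_sesq (a b : ℂ) : Continuous fun M : HC => sesq M a b := by
  have hc : ∀ i j, Continuous fun Z : HC => Z i j := fun i j => continuous_id.matrix_elem i j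
  have h00 := hc 0 0
  have h01 := hc 0 1
  have h10 := hc 1 0
  have h11 := hc 1 1
  simp only [sesq]
  fun_prop

theorem continuous_graphMap {g : EuclideanSpace ℝ (Fin 3) → ℝ} (hg : Continuous g) :
    Continuous (graphMap g) := by
  refine (PiLp.continuous_toLp 2 _).comp (continuous_pi fun i => ?_)
  fin_cases i <;> simp <;> fun_prop

theorem continuous_sheet (R : ℝ) : Continuous (sheet R) := by
  unfold sheet
  fun_prop

/-- The difference of the values of `F` on the two sheets of the hyperboloid, relative to the
invariant measure. -/
noncomputable def sheetDiff (R : ℝ) (F : EuclideanSpace ℝ (Fin 4) → ℂ)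
    (x : EuclideanSpace ℝ (Fin 3)) : ℂ :=
  F (graphMap (sheet R) x) / (sheet R x : ℂ) -
    F (graphMap (fun x => -sheet R x) x) / (sheet R x : ℂ)

theorem measurable_sheetDiff (R : ℝ) {F : EuclideanSpace ℝ (Fin 4) → ℂ} (hF : Measurable F) :
    Measurable (sheetDiff R F) := by
  have h1 : Measurable fun x => (sheet R x : ℂ) :=
    (continuous_ofReal.comp (continuous_sheet R)).measurable
  exact ((hF.comp (continuous_graphMap (continuous_sheet R)).measurable).div h1).sub
    ((hF.comp (continuous_graphMap (continuous_sheet R).neg).measurable).div h1)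

/-- The reproducing kernel `(R² + N(Z)) / N(Y - Z)²`. -/
noncomputable def poissonKernel (R : ℝ) (Z : HC) (y : EuclideanSpace ℝ (Fin 4)) : ℂ :=
  ((R : ℂ) ^ 2 + N Z) / N (mink y - Z) ^ 2

theorem measurable_poissonKernel (R : ℝ) (Z : HC) : Measurable (poissonKernel R Z) :=
  measurable_const.div
    ((continuous_N.comp (continuous_mink.sub continuous_const)).pow 2).measurable

/-- The kernel times a test function that is constant on null hyperplanes. -/
noncomputable def planeKernel (R : ℝ) (Z : HC) (a b α : ℂ) (y : EuclideanSpace ℝ (Fin 4)) : ℂ :=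
  poissonKernel R Z y * ((sesq (mink y) a b - α) ^ 2)⁻¹

theorem measurable_planeKernel (R : ℝ) (Z : HC) (a b α : ℂ) :
    Measurable (planeKernel R Z a b α) :=
  (measurable_poissonKernel R Z).mul
    (((((continuous_sesq a b).comp continuous_mink).sub continuous_const).pow 2).measurable.inv)

theorem sheet_le_norm_graphMap {R h : ℝ} {x : EuclideanSpace ℝ (Fin 3)}
    {g : EuclideanSpace ℝ (Fin 3) → ℝ} (hg : g x = h) (hh : |h| = sheet R x) :
    sheet R x ≤ ‖graphMap g x‖ := by
  have := PiLp.norm_apply_le (graphMap g x) 0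
  simpa [graphMap, hg, hh] using this

/-- The kernel gives s⁻² with s the height of the sheet. The wave decays only in τ = h + t, which
can be small far out, but (h + t)(h - t) = R² + |η|² forces |τ| ≥ (R² + |η|²)/(2s). -/
theorem norm_planeKernel_div_le {R c δ B h : ℝ} {Z : HC} {α : ℂ} (hR : 0 < R) (hc : 0 < c)
    (hZ : ∀ y, c * (1 + ‖y‖) ≤ ‖N (mink y - Z)‖) (hδ : 0 < δ) (hα : δ ≤ α.re) (hB : ‖α‖ ≤ B)
    {x : EuclideanSpace ℝ (Fin 3)} {g : EuclideanSpace ℝ (Fin 3) → ℝ} (hg : g x = h)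
    (hh : |h| = sheet R x) :
    ‖planeKernel R Z 1 0 α (graphMap g x) / sheet R x‖ ≤
      2 * ‖(R : ℂ) ^ 2 + N Z‖ / c ^ 2 * ((1 + B + B) / δ) ^ 2 *
        (sheet R x ^ 2 * (R ^ 2 + ‖(splitCoord x).2‖ ^ 2))⁻¹ := by
  have hs := sheet_pos hR x
  set s := sheet R x with hs'
  set m := R ^ 2 + ‖(splitCoord x).2‖ ^ 2 with hm'
  have hm : 0 < m := by positivity
  have h1 : s ^ 2 = m + (splitCoord x).1 ^ 2 := by
    rw [hs', sheet_sq, norm_sq_eq_splitCoord]; ring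
  set t := (splitCoord x).1 with ht
  have hhs : h ^ 2 = s ^ 2 := by rw [← hh, sq_abs]
  have hts : |t| ≤ s := abs_le_of_sq_le_sq (by linarith) hs.le
  have hτ : m ≤ |h + t| * (2 * s) := by
    have h2 : m = |h + t| * |h - t| := by
      rw [← abs_mul, show (h + t) * (h - t) = m by linarith, abs_of_pos hm]
    have h3 : |h - t| ≤ 2 * s := (abs_sub _ _).trans (by linarith)
    nlinarith [abs_nonneg (h + t)]
  have hse : sesq (mink (graphMap g x)) 1 0 = -(I * ((h + t : ℝ) : ℂ)) := by
    rw [sesq_mink_one_zero]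
    simp [graphMap, hg, ht, splitCoord]
  have e1 := norm_inv_sq_neg_I_mul_sub_le hδ hα hB (h + t)
  have e2 : ((1 + |h + t|) ^ 2)⁻¹ ≤ 2 * s / m := by
    rw [inv_eq_one_div, div_le_div_iff₀ (by positivity) hm]
    nlinarith [abs_nonneg (h + t), sq_nonneg (h + t), sq_abs (h + t)]
  have e3 : ‖poissonKernel R Z (graphMap g x)‖ ≤ ‖(R : ℂ) ^ 2 + N Z‖ / (c * s) ^ 2 := by
    rw [poissonKernel, norm_div, norm_pow]
    have := hZ (graphMap g x)
    have h4 := sheet_le_norm_graphMap hg hh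
    have h5 : c * s ≤ ‖N (mink (graphMap g x) - Z)‖ := by
      refine le_trans ?_ this
      gcongr
      linarith
    gcongr
  rw [planeKernel, hse, norm_div, norm_mul, norm_real, Real.norm_of_nonneg hs.le]
  calc ‖poissonKernel R Z (graphMap g x)‖ * ‖((-(I * ((h + t : ℝ) : ℂ)) - α) ^ 2)⁻¹‖ / s
      ≤ ‖(R : ℂ) ^ 2 + N Z‖ / (c * s) ^ 2 * (((1 + B + B) / δ) ^ 2 * (2 * s / m)) / s := by
        gcongr
        exact e1.trans (mul_le_mul_of_nonneg_left e2 (by positivity))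
    _ = _ := by field_simp

/-- The L¹ bound depends on α only through δ and B, and on Z only through c and N(Z). These
quantities survive rotations, so one bound serves every plane wave in the superposition. -/
theorem integrable_planeKernel_one_zero {R c δ B : ℝ} {Z : HC} {α : ℂ} (hR : 0 < R) (hc : 0 < c)
    (hZ : ∀ y, c * (1 + ‖y‖) ≤ ‖N (mink y - Z)‖) (hδ : 0 < δ) (hα : δ ≤ α.re) (hB : ‖α‖ ≤ B) :
    Integrable (sheetDiff R (planeKernel R Z 1 0 α)) ∧
    ∫ x, ‖sheetDiff R (planeKernel R Z 1 0 α) x‖ ≤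
      ∫ x, 2 * (2 * ‖(R : ℂ) ^ 2 + N Z‖ / c ^ 2 * ((1 + B + B) / δ) ^ 2) *
        (sheet R x ^ 2 * (R ^ 2 + ‖(splitCoord x).2‖ ^ 2))⁻¹ := by
  have h1 : ∀ x, ‖sheetDiff R (planeKernel R Z 1 0 α) x‖ ≤
      2 * (2 * ‖(R : ℂ) ^ 2 + N Z‖ / c ^ 2 * ((1 + B + B) / δ) ^ 2) *
        (sheet R x ^ 2 * (R ^ 2 + ‖(splitCoord x).2‖ ^ 2))⁻¹ := by
    intro x
    refine (norm_sub_le _ _).trans ?_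
    have hs := sheet_pos hR x
    have e1 := norm_planeKernel_div_le hR hc hZ hδ hα hB (x := x) (g := sheet R) rfl
      (abs_of_pos hs)
    have e2 := norm_planeKernel_div_le hR hc hZ hδ hα hB (x := x) (g := fun x => -sheet R x) rfl
      (by rw [abs_neg, abs_of_pos hs])
    linarith
  have h2 := (integrable_inv_sheet_sq_mul hR).const_mul
    (2 * (2 * ‖(R : ℂ) ^ 2 + N Z‖ / c ^ 2 * ((1 + B + B) / δ) ^ 2))
  have h3 : Integrable (sheetDiff R (planeKernel R Z 1 0 α)) :=
    h2.mono' (measurable_sheetDiff R (measurable_planeKernel R Z 1 0 α)).aestronglyMeasurable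
      (Eventually.of_forall h1)
  exact ⟨h3, integral_mono h3.norm h2 h1⟩

/-- This places the poles iZ₀₀ and -iZ₀₀R²/N(Z) in opposite half planes. The third inequality is the
form tested on a column of the adjugate. -/
theorem re_lt_zero_of_accretive_neg {δ : ℝ} {Z : HC} (hδ : 0 < δ) (h : Accretive δ (-Z)) :
    (Z 0 0).re < 0 ∧ N Z ≠ 0 ∧ (Z 0 0 / N Z).re < 0 := by
  have hN : N Z ≠ 0 := by rw [← N_neg]; exact h.N_ne_zero hδ
  have h0 : (Z 0 0).re < 0 := by
    have h1 := h 1 0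
    have e1 : sesq (-Z) 1 0 = -Z 0 0 := by simp [sesq]
    rw [e1] at h1
    norm_num at h1
    linarith
  refine ⟨h0, hN, ?_⟩
  have h2 := h (-Z 0 1) (Z 0 0)
  have e2 : sesq (-Z) (-Z 0 1) (Z 0 0) = -((starRingEnd ℂ) (Z 0 0) * N Z) := by
    rw [sesq, N_eq]; simp; ring
  rw [e2] at h2
  have h3 : 0 < ‖Z 0 0‖ := norm_pos_iff.2 fun h => by simp [h] at h0
  have h4 : 0 < δ * (‖-Z 0 1‖ ^ 2 + ‖Z 0 0‖ ^ 2) := by positivity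
  have h5 : (Z 0 0 / N Z).re = ((starRingEnd ℂ) (Z 0 0) * N Z).re / normSq (N Z) := by
    simp [div_re, mul_re]
    ring
  rw [h5]
  refine div_neg_of_neg_of_pos ?_ (normSq_pos.2 hN)
  rw [neg_re] at h2
  linarith

theorem integral_planeKernel_one_zero {R δ : ℝ} {Z : HC} {α : ℂ} (hR : 0 < R) (hδ : 0 < δ)
    (h : Accretive δ (-Z)) (hα : 0 < α.re) :
    ∫ x, sheetDiff R (planeKernel R Z 1 0 α) x = 2 * Real.pi ^ 2 * I / (Z 0 0 - α) ^ 2 := by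
  obtain ⟨c, hc, hZ⟩ := h.exists_le_norm_N_mink_sub hδ
  obtain ⟨h00, hN, hZN⟩ := re_lt_zero_of_accretive_neg hδ h
  have hQ : ∀ τ : ℝ, τ ≠ 0 → ∀ η : ℂ, c / 2 * (τ ^ 2 + R ^ 2 + ‖η‖ ^ 2) ≤ ‖horoQ Z R τ η‖ :=
    fun τ hτ η => exists_le_norm_horoQ hc hZ R hτ η
  have hint := (integrable_planeKernel_one_zero hR hc hZ hα le_rfl le_rfl).1
  set G : ℝ × ℂ → ℂ := fun p =>
    horoF Z R α p.2 (Real.sqrt (R ^ 2 + ‖p.2‖ ^ 2 + p.1 ^ 2) + p.1) /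
      ((Real.sqrt (R ^ 2 + ‖p.2‖ ^ 2 + p.1 ^ 2) : ℝ) : ℂ) -
    horoF Z R α p.2 (-Real.sqrt (R ^ 2 + ‖p.2‖ ^ 2 + p.1 ^ 2) + p.1) /
      ((Real.sqrt (R ^ 2 + ‖p.2‖ ^ 2 + p.1 ^ 2) : ℝ) : ℂ) with hG
  have hm : ∀ η : ℂ, 0 < R ^ 2 + ‖η‖ ^ 2 := fun η => by positivity
  have e1 : ∀ x, sheetDiff R (planeKernel R Z 1 0 α) x = G (splitCoord x) := by
    intro x
    have ha := abs_lt_sqrt_add_sq (hm (splitCoord x).2) (splitCoord x).1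
    rw [← sheet_eq] at ha
    have ha' := abs_lt.1 ha
    have n1 : sheet R x + (splitCoord x).1 ≠ 0 := by linarith
    have n2 : -sheet R x + (splitCoord x).1 ≠ 0 := by linarith
    rw [sheetDiff, planeKernel, planeKernel, poissonKernel, poissonKernel,
      graphMap_eq_horoPoint (R := R) (g := sheet R) x rfl (sheet_sq R x) n1,
      graphMap_eq_horoPoint (R := R) (g := fun x => -sheet R x) x rfl
        (by rw [neg_sq]; exact sheet_sq R x) n2, ← horoF_eq Z R α n1, ← horoF_eq Z R α n2, hG]
    simp only [← sheet_eq]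
  have hGint : Integrable G (volume.prod volume) := by
    rw [← Measure.volume_eq_prod]
    refine (measurePreserving_splitCoord.integrable_comp_emb measurableEmbedding_splitCoord).1 ?_
    exact hint.congr (Eventually.of_forall e1)
  simp_rw [e1]
  rw [measurePreserving_splitCoord.integral_comp measurableEmbedding_splitCoord G,
    Measure.volume_eq_prod, integral_prod_symm G hGint,
    ← integral_integral_horoF hR hα h00 hN hZN (half_pos hc) hQ]
  congr 1
  ext η
  exact integral_sub_comp_sqrt_add (hm η) ((integrable_horoF_div hR hα (half_pos hc) hQ).2 η)

end ComplexQuaternion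

/-! ### Rotations: from the wave in the direction (1, 0) to an arbitrary direction. -/

namespace ComplexQuaternion

/-- The unitary matrix with first column `(a, b)`. -/
noncomputable def rotMatrix (a b : ℂ) : HC := !![a, -(starRingEnd ℂ) b; b, (starRingEnd ℂ) a]

/-- Conjugation by `rotMatrix a b` on the space coordinates. -/
noncomputable def rotMap (a b : ℂ) : EuclideanSpace ℝ (Fin 3) →ₗ[ℝ] EuclideanSpace ℝ (Fin 3) where
  toFun x := !₂[(a.re ^ 2 - a.im ^ 2 - b.re ^ 2 + b.im ^ 2) * x 0 -
      2 * (a.re * a.im + b.re * b.im) * x 1 - 2 * (a.re * b.re - a.im * b.im) * x 2,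
    2 * (a.re * a.im - b.re * b.im) * x 0 +
      (a.re ^ 2 - a.im ^ 2 + b.re ^ 2 - b.im ^ 2) * x 1 - 2 * (a.re * b.im + a.im * b.re) * x 2,
    2 * (a.re * b.re + a.im * b.im) * x 0 + 2 * (a.re * b.im - a.im * b.re) * x 1 +
      (a.re ^ 2 + a.im ^ 2 - b.re ^ 2 - b.im ^ 2) * x 2]
  map_add' x y := by
    ext i
    fin_cases i <;> simp <;> ring
  map_smul' c x := by
    ext i
    fin_cases i <;> simp <;> ring

section Rotation

variable {a b : ℂ}

theorem norm_rotMap (h : a.re ^ 2 + a.im ^ 2 + b.re ^ 2 + b.im ^ 2 = 1)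
    (x : EuclideanSpace ℝ (Fin 3)) : ‖rotMap a b x‖ = ‖x‖ := by
  refine (sq_eq_sq₀ (norm_nonneg _) (norm_nonneg _)).1 ?_
  rw [EuclideanSpace.real_norm_sq_eq, EuclideanSpace.real_norm_sq_eq, Fin.sum_univ_three,
    Fin.sum_univ_three]
  simp [rotMap]
  linear_combination ((x 0 ^ 2 + x 1 ^ 2 + x 2 ^ 2) *
    (a.re ^ 2 + a.im ^ 2 + b.re ^ 2 + b.im ^ 2 + 1)) * h

/-- `rotMap` as a linear isometry. -/
noncomputable def rotEquiv (a b : ℂ) (h : a.re ^ 2 + a.im ^ 2 + b.re ^ 2 + b.im ^ 2 = 1) :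
    EuclideanSpace ℝ (Fin 3) ≃ₗᵢ[ℝ] EuclideanSpace ℝ (Fin 3) :=
  (LinearIsometry.mk (rotMap a b) (norm_rotMap h)).toLinearIsometryEquiv rfl

theorem rotEquiv_apply (h : a.re ^ 2 + a.im ^ 2 + b.re ^ 2 + b.im ^ 2 = 1)
    (x : EuclideanSpace ℝ (Fin 3)) : rotEquiv a b h x = rotMap a b x := rfl

/-- SU(2) acts on M by conjugation, fixing y⁰ and rotating the space coordinates. It preserves N and
both sheets and moves the direction (1, 0) to (a, b), which transfers the results above to any unit
direction. -/
theorem mink_graphMap_rotMap (h : a.re ^ 2 + a.im ^ 2 + b.re ^ 2 + b.im ^ 2 = 1)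
    {g : EuclideanSpace ℝ (Fin 3) → ℝ} {x : EuclideanSpace ℝ (Fin 3)}
    (hg : g (rotMap a b x) = g x) :
    mink (graphMap g (rotMap a b x)) =
      (rotMatrix a b).conjTranspose * mink (graphMap g x) * rotMatrix a b := by
  rw [mink_eq, mink_eq]
  simp only [graphMap, hg]
  ext i j
  fin_cases i <;> fin_cases j <;> apply Complex.ext <;>
    simp [rotMatrix, rotMap, Matrix.mul_apply, Fin.sum_univ_two, Matrix.conjTranspose_apply, sq]
  all_goals first | ring1 | linear_combination (g x) * h

theorem N_rotMatrix (h : a.re ^ 2 + a.im ^ 2 + b.re ^ 2 + b.im ^ 2 = 1) :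
    N (rotMatrix a b) = 1 ∧ N (rotMatrix a b).conjTranspose = 1 := by
  constructor <;> rw [N_eq] <;> apply Complex.ext <;>
    simp [rotMatrix, Matrix.conjTranspose_apply] <;> first | ring1 | linear_combination h

theorem N_conj_rotMatrix (h : a.re ^ 2 + a.im ^ 2 + b.re ^ 2 + b.im ^ 2 = 1) (M : HC) :
    N ((rotMatrix a b).conjTranspose * M * rotMatrix a b) = N M := by
  have h1 := N_rotMatrix h
  simp only [N, Matrix.det_mul] at h1 ⊢
  rw [h1.1, h1.2, one_mul, mul_one]

theorem sesq_conj_rotMatrix (M : HC) (u v : ℂ) :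
    sesq ((rotMatrix a b).conjTranspose * M * rotMatrix a b) u v =
      sesq M (a * u - (starRingEnd ℂ) b * v) (b * u + (starRingEnd ℂ) a * v) := by
  simp [sesq, rotMatrix, Matrix.mul_apply, Fin.sum_univ_two, Matrix.conjTranspose_apply]
  ring

theorem Accretive.conj_rotMatrix {δ : ℝ} {M : HC} (hM : Accretive δ M)
    (h : a.re ^ 2 + a.im ^ 2 + b.re ^ 2 + b.im ^ 2 = 1) :
    Accretive δ ((rotMatrix a b).conjTranspose * M * rotMatrix a b) := by
  intro u v
  rw [sesq_conj_rotMatrix]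
  refine le_of_eq_of_le ?_ (hM _ _)
  congr 1
  simp only [← normSq_eq_norm_sq, normSq_apply]
  simp
  linear_combination (-(u.re * u.re + u.im * u.im + (v.re * v.re + v.im * v.im))) * h

theorem sheet_rotMap (h : a.re ^ 2 + a.im ^ 2 + b.re ^ 2 + b.im ^ 2 = 1) (R : ℝ)
    (x : EuclideanSpace ℝ (Fin 3)) : sheet R (rotMap a b x) = sheet R x := by
  rw [sheet, norm_rotMap h, sheet]

theorem norm_sq_graphMap (g : EuclideanSpace ℝ (Fin 3) → ℝ) (x : EuclideanSpace ℝ (Fin 3)) :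
    ‖graphMap g x‖ ^ 2 = g x ^ 2 + ‖x‖ ^ 2 := by
  rw [EuclideanSpace.real_norm_sq_eq, EuclideanSpace.real_norm_sq_eq, Fin.sum_univ_three,
    Fin.sum_univ_four]
  simp [graphMap]
  ring

theorem planeKernel_rotMap (h : a.re ^ 2 + a.im ^ 2 + b.re ^ 2 + b.im ^ 2 = 1) (R : ℝ) (Z : HC)
    (α : ℂ) {g : EuclideanSpace ℝ (Fin 3) → ℝ} {x : EuclideanSpace ℝ (Fin 3)}
    (hg : g (rotMap a b x) = g x) :
    planeKernel R ((rotMatrix a b).conjTranspose * Z * rotMatrix a b) 1 0 α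
      (graphMap g (rotMap a b x)) = planeKernel R Z a b α (graphMap g x) := by
  rw [planeKernel, planeKernel, poissonKernel, poissonKernel, mink_graphMap_rotMap h hg,
    ← sub_mul, ← mul_sub, N_conj_rotMatrix h, N_conj_rotMatrix h, sesq_conj_rotMatrix]
  simp

theorem sheetDiff_planeKernel_rotMap (h : a.re ^ 2 + a.im ^ 2 + b.re ^ 2 + b.im ^ 2 = 1) (R : ℝ)
    (Z : HC) (α : ℂ) (x : EuclideanSpace ℝ (Fin 3)) :
    sheetDiff R (planeKernel R ((rotMatrix a b).conjTranspose * Z * rotMatrix a b) 1 0 α)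
      (rotEquiv a b h x) = sheetDiff R (planeKernel R Z a b α) x := by
  rw [rotEquiv_apply, sheetDiff, sheetDiff, planeKernel_rotMap h R Z α (sheet_rotMap h R x),
    planeKernel_rotMap h R Z α (g := fun x => -sheet R x) (by simp only [sheet_rotMap h]),
    sheet_rotMap h]

theorem le_norm_N_conj_rotMatrix (h : a.re ^ 2 + a.im ^ 2 + b.re ^ 2 + b.im ^ 2 = 1) {c : ℝ}
    {Z : HC} (hZ : ∀ y, c * (1 + ‖y‖) ≤ ‖N (mink y - Z)‖) (y : EuclideanSpace ℝ (Fin 4)) :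
    c * (1 + ‖y‖) ≤
      ‖N (mink y - (rotMatrix a b).conjTranspose * Z * rotMatrix a b)‖ := by
  obtain ⟨x, hx⟩ := (rotEquiv a b h).surjective !₂[y 1, y 2, y 3]
  rw [rotEquiv_apply] at hx
  have hy : y = graphMap (fun _ => y 0) (rotMap a b x) := by
    rw [hx]
    ext i
    fin_cases i <;> simp [graphMap]
  have hn : ‖y‖ = ‖graphMap (fun _ => y 0) x‖ := by
    refine (sq_eq_sq₀ (norm_nonneg _) (norm_nonneg _)).1 ?_
    conv_lhs => rw [hy]
    rw [norm_sq_graphMap, norm_sq_graphMap, norm_rotMap h]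
  rw [hn]
  conv_rhs => rw [hy]
  rw [mink_graphMap_rotMap h rfl, ← sub_mul, ← mul_sub, N_conj_rotMatrix h]
  exact hZ _

theorem integrable_planeKernel {R c δ B : ℝ} {Z : HC} {α : ℂ} (hR : 0 < R) (hc : 0 < c)
    (hZ : ∀ y, c * (1 + ‖y‖) ≤ ‖N (mink y - Z)‖) (hδ : 0 < δ) (hα : δ ≤ α.re) (hB : ‖α‖ ≤ B)
    (h : a.re ^ 2 + a.im ^ 2 + b.re ^ 2 + b.im ^ 2 = 1) :
    Integrable (sheetDiff R (planeKernel R Z a b α)) ∧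
    ∫ x, ‖sheetDiff R (planeKernel R Z a b α) x‖ ≤
      ∫ x, 2 * (2 * ‖(R : ℂ) ^ 2 + N Z‖ / c ^ 2 * ((1 + B + B) / δ) ^ 2) *
        (sheet R x ^ 2 * (R ^ 2 + ‖(splitCoord x).2‖ ^ 2))⁻¹ := by
  obtain ⟨h1, h2⟩ := integrable_planeKernel_one_zero hR hc (le_norm_N_conj_rotMatrix h hZ) hδ hα hB
  rw [N_conj_rotMatrix h] at h2
  have hmp := (rotEquiv a b h).measurePreserving
  have hme := (rotEquiv a b h).toMeasurableEquiv.measurableEmbedding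
  constructor
  · exact ((hmp.integrable_comp_emb hme).2 h1).congr
      (Eventually.of_forall (sheetDiff_planeKernel_rotMap h R Z α))
  · simp_rw [← sheetDiff_planeKernel_rotMap h R Z α]
    rw [hmp.integral_comp hme (fun x => ‖sheetDiff R (planeKernel R
      ((rotMatrix a b).conjTranspose * Z * rotMatrix a b) 1 0 α) x‖)]
    exact h2

theorem integral_planeKernel {R δ : ℝ} {Z : HC} {α : ℂ} (hR : 0 < R) (hδ : 0 < δ)
    (hZ : Accretive δ (-Z)) (hα : 0 < α.re)
    (h : a.re ^ 2 + a.im ^ 2 + b.re ^ 2 + b.im ^ 2 = 1) :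
    ∫ x, sheetDiff R (planeKernel R Z a b α) x = 2 * Real.pi ^ 2 * I / (sesq Z a b - α) ^ 2 := by
  have hmp := (rotEquiv a b h).measurePreserving
  have hme := (rotEquiv a b h).toMeasurableEquiv.measurableEmbedding
  simp_rw [← sheetDiff_planeKernel_rotMap h R Z α]
  have hZ' : Accretive δ (-((rotMatrix a b).conjTranspose * Z * rotMatrix a b)) := by
    have := hZ.conj_rotMatrix h
    rwa [mul_neg, neg_mul] at this
  rw [hmp.integral_comp hme (fun x => sheetDiff R (planeKernel R
      ((rotMatrix a b).conjTranspose * Z * rotMatrix a b) 1 0 α) x),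
    integral_planeKernel_one_zero hR hδ hZ' hα]
  have e : ((rotMatrix a b).conjTranspose * Z * rotMatrix a b) 0 0 =
      sesq ((rotMatrix a b).conjTranspose * Z * rotMatrix a b) 1 0 := by simp [sesq]
  rw [e, sesq_conj_rotMatrix]
  simp

end Rotation

theorem sesq_smul (M : HC) (r : ℝ) (u v : ℂ) : sesq M (r * u) (r * v) = r ^ 2 * sesq M u v := by
  simp [sesq]; ring

theorem norm_sesq_le (M : HC) {u v : ℂ} (hu : ‖u‖ ≤ 1) (hv : ‖v‖ ≤ 1) :
    ‖sesq M u v‖ ≤ ‖M 0 0‖ + ‖M 0 1‖ + (‖M 1 0‖ + ‖M 1 1‖) := by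
  rw [sesq]
  have h : ∀ p q : ℂ, ‖p * u + q * v‖ ≤ ‖p‖ + ‖q‖ := fun p q => by
    refine (norm_add_le _ _).trans ?_
    rw [norm_mul, norm_mul]
    exact add_le_add (mul_le_of_le_one_right (norm_nonneg _) hu)
      (mul_le_of_le_one_right (norm_nonneg _) hv)
  refine (norm_add_le _ _).trans ?_
  rw [norm_mul, norm_mul, RCLike.norm_conj, RCLike.norm_conj]
  exact add_le_add ((mul_le_of_le_one_left (norm_nonneg _) hu).trans (h _ _))
    ((mul_le_of_le_one_left (norm_nonneg _) hv).trans (h _ _))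

/-- Homogeneity of degree -4 in the direction. Writing (1, ζ) as r times a unit vector gives the
weight r⁻⁴ = (1 + |ζ|²)⁻², integrable over the ζ-plane. -/
theorem planeKernel_eq_smul (R : ℝ) (Z A : HC) {r : ℝ} (hr : r ≠ 0) (u v : ℂ)
    (y : EuclideanSpace ℝ (Fin 4)) :
    planeKernel R Z (r * u) (r * v) (sesq A (r * u) (r * v)) y =
      ((r : ℂ) ^ 4)⁻¹ * planeKernel R Z u v (sesq A u v) y := by
  have hr' : (r : ℂ) ≠ 0 := by exact_mod_cast hr
  rw [planeKernel, planeKernel, sesq_smul, sesq_smul, ← mul_sub, mul_pow, mul_inv, ← pow_mul]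
  ring

theorem sheetDiff_const_mul (R : ℝ) (k : ℂ) (F : EuclideanSpace ℝ (Fin 4) → ℂ)
    (x : EuclideanSpace ℝ (Fin 3)) : sheetDiff R (fun y => k * F y) x = k * sheetDiff R F x := by
  rw [sheetDiff, sheetDiff]; ring

/-! ### Superposition of plane waves: the reproducing identity for 1/N(Y - A). -/

section MultipoleIdentity

variable {R δ δ' : ℝ} {Z A : HC}

theorem exists_unit_scaling (ζ : ℂ) : ∃ (r : ℝ) (u v : ℂ), r ≠ 0 ∧ r ^ 2 = 1 + ‖ζ‖ ^ 2 ∧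
    (r : ℂ) * u = 1 ∧ (r : ℂ) * v = ζ ∧ u.re ^ 2 + u.im ^ 2 + v.re ^ 2 + v.im ^ 2 = 1 ∧
    ‖u‖ ≤ 1 ∧ ‖v‖ ≤ 1 ∧ ‖u‖ ^ 2 + ‖v‖ ^ 2 = 1 := by
  set r := Real.sqrt (1 + ‖ζ‖ ^ 2) with hr
  have h0 : 0 < r := Real.sqrt_pos.2 (by positivity)
  have h1 : r ^ 2 = 1 + ‖ζ‖ ^ 2 := Real.sq_sqrt (by positivity)
  have h0' : (r : ℂ) ≠ 0 := by exact_mod_cast h0.ne'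
  have h2 : ‖(r : ℂ)⁻¹‖ ^ 2 + ‖(r : ℂ)⁻¹ * ζ‖ ^ 2 = 1 := by
    rw [norm_mul, norm_inv, norm_real, Real.norm_of_nonneg h0.le, mul_pow, ← mul_one_add, ← h1]
    field_simp
  refine ⟨r, (r : ℂ)⁻¹, (r : ℂ)⁻¹ * ζ, h0.ne', h1, mul_inv_cancel₀ h0',
    mul_inv_cancel_left₀ h0' ζ, ?_, ?_, ?_, h2⟩
  · rw [← h2, ← normSq_eq_norm_sq, ← normSq_eq_norm_sq, normSq_apply, normSq_apply]
    ring
  · exact (abs_le_one_iff_mul_self_le_one.2 (by nlinarith [sq_nonneg ‖(r : ℂ)⁻¹ * ζ‖])).trans'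
      (le_abs_self _)
  · exact (abs_le_one_iff_mul_self_le_one.2 (by nlinarith [sq_nonneg ‖(r : ℂ)⁻¹‖])).trans'
      (le_abs_self _)

theorem exists_integral_norm_planeKernel_le (hR : 0 < R) (hδ : 0 < δ) (hZ : Accretive δ (-Z))
    (hδ' : 0 < δ') (hA : Accretive δ' A) :
    ∃ C : ℝ, ∀ ζ : ℂ, Integrable (sheetDiff R (planeKernel R Z 1 ζ (sesq A 1 ζ))) ∧
      ∫ x, ‖sheetDiff R (planeKernel R Z 1 ζ (sesq A 1 ζ)) x‖ ≤ C * ((1 + ‖ζ‖ ^ 2) ^ 2)⁻¹ := by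
  obtain ⟨c, hc, hcZ⟩ := hZ.exists_le_norm_N_mink_sub hδ
  set B := ‖A 0 0‖ + ‖A 0 1‖ + (‖A 1 0‖ + ‖A 1 1‖) with hB
  refine ⟨∫ x, 2 * (2 * ‖(R : ℂ) ^ 2 + N Z‖ / c ^ 2 * ((1 + B + B) / δ') ^ 2) *
        (sheet R x ^ 2 * (R ^ 2 + ‖(splitCoord x).2‖ ^ 2))⁻¹, fun ζ => ?_⟩
  obtain ⟨r, u, v, hr, hr2, hu, hv, huv, hu1, hv1, huv'⟩ := exists_unit_scaling ζ
  have hα : δ' ≤ (sesq A u v).re := by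
    have := hA u v
    rwa [huv', mul_one] at this
  obtain ⟨h1, h2⟩ := integrable_planeKernel hR hc hcZ hδ' hα (norm_sesq_le A hu1 hv1) huv
  have e : ∀ x, sheetDiff R (planeKernel R Z 1 ζ (sesq A 1 ζ)) x =
      ((r : ℂ) ^ 4)⁻¹ * sheetDiff R (planeKernel R Z u v (sesq A u v)) x := by
    intro x
    rw [← sheetDiff_const_mul, ← hu, ← hv]
    congr 1
    ext y
    exact planeKernel_eq_smul R Z A hr u v y
  have e2 : ‖((r : ℂ) ^ 4)⁻¹‖ = ((1 + ‖ζ‖ ^ 2) ^ 2)⁻¹ := by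
    rw [norm_inv, norm_pow, norm_real, Real.norm_eq_abs, ← hr2, ← pow_mul,
      (by decide : Even (2 * 2)).pow_abs]
  constructor
  · exact (h1.const_mul _).congr (Eventually.of_forall fun x => (e x).symm)
  · simp_rw [e, norm_mul, e2]
    rw [integral_const_mul, mul_comm]
    exact mul_le_mul_of_nonneg_right h2 (by positivity)

theorem integral_planeKernel_sesq (hR : 0 < R) (hδ : 0 < δ) (hZ : Accretive δ (-Z))
    (hδ' : 0 < δ') (hA : Accretive δ' A) (ζ : ℂ) :
    ∫ x, sheetDiff R (planeKernel R Z 1 ζ (sesq A 1 ζ)) x =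
      2 * Real.pi ^ 2 * I * (sesq (A - Z) 1 ζ ^ 2)⁻¹ := by
  obtain ⟨r, u, v, hr, hr2, hu, hv, huv, hu1, hv1, huv'⟩ := exists_unit_scaling ζ
  have hα : 0 < (sesq A u v).re := by
    have := hA u v
    rw [huv', mul_one] at this
    exact hδ'.trans_le this
  have e : ∀ x, sheetDiff R (planeKernel R Z 1 ζ (sesq A 1 ζ)) x =
      ((r : ℂ) ^ 4)⁻¹ * sheetDiff R (planeKernel R Z u v (sesq A u v)) x := by
    intro x
    rw [← sheetDiff_const_mul, ← hu, ← hv]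
    congr 1
    ext y
    exact planeKernel_eq_smul R Z A hr u v y
  simp_rw [e]
  rw [integral_const_mul, integral_planeKernel hR hδ hZ hα huv, ← hu, ← hv, sesq_smul, sesq_sub,
    div_eq_mul_inv, mul_pow, mul_inv, ← pow_mul, show (sesq Z u v - sesq A u v) ^ 2 =
      (sesq A u v - sesq Z u v) ^ 2 by ring]
  ring

theorem measurable_sheetDiff_planeKernel :
    Measurable fun p : EuclideanSpace ℝ (Fin 3) × ℂ =>
      sheetDiff R (planeKernel R Z 1 p.2 (sesq A 1 p.2)) p.1 := by
  have h1 : ∀ g : EuclideanSpace ℝ (Fin 3) → ℝ, Continuous g → Measurable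
      fun p : EuclideanSpace ℝ (Fin 3) × ℂ =>
        planeKernel R Z 1 p.2 (sesq A 1 p.2) (graphMap g p.1) := by
    intro g hg
    have hm := continuous_mink.comp (continuous_graphMap hg)
    refine ((measurable_poissonKernel R Z).comp
      ((continuous_graphMap hg).measurable.comp measurable_fst)).mul ?_
    refine Measurable.inv (Continuous.measurable (Continuous.pow (Continuous.sub ?_ ?_) 2))
    · have hc : ∀ i j, Continuous fun p : EuclideanSpace ℝ (Fin 3) × ℂ =>
          mink (graphMap g p.1) i j := fun i j => (hm.comp continuous_fst).matrix_elem i j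
      have h00 := hc 0 0
      have h01 := hc 0 1
      have h10 := hc 1 0
      have h11 := hc 1 1
      simp only [sesq]
      fun_prop
    · simp only [sesq]
      fun_prop
  have h2 : Measurable fun p : EuclideanSpace ℝ (Fin 3) × ℂ => (sheet R p.1 : ℂ) :=
    (continuous_ofReal.comp ((continuous_sheet R).comp continuous_fst)).measurable
  exact ((h1 _ (continuous_sheet R)).div h2).sub ((h1 _ (continuous_sheet R).neg).div h2)

/-- Joint integrability for Fubini: the L¹ norm over the hyperboloid is bounded by C(1 + |ζ|²)⁻²,
uniformly because unit directions form a bounded set on which A is accretive. -/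
theorem integrable_sheetDiff_planeKernel (hR : 0 < R) (hδ : 0 < δ) (hZ : Accretive δ (-Z))
    (hδ' : 0 < δ') (hA : Accretive δ' A) :
    Integrable (fun p : EuclideanSpace ℝ (Fin 3) × ℂ =>
      sheetDiff R (planeKernel R Z 1 p.2 (sesq A 1 p.2)) p.1) (volume.prod volume) := by
  obtain ⟨C, hC⟩ := exists_integral_norm_planeKernel_le hR hδ hZ hδ' hA
  have hm := (measurable_sheetDiff_planeKernel (R := R) (Z := Z) (A := A)).aestronglyMeasurable
    (μ := volume.prod volume)
  rw [integrable_prod_iff' hm]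
  refine ⟨Eventually.of_forall fun ζ => (hC ζ).1, ?_⟩
  have h1 : Integrable fun ζ : ℂ => (1 + ‖ζ‖ ^ 2) ^ (-(4 : ℝ) / 2) :=
    integrable_rpow_neg_one_add_norm_sq (by rw [Complex.finrank_real_complex]; norm_num)
  refine (h1.const_mul C).mono' hm.norm.prod_swap.integral_prod_right'
    (Eventually.of_forall fun ζ => ?_)
  rw [Real.norm_of_nonneg (by positivity)]
  refine (hC ζ).2.trans_eq ?_
  rw [show (-(4 : ℝ) / 2) = -((2 : ℕ) : ℝ) by norm_num, Real.rpow_neg (by positivity),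
    Real.rpow_natCast]

/-- A - Y is accretive for all Y in M, so the plane wave representation of 1/N applies pointwise.
After Fubini the same representation, now for A - Z, is read backwards. -/
theorem sheetDiff_eq_integral (hδ' : 0 < δ') (hA : Accretive δ' A)
    (x : EuclideanSpace ℝ (Fin 3)) :
    sheetDiff R (fun y => poissonKernel R Z y / N (mink y - A)) x =
      (Real.pi : ℂ)⁻¹ * ∫ ζ : ℂ, sheetDiff R (planeKernel R Z 1 ζ (sesq A 1 ζ)) x := by
  have h1 : ∀ y, Integrable (fun ζ : ℂ => ((sesq (mink y) 1 ζ - sesq A 1 ζ) ^ 2)⁻¹) ∧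
      ∫ ζ : ℂ, ((sesq (mink y) 1 ζ - sesq A 1 ζ) ^ 2)⁻¹ = Real.pi / N (mink y - A) := by
    intro y
    have h2 : Accretive δ' (-(mink y - A)) := by
      have := Accretive.mink_sub (M := -A) (by rwa [neg_neg]) (-y)
      have e : mink (-y) - -A = -(mink y - A) := by
        rw [show mink (-y) = -mink y by simp [mink]; abel]; abel
      rwa [e] at this
    have h3 := integral_inv_sesq_sq hδ' h2
    rw [N_neg] at h3
    simp_rw [sesq_neg, neg_sq, sesq_sub] at h3
    exact h3
  have hpi : (Real.pi : ℂ) ≠ 0 := by exact_mod_cast Real.pi_ne_zero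
  simp only [sheetDiff, planeKernel]
  rw [integral_sub (((h1 _).1.const_mul _).div_const _) (((h1 _).1.const_mul _).div_const _),
    integral_div, integral_div, integral_const_mul, integral_const_mul, (h1 _).2, (h1 _).2]
  field_simp

/-- The reproducing identity for the kernel `1 / N(Y - A)`. -/
theorem integral_poissonKernel_div (hR : 0 < R) (hδ : 0 < δ) (hZ : Accretive δ (-Z))
    (hδ' : 0 < δ') (hA : Accretive δ' A) :
    Integrable (sheetDiff R (fun y => poissonKernel R Z y / N (mink y - A))) ∧
    ∫ x, sheetDiff R (fun y => poissonKernel R Z y / N (mink y - A)) x =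
      2 * Real.pi ^ 2 * I / N (Z - A) := by
  have h1 := integrable_sheetDiff_planeKernel hR hδ hZ hδ' hA
  have hpi : (Real.pi : ℂ) ≠ 0 := by exact_mod_cast Real.pi_ne_zero
  have h2 : Accretive (δ' + δ) (A - Z) := by
    intro u v
    have := add_le_add (hA u v) (hZ u v)
    rw [← add_re, ← sesq_add, ← sub_eq_add_neg, ← add_mul] at this
    exact this
  constructor
  · exact (h1.integral_prod_left.const_mul ((Real.pi : ℂ)⁻¹)).congr
      (Eventually.of_forall fun x => (sheetDiff_eq_integral hδ' hA x).symm)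
  · simp_rw [sheetDiff_eq_integral hδ' hA]
    rw [integral_const_mul, integral_integral_swap h1]
    simp_rw [integral_planeKernel_sesq hR hδ hZ hδ' hA]
    rw [integral_const_mul, (integral_inv_sesq_sq (add_pos hδ' hδ) h2).2, ← N_neg (A - Z), neg_sub]
    field_simp

end MultipoleIdentity

end ComplexQuaternion

namespace ComplexQuaternion

/-! ### The form dS/‖Y‖ in the space coordinates, and the reflection Y ↦ -Y. -/

section SurfaceMeasure

variable {R : ℝ}

theorem hasGradientAt_sheet (hR : 0 < R) (x : EuclideanSpace ℝ (Fin 3)) :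
    HasGradientAt (sheet R) ((sheet R x)⁻¹ • x) x := by
  rw [hasGradientAt_iff_hasFDerivAt]
  have h1 := ((hasStrictFDerivAt_norm_sq x).hasFDerivAt.const_add (R ^ 2)).sqrt
    (by positivity : R ^ 2 + ‖x‖ ^ 2 ≠ 0)
  refine h1.congr_fderiv ?_
  have hs := sheet_pos hR x
  ext v
  simp only [InnerProductSpace.toDual_apply_apply, inner_smul_left, _root_.smul_apply,
    innerSL_apply_apply]
  change (1 / (2 * sheet R x)) • (2 • inner ℝ x v) = _
  simp
  field_simp

/-- The gradient of the height s is x/s, so √(1 + |∇g|²) = ‖Y‖/s. Dividing by ‖Y‖ leaves the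
Lorentz-invariant measure dx/s. -/
theorem density_sheet (hR : 0 < R) (x : EuclideanSpace ℝ (Fin 3)) {g : EuclideanSpace ℝ (Fin 3) → ℝ}
    (hg : g = sheet R ∨ g = fun x => -sheet R x) :
    Real.sqrt (1 + ‖gradient g x‖ ^ 2) = ‖graphMap g x‖ / sheet R x := by
  have hs := sheet_pos hR x
  have h1 : ‖gradient g x‖ = ‖(sheet R x)⁻¹ • x‖ := by
    rcases hg with rfl | rfl
    · rw [(hasGradientAt_sheet hR x).gradient]
    · have h2 := (hasGradientAt_sheet hR x).hasFDerivAt.neg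
      have h3 : HasGradientAt (fun x => -sheet R x) (-((sheet R x)⁻¹ • x)) x := by
        rw [hasGradientAt_iff_hasFDerivAt, map_neg]
        exact h2
      rw [h3.gradient, norm_neg]
  have h2 : g x ^ 2 = sheet R x ^ 2 := by
    rcases hg with rfl | rfl
    · rfl
    · exact neg_sq _
  rw [h1, norm_smul, norm_inv, Real.norm_of_nonneg hs.le]
  refine (Real.sqrt_eq_iff_eq_sq (by positivity) (by positivity)).2 ?_
  rw [div_pow, norm_sq_graphMap, h2]
  field_simp

theorem orientationSign_graphMap (g : EuclideanSpace ℝ (Fin 3) → ℝ)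
    (x : EuclideanSpace ℝ (Fin 3)) : orientationSign (graphMap g x) = Real.sign (g x) := by
  rw [orientationSign, trace_mink, ofReal_re]
  simp only [graphMap, PiLp.toLp_apply, Matrix.cons_val_zero]
  rcases lt_trichotomy (g x) 0 with h | h | h
  · rw [Real.sign_of_neg h, Real.sign_of_neg (by linarith)]
  · simp [h]
  · rw [Real.sign_of_pos h, Real.sign_of_pos (by linarith)]

theorem measurableEmbedding_graphMap {g : EuclideanSpace ℝ (Fin 3) → ℝ} (hg : Continuous g) :
    MeasurableEmbedding (graphMap g) := by
  refine (continuous_graphMap hg).measurableEmbedding fun x y h => ?_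
  ext i
  have h1 := congrFun (congrArg WithLp.ofLp h) i.succ
  fin_cases i <;> simpa [graphMap] using h1

theorem graphSurfaceMeasure_integral (hR : 0 < R) {g : EuclideanSpace ℝ (Fin 3) → ℝ} {ε : ℝ}
    (hg : (g = sheet R ∧ ε = 1) ∨ (g = (fun x => -sheet R x) ∧ ε = -1))
    {F : EuclideanSpace ℝ (Fin 4) → ℂ}
    (hF : Integrable fun x => F (graphMap g x) / (sheet R x : ℂ)) :
    Integrable (fun y => F y * oneOverNorm y) (graphSurfaceMeasure g) ∧
    ∫ y, F y * oneOverNorm y ∂(graphSurfaceMeasure g) =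
      ε * ∫ x, F (graphMap g x) / (sheet R x : ℂ) := by
  have hg' : g = sheet R ∨ g = fun x => -sheet R x := hg.imp And.left And.left
  have hgc : Continuous g := by
    rcases hg' with rfl | rfl
    · exact continuous_sheet R
    · exact (continuous_sheet R).neg
  have he := measurableEmbedding_graphMap hgc
  have hdm : Measurable fun x => ENNReal.ofReal (Real.sqrt (1 + ‖gradient g x‖ ^ 2)) := by
    simp_rw [density_sheet hR _ hg']
    exact ((continuous_graphMap hgc).norm.measurable.div
      (continuous_sheet R).measurable).ennreal_ofReal
  have hlt : ∀ᵐ x : EuclideanSpace ℝ (Fin 3),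
      ENNReal.ofReal (Real.sqrt (1 + ‖gradient g x‖ ^ 2)) < ⊤ :=
    Eventually.of_forall fun x => ENNReal.ofReal_lt_top
  have hpt : ∀ x, (ENNReal.ofReal (Real.sqrt (1 + ‖gradient g x‖ ^ 2))).toReal •
      (F (graphMap g x) * oneOverNorm (graphMap g x)) =
      ε * (F (graphMap g x) / (sheet R x : ℂ)) := by
    intro x
    have hs := sheet_pos hR x
    have hsig : Real.sign (g x) = ε := by
      rcases hg with ⟨rfl, rfl⟩ | ⟨rfl, rfl⟩
      · exact Real.sign_of_pos hs
      · exact Real.sign_of_neg (neg_lt_zero.2 hs)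
    have hn : ‖graphMap g x‖ ≠ 0 := by
      have habs : |g x| = sheet R x := by
        rcases hg' with rfl | rfl
        · exact abs_of_pos hs
        · rw [abs_neg]; exact abs_of_pos hs
      exact (hs.trans_le (sheet_le_norm_graphMap rfl habs)).ne'
    rw [ENNReal.toReal_ofReal (Real.sqrt_nonneg _), density_sheet hR x hg', oneOverNorm,
      orientationSign_graphMap, hsig, real_smul]
    have hs' : (sheet R x : ℂ) ≠ 0 := by exact_mod_cast hs.ne'
    have hn' : (‖graphMap g x‖ : ℂ) ≠ 0 := by exact_mod_cast hn
    push_cast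
    field_simp
  constructor
  · rw [graphSurfaceMeasure, he.integrable_map_iff, integrable_withDensity_iff_integrable_smul' hdm hlt]
    exact (hF.const_mul (ε : ℂ)).congr (Eventually.of_forall fun x => (hpt x).symm)
  · rw [graphSurfaceMeasure, he.integral_map, integral_withDensity_eq_integral_toReal_smul hdm hlt]
    simp_rw [hpt]
    rw [integral_const_mul]

theorem hyperboloidMeasure_integral (hR : 0 < R) {F : EuclideanSpace ℝ (Fin 4) → ℂ}
    (h1 : Integrable fun x => F (graphMap (sheet R) x) / (sheet R x : ℂ))
    (h2 : Integrable fun x => F (graphMap (fun x => -sheet R x) x) / (sheet R x : ℂ)) :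
    Integrable (fun y => F y * oneOverNorm y) (hyperboloidMeasure R) ∧
    ∫ y, F y * oneOverNorm y ∂(hyperboloidMeasure R) = ∫ x, sheetDiff R F x := by
  have e1 := graphSurfaceMeasure_integral hR (Or.inl ⟨rfl, rfl⟩) h1
  have e2 := graphSurfaceMeasure_integral hR (Or.inr ⟨rfl, rfl⟩) h2
  constructor
  · rw [hyperboloidMeasure, integrable_add_measure]
    exact ⟨e1.1, e2.1⟩
  · rw [hyperboloidMeasure, integral_add_measure e1.1 e2.1, e1.2, e2.2]
    simp only [sheetDiff]
    rw [integral_sub h1 h2]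
    push_cast
    ring

theorem graphMap_mem_hyperboloid (x : EuclideanSpace ℝ (Fin 3)) :
    graphMap (sheet R) x ∈ hyperboloid R ∧ graphMap (fun x => -sheet R x) x ∈ hyperboloid R := by
  rw [hyperboloid_eq]
  exact ⟨Or.inl ⟨x, rfl⟩, Or.inr ⟨x, rfl⟩⟩

/-- Decay of order -3 on the hyperboloid becomes order -4 against dx/s, enough in dimension three.
-/
theorem integrable_cube_bound (hR : 0 < R) :
    Integrable fun x => ((1 + sheet R x) ^ 3)⁻¹ / sheet R x := by
  have h1 : Integrable fun x : EuclideanSpace ℝ (Fin 3) => (1 + ‖x‖) ^ (-(4 : ℝ)) :=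
    integrable_one_add_norm (by simp; norm_num)
  set b := min 1 R with hb
  have hb0 : 0 < b := lt_min one_pos hR
  refine (h1.const_mul (2 / b)).mono' ?_ (Eventually.of_forall fun x => ?_)
  · refine Continuous.aestronglyMeasurable (Continuous.div (Continuous.inv₀ ?_ fun x => ?_)
      (continuous_sheet R) fun x => (sheet_pos hR x).ne')
    · exact (continuous_const.add (continuous_sheet R)).pow 3
    · have := sheet_pos hR x
      positivity
  · have hs := sheet_pos hR x
    have h2 : ‖x‖ ≤ sheet R x := Real.le_sqrt_of_sq_le (by nlinarith)
    have h3 : R ≤ sheet R x := Real.le_sqrt_of_sq_le (by nlinarith [sq_nonneg ‖x‖])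
    have h4 : b ≤ 1 := min_le_left _ _
    have h5 : b ≤ R := min_le_right _ _
    have h6 : b * (1 + ‖x‖) ≤ 2 * sheet R x := by nlinarith [norm_nonneg x]
    have h7 : 0 < 1 + ‖x‖ := by positivity
    rw [Real.norm_of_nonneg (by positivity), show (-(4 : ℝ)) = -((4 : ℕ) : ℝ) by norm_num,
      Real.rpow_neg h7.le, Real.rpow_natCast]
    calc ((1 + sheet R x) ^ 3)⁻¹ / sheet R x
        ≤ ((1 + ‖x‖) ^ 3)⁻¹ / (b * (1 + ‖x‖) / 2) := by
          gcongr
          linarith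
      _ = _ := by field_simp

theorem integrable_comp_graphMap_div_of_bound {F : EuclideanSpace ℝ (Fin 4) → ℂ} (hR : 0 < R)
    (hF : Measurable F) {C : ℝ} (hC : ∀ y ∈ hyperboloid R, ‖F y‖ ≤ C * ((1 + ‖y‖) ^ 3)⁻¹) :
    ∀ g : EuclideanSpace ℝ (Fin 3) → ℝ, (g = sheet R ∨ g = fun x => -sheet R x) →
      (∀ x, ‖F (graphMap g x) / (sheet R x : ℂ)‖ ≤ C * (((1 + sheet R x) ^ 3)⁻¹ / sheet R x)) ∧
      Integrable fun x => F (graphMap g x) / (sheet R x : ℂ) := by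
  intro g hg
  have hgc : Continuous g := by
    rcases hg with rfl | rfl
    · exact continuous_sheet R
    · exact (continuous_sheet R).neg
  have h1 : ∀ x, ‖F (graphMap g x) / (sheet R x : ℂ)‖ ≤
      C * (((1 + sheet R x) ^ 3)⁻¹ / sheet R x) := by
    intro x
    have hs := sheet_pos hR x
    have hmem : graphMap g x ∈ hyperboloid R := by
      rcases hg with rfl | rfl
      · exact (graphMap_mem_hyperboloid x).1
      · exact (graphMap_mem_hyperboloid x).2
    have habs : |g x| = sheet R x := by
      rcases hg with rfl | rfl
      · exact abs_of_pos hs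
      · rw [abs_neg]; exact abs_of_pos hs
    have h2 := hC _ hmem
    have hC0 : 0 ≤ C := nonneg_of_mul_nonneg_left ((norm_nonneg _).trans h2) (by positivity)
    have h3 := sheet_le_norm_graphMap rfl habs
    rw [norm_div, norm_real, Real.norm_of_nonneg hs.le, ← mul_div_assoc]
    refine div_le_div_of_nonneg_right (h2.trans ?_) hs.le
    gcongr
  refine ⟨h1, ((integrable_cube_bound hR).const_mul C).mono' ?_ (Eventually.of_forall h1)⟩
  exact ((hF.comp (continuous_graphMap hgc).measurable).div
    (continuous_ofReal.comp (continuous_sheet R)).measurable).aestronglyMeasurable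

/-- Integrals over the hyperboloid of functions decaying like the cube of the inverse norm. -/
theorem hyperboloidMeasure_integral_of_bound {F : EuclideanSpace ℝ (Fin 4) → ℂ} (hR : 0 < R)
    (hF : Measurable F) {C : ℝ} (hC : ∀ y ∈ hyperboloid R, ‖F y‖ ≤ C * ((1 + ‖y‖) ^ 3)⁻¹) :
    Integrable (fun y => F y * oneOverNorm y) (hyperboloidMeasure R) ∧
    ∫ y, F y * oneOverNorm y ∂(hyperboloidMeasure R) = ∫ x, sheetDiff R F x :=
  hyperboloidMeasure_integral hR (integrable_comp_graphMap_div_of_bound hR hF hC _ (Or.inl rfl)).2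
    (integrable_comp_graphMap_div_of_bound hR hF hC _ (Or.inr rfl)).2

theorem norm_sheetDiff_le {F : EuclideanSpace ℝ (Fin 4) → ℂ} (hR : 0 < R)
    (hF : Measurable F) {C : ℝ} (hC : ∀ y ∈ hyperboloid R, ‖F y‖ ≤ C * ((1 + ‖y‖) ^ 3)⁻¹)
    (x : EuclideanSpace ℝ (Fin 3)) :
    ‖sheetDiff R F x‖ ≤ C * (2 * (((1 + sheet R x) ^ 3)⁻¹ / sheet R x)) := by
  have h1 := (integrable_comp_graphMap_div_of_bound hR hF hC _ (Or.inl rfl)).1 x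
  have h2 := (integrable_comp_graphMap_div_of_bound hR hF hC _ (Or.inr rfl)).1 x
  refine (norm_sub_le _ _).trans ?_
  linarith

theorem hasSum_integral_sheetDiff (hR : 0 < R) {F : ℕ → EuclideanSpace ℝ (Fin 4) → ℂ}
    {G : EuclideanSpace ℝ (Fin 4) → ℂ} (hF : ∀ k, Measurable (F k)) {b : ℕ → ℝ} (hb : Summable b)
    (hle : ∀ k, ∀ y ∈ hyperboloid R, ‖F k y‖ ≤ b k * ((1 + ‖y‖) ^ 3)⁻¹)
    (hG : ∀ y ∈ hyperboloid R, HasSum (fun k => F k y) (G y)) :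
    HasSum (fun k => ∫ x, sheetDiff R (F k) x) (∫ x, sheetDiff R G x) := by
  refine hasSum_integral_of_dominated_convergence
    (fun k x => b k * (2 * (((1 + sheet R x) ^ 3)⁻¹ / sheet R x)))
    (fun k => (measurable_sheetDiff R (hF k)).aestronglyMeasurable)
    (fun k => Eventually.of_forall fun x => norm_sheetDiff_le hR (hF k) (hle k) x)
    (Eventually.of_forall fun x => hb.mul_right _) ?_ (Eventually.of_forall fun x => ?_)
  · simp_rw [tsum_mul_right]
    exact ((integrable_cube_bound hR).const_mul 2).const_mul _
  · exact ((hG _ (graphMap_mem_hyperboloid x).1).div_const _).sub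
      ((hG _ (graphMap_mem_hyperboloid x).2).div_const _)

theorem sheetDiff_neg (F : EuclideanSpace ℝ (Fin 4) → ℂ) (x : EuclideanSpace ℝ (Fin 3)) :
    sheetDiff R F (-x) = -sheetDiff R (fun y => F (-y)) x := by
  have hs : sheet R (-x) = sheet R x := by simp [sheet]
  have e1 : graphMap (sheet R) (-x) = -graphMap (fun x => -sheet R x) x := by
    ext i
    fin_cases i <;> simp [graphMap, hs]
  have e2 : graphMap (fun x => -sheet R x) (-x) = -graphMap (sheet R) x := by
    ext i
    fin_cases i <;> simp [graphMap, hs]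
  rw [sheetDiff, sheetDiff, e1, e2, hs]
  ring

/-- The reflection Y ↦ -Y exchanges the sheets, which carry opposite signs. -/
theorem integral_sheetDiff_neg (F : EuclideanSpace ℝ (Fin 4) → ℂ) :
    ∫ x, sheetDiff R (fun y => F (-y)) x = -∫ x, sheetDiff R F x := by
  rw [← integral_neg_eq_self (sheetDiff R F) volume]
  simp_rw [sheetDiff_neg]
  rw [integral_neg, neg_neg]

theorem mink_neg (y : EuclideanSpace ℝ (Fin 4)) : mink (-y) = -mink y := by
  simp [mink]; abel

/-- The identity for 1/N(Y - A) at the points -A and -Z, pulled back by Y ↦ -Y. All values of N are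
even, so only the sign of the orientation changes. This is the core of the second formula. -/
theorem integral_poissonKernel_div_swap {δ δ' : ℝ} {Z A : HC} (hR : 0 < R) (hδ : 0 < δ)
    (hZ : Accretive δ (-Z)) (hδ' : 0 < δ') (hA : Accretive δ' A) :
    ∫ x, sheetDiff R (fun y => poissonKernel R A y / N (mink y - Z)) x =
      -(2 * Real.pi ^ 2 * I / N (Z - A)) := by
  have h1 := (integral_poissonKernel_div (Z := -A) (A := -Z) hR hδ' (by rwa [neg_neg]) hδ hZ).2
  rw [show -A - -Z = Z - A by abel] at h1
  rw [← h1, ← integral_sheetDiff_neg]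
  congr 1
  ext x
  congr 1
  ext y
  rw [poissonKernel, poissonKernel, mink_neg, N_neg, ← N_neg (-mink y - -A),
    ← N_neg (-mink y - -Z), show -(-mink y - -A) = mink y - A by abel,
    show -(-mink y - -Z) = mink y - Z by abel]

end SurfaceMeasure

end ComplexQuaternion

/-! ### The Cayley transform between the tube and the bounded domain. -/

namespace ComplexQuaternion

open scoped ComplexOrder

theorem dotProduct_mulVec_eq_sesq (M : HC) (x : Fin 2 → ℂ) :
    dotProduct (star x) (M.mulVec x) = sesq M (x 0) (x 1) := by
  simp [sesq, dotProduct, Matrix.mulVec, Fin.sum_univ_two]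

theorem sesq_neg_add_conjTranspose (W : HC) (a b : ℂ) :
    sesq (-(W + W.conjTranspose)) a b = ((2 * (sesq (-W) a b).re : ℝ) : ℂ) := by
  apply Complex.ext <;> simp [sesq, Matrix.conjTranspose_apply] <;> ring

theorem mem_Tplus_iff_posDef (W : HC) : W ∈ Tplus ↔ (-(W + W.conjTranspose)).PosDef := by
  rw [mem_Tplus_iff, Matrix.posDef_iff_dotProduct_mulVec]
  simp_rw [dotProduct_mulVec_eq_sesq, sesq_neg_add_conjTranspose, ← ofReal_zero, real_lt_real]
  constructor
  · rintro ⟨δ, hδ, h⟩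
    refine ⟨?_, fun x hx => ?_⟩
    · rw [Matrix.IsHermitian, Matrix.conjTranspose_neg, Matrix.conjTranspose_add,
        Matrix.conjTranspose_conjTranspose, add_comm]
    · have hx' : 0 < ‖x 0‖ ^ 2 + ‖x 1‖ ^ 2 := by
        by_contra hcon
        refine hx (funext fun i => ?_)
        have h0 : ‖x 0‖ = 0 := by nlinarith [sq_nonneg ‖x 0‖, sq_nonneg ‖x 1‖]
        have h1 : ‖x 1‖ = 0 := by nlinarith [sq_nonneg ‖x 0‖, sq_nonneg ‖x 1‖]
        fin_cases i
        · exact norm_eq_zero.1 h0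
        · exact norm_eq_zero.1 h1
      have := h (x 0) (x 1)
      have := mul_pos hδ hx'
      linarith
  · rintro ⟨-, h⟩
    rw [accretive_neg_iff]
    refine lt_of_re_sesq_neg_pos fun a b hab => ?_
    have := @h ![a, b] (fun h0 => by
      have e0 := congrFun h0 0
      have e1 := congrFun h0 1
      simp at e0 e1
      simp [e0, e1] at hab)
    simp at this
    exact this

theorem accretive_one : Accretive 1 (1 : HC) := by
  intro a b
  simp only [← normSq_eq_norm_sq, normSq_apply]
  simp [sesq]

theorem N_one_sub_mink_ne_zero (y : EuclideanSpace ℝ (Fin 4)) : N (1 - mink y) ≠ 0 := by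
  rw [← N_neg, neg_sub]
  have h : Accretive 1 (-(mink y - 1)) := by
    intro a b
    rw [neg_sub, sub_eq_add_neg, sesq_add, add_re, sesq_neg, neg_re, sesq_mink_re, neg_zero,
      add_zero]
    exact accretive_one a b
  rw [← N_neg]
  exact h.N_ne_zero one_pos

theorem exists_le_norm_N_one_sub_mink :
    ∃ c : ℝ, 0 < c ∧ ∀ y, c * (1 + ‖y‖) ≤ ‖N (1 - mink y)‖ := by
  obtain ⟨c, hc, h⟩ := Accretive.exists_le_norm_N_mink_sub (Z := -1) one_pos
    (by rw [neg_neg]; exact accretive_one)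
  refine ⟨c, hc, fun y => ?_⟩
  have h1 := h (-y)
  rwa [norm_neg, show mink (-y) - -1 = 1 - mink y by
    rw [show mink (-y) = -mink y by simp [mink]; abel]; abel] at h1

theorem N_one_sub_ne_zero_of_mem_Tplus {W : HC} (hW : W ∈ Tplus) : N (1 - W) ≠ 0 := by
  obtain ⟨δ, hδ, h⟩ := (mem_Tplus_iff W).1 hW
  have h1 : Accretive (1 + δ) (1 - W) := by
    intro a b
    rw [sub_eq_add_neg, sesq_add, add_re, add_mul]
    exact add_le_add (accretive_one a b) (h a b)
  exact h1.N_ne_zero (by positivity)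

/-- The Cayley transform from the tube to the bounded domain. -/
noncomputable def cayleyMap (W : HC) : HC := I • ((2 : ℂ) • (1 - W)⁻¹ - 1)

/-- The inverse Cayley transform. -/
noncomputable def tubeMap (P : HC) : HC := 1 + (2 : ℂ) • (I • P - 1)⁻¹

theorem isUnit_of_N_ne_zero {M : HC} (h : N M ≠ 0) : IsUnit M :=
  (Matrix.isUnit_iff_isUnit_det M).2 (isUnit_iff_ne_zero.2 h)

theorem N_ne_zero_of_isUnit {M : HC} (h : IsUnit M) : N M ≠ 0 :=
  isUnit_iff_ne_zero.1 ((Matrix.isUnit_iff_isUnit_det M).1 h)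

theorem mul_inv_of_N_ne_zero {M : HC} (h : N M ≠ 0) : M * M⁻¹ = 1 ∧ M⁻¹ * M = 1 :=
  ⟨Matrix.mul_nonsing_inv M (isUnit_iff_ne_zero.2 h),
    Matrix.nonsing_inv_mul M (isUnit_iff_ne_zero.2 h)⟩

theorem N_smul (c : ℂ) (M : HC) : N (c • M) = c ^ 2 * N M := by
  simp [N]

theorem N_inv (M : HC) : N M⁻¹ = (N M)⁻¹ := by
  simp [N, Matrix.det_nonsing_inv, Ring.inverse_eq_inv']

theorem I_smul_cayleyMap_sub_one (W : HC) :
    I • cayleyMap W - 1 = (-2 : ℂ) • (1 - W)⁻¹ := by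
  rw [cayleyMap, smul_smul, I_mul_I]
  module

theorem N_I_smul_cayleyMap_sub_one (W : HC) :
    N (I • cayleyMap W - 1) = 4 * (N (1 - W))⁻¹ := by
  rw [I_smul_cayleyMap_sub_one, N_smul, N_inv]
  norm_num

theorem inv_smul_of_ne_zero {c : ℂ} (hc : c ≠ 0) {M : HC} (hM : N M ≠ 0) :
    (c • M)⁻¹ = c⁻¹ • M⁻¹ := by
  refine Matrix.inv_eq_left_inv ?_
  rw [smul_mul_smul_comm, inv_mul_cancel₀ hc, (mul_inv_of_N_ne_zero hM).2, one_smul]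

theorem tubeMap_cayleyMap {W : HC} (hW : N (1 - W) ≠ 0) : tubeMap (cayleyMap W) = W := by
  rw [tubeMap, I_smul_cayleyMap_sub_one,
    inv_smul_of_ne_zero (by norm_num) (by rw [N_inv]; exact inv_ne_zero hW),
    Matrix.nonsing_inv_nonsing_inv _ (isUnit_iff_ne_zero.2 hW), smul_smul]
  norm_num

theorem cayley_apply {φ : HC → ℂ} {P : HC} (h : N (I • P - 1) ≠ 0) :
    cayley φ P = (N (I • P - 1))⁻¹ * φ (tubeMap P) := by
  have e1 : (I • (1 : HC)) * P + -1 = I • P - 1 := by rw [smul_mul_assoc, one_mul, sub_eq_add_neg]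
  have e2 : (I • (1 : HC)) * P + 1 = (I • P - 1) + (2 : ℂ) • 1 := by
    rw [smul_mul_assoc, one_mul]; module
  rw [cayley, piZero, e1, e2, add_mul, (mul_inv_of_N_ne_zero h).1, smul_mul_assoc, one_mul, tubeMap]

/-- Inverts π and explains the weight 4/N(1 - W) used for boundary values below. -/
theorem eq_mul_cayley {φ : HC → ℂ} {W : HC} (hW : N (1 - W) ≠ 0) :
    φ W = 4 / N (1 - W) * cayley φ (cayleyMap W) := by
  have h1 := N_I_smul_cayleyMap_sub_one W
  rw [cayley_apply (by rw [h1]; exact mul_ne_zero (by norm_num) (inv_ne_zero hW)), h1,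
    tubeMap_cayleyMap hW]
  field_simp

/-- With Q = iP - 1 the tube point is 1 + 2Q⁻¹, and Q + 1 = iP. The identity is a congruence by Q,
so it carries definiteness of the Hermitian part to 1 - PP* > 0, and anti-Hermitian matrices to
unitary ones. -/
theorem mul_tubeMap {P : HC} (h : N (I • P - 1) ≠ 0) :
    (I • P - 1) * -(tubeMap P + (tubeMap P).conjTranspose) * (I • P - 1).conjTranspose =
      (2 : ℂ) • (1 - P * P.conjTranspose) := by
  set Q := I • P - 1 with hQ
  have h1 : Q * tubeMap P = Q + (2 : ℂ) • 1 := by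
    rw [tubeMap, ← hQ, mul_add, mul_one, mul_smul_comm, (mul_inv_of_N_ne_zero h).1]
  have h2 : (tubeMap P).conjTranspose * Q.conjTranspose = Q.conjTranspose + (2 : ℂ) • 1 := by
    rw [← Matrix.conjTranspose_mul, h1]
    simp [Matrix.conjTranspose_add, Matrix.conjTranspose_smul]
  have h3 : (Q + 1) * (Q + 1).conjTranspose = P * P.conjTranspose := by
    rw [show Q + 1 = I • P by rw [hQ]; abel, Matrix.conjTranspose_smul, smul_mul_smul_comm]
    simp
  rw [← h3, mul_neg, neg_mul, mul_add, add_mul, h1, mul_assoc Q (tubeMap P).conjTranspose, h2,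
    Matrix.conjTranspose_add, Matrix.conjTranspose_one]
  simp only [add_mul, mul_add, smul_mul_assoc, mul_smul_comm, one_mul, mul_one]
  module

theorem posDef_two_smul_iff (M : HC) : ((2 : ℂ) • M).PosDef ↔ M.PosDef := by
  have h2 : (0 : ℂ) < 2 := by
    rw [show (2 : ℂ) = ((2 : ℝ) : ℂ) by norm_num, ← ofReal_zero, real_lt_real]; norm_num
  have h3 : (0 : ℂ) < 2⁻¹ := by
    rw [show (2⁻¹ : ℂ) = ((2⁻¹ : ℝ) : ℂ) by norm_num, ← ofReal_zero, real_lt_real]; norm_num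
  constructor
  · intro h
    have := h.smul h3
    rwa [smul_smul, inv_mul_cancel₀ two_ne_zero, one_smul] at this
  · intro h
    exact h.smul h2

/-- If v is in the kernel of Q*, where Q = iP - 1, then the form of 1 - PP* = -(QQ* + Q + Q*)
vanishes at v, contradicting positivity. -/
theorem N_ne_zero_of_mem_Dplus {P : HC} (hP : P ∈ Dplus) : N (I • P - 1) ≠ 0 := by
  intro h
  set Q := I • P - 1 with hQ
  have hdet : Q.conjTranspose.det = 0 := by
    rw [Matrix.det_conjTranspose]
    change star (N Q) = 0
    rw [h, star_zero]
  obtain ⟨v, hv, hv0⟩ := Matrix.exists_mulVec_eq_zero_iff.2 hdet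
  have h1 := (Matrix.posDef_iff_dotProduct_mulVec.1 hP).2 hv
  have h3 : (Q + 1) * (Q + 1).conjTranspose = P * P.conjTranspose := by
    rw [show Q + 1 = I • P by rw [hQ]; abel, Matrix.conjTranspose_smul, smul_mul_smul_comm]
    simp
  have h4 : (1 - P * P.conjTranspose) = -(Q * Q.conjTranspose + Q + Q.conjTranspose) := by
    rw [← h3, Matrix.conjTranspose_add, Matrix.conjTranspose_one, add_mul, mul_add, one_mul, mul_one]
    abel
  have h5 : dotProduct (star v) (Q.mulVec v) = 0 := by
    rw [Matrix.dotProduct_mulVec, ← Matrix.conjTranspose_conjTranspose Q, ← Matrix.star_mulVec,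
      hv0, star_zero, zero_dotProduct]
  rw [h4, Matrix.neg_mulVec, Matrix.add_mulVec, Matrix.add_mulVec, ← Matrix.mulVec_mulVec, hv0,
    Matrix.mulVec_zero, zero_add, add_zero, dotProduct_neg, h5, neg_zero] at h1
  exact lt_irrefl _ h1

theorem mem_Dplus_iff_tubeMap {P : HC} (h : N (I • P - 1) ≠ 0) : P ∈ Dplus ↔ tubeMap P ∈ Tplus := by
  rw [mem_Tplus_iff_posDef, ← Matrix.IsUnit.posDef_star_right_conjugate_iff (isUnit_of_N_ne_zero h),
    Matrix.star_eq_conjTranspose, mul_tubeMap h, posDef_two_smul_iff]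
  rfl

theorem tubeMap_mem_Tplus {P : HC} (hP : P ∈ Dplus) : tubeMap P ∈ Tplus :=
  (mem_Dplus_iff_tubeMap (N_ne_zero_of_mem_Dplus hP)).1 hP

theorem N_I_smul_cayleyMap_sub_one_ne_zero {W : HC} (hW : N (1 - W) ≠ 0) :
    N (I • cayleyMap W - 1) ≠ 0 := by
  rw [N_I_smul_cayleyMap_sub_one]
  exact mul_ne_zero (by norm_num) (inv_ne_zero hW)

theorem cayleyMap_mem_Dplus {W : HC} (hW : W ∈ Tplus) : cayleyMap W ∈ Dplus := by
  have h := N_one_sub_ne_zero_of_mem_Tplus hW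
  rw [mem_Dplus_iff_tubeMap (N_I_smul_cayleyMap_sub_one_ne_zero h), tubeMap_cayleyMap h]
  exact hW

/-- The unitary group, the Shilov boundary of the bounded domain. -/
def unitarySet : Set HC := {u | u * u.conjTranspose = 1}

theorem mink_mem_Mink (y : EuclideanSpace ℝ (Fin 4)) : (mink y).conjTranspose = -mink y := by
  have : mink y ∈ Mink := range_mink ▸ Set.mem_range_self y
  exact this

theorem cayleyMap_mink_mem (y : EuclideanSpace ℝ (Fin 4)) : cayleyMap (mink y) ∈ unitarySet := by
  have h := N_one_sub_mink_ne_zero y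
  have h1 := mul_tubeMap (N_I_smul_cayleyMap_sub_one_ne_zero h)
  rw [tubeMap_cayleyMap h, mink_mem_Mink, add_neg_cancel, neg_zero, mul_zero, zero_mul] at h1
  have h2 := smul_eq_zero.1 h1.symm
  exact (sub_eq_zero.1 (h2.resolve_left two_ne_zero)).symm

theorem smul_mem_Dplus {u : HC} (hu : u ∈ unitarySet) {t : ℂ} (ht : ‖t‖ < 1) : t • u ∈ Dplus := by
  change (1 - (t • u) * (t • u).conjTranspose).PosDef
  have hu' : u * u.conjTranspose = 1 := hu
  rw [Matrix.conjTranspose_smul, smul_mul_smul_comm, hu', RCLike.star_def, mul_conj']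
  have h1 : (0 : ℂ) < 1 - (‖t‖ : ℂ) ^ 2 := by
    rw [show (1 : ℂ) - (‖t‖ : ℂ) ^ 2 = ((1 - ‖t‖ ^ 2 : ℝ) : ℂ) by push_cast; ring, ← ofReal_zero,
      real_lt_real]
    nlinarith [norm_nonneg t]
  have h2 := (Matrix.PosDef.one (n := Fin 2) (R := ℂ)).smul h1
  rwa [sub_smul, one_smul] at h2

theorem smul_mem_Dminus {u : HC} (hu : u ∈ unitarySet) {t : ℂ} (ht : 1 < ‖t‖) : t • u ∈ Dminus := by
  change ((t • u) * (t • u).conjTranspose - 1).PosDef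
  have hu' : u * u.conjTranspose = 1 := hu
  rw [Matrix.conjTranspose_smul, smul_mul_smul_comm, hu', RCLike.star_def, mul_conj']
  have h1 : (0 : ℂ) < (‖t‖ : ℂ) ^ 2 - 1 := by
    rw [show (‖t‖ : ℂ) ^ 2 - 1 = ((‖t‖ ^ 2 - 1 : ℝ) : ℂ) by push_cast; ring, ← ofReal_zero,
      real_lt_real]
    nlinarith [norm_nonneg t]
  have h2 := (Matrix.PosDef.one (n := Fin 2) (R := ℂ)).smul h1
  rwa [sub_smul, one_smul] at h2

theorem unitarySet_subset_closure_Dplus : unitarySet ⊆ closure Dplus := by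
  intro u hu
  have h1 : Tendsto (fun t : ℝ => (t : ℂ) • u) (𝓝[<] 1) (𝓝 (((1 : ℝ) : ℂ) • u)) :=
    ((continuous_ofReal.smul continuous_const).tendsto 1).mono_left nhdsWithin_le_nhds
  rw [ofReal_one, one_smul] at h1
  refine mem_closure_of_tendsto h1 ?_
  filter_upwards [Ioo_mem_nhdsLT (zero_lt_one (α := ℝ))] with t ht
  refine smul_mem_Dplus hu ?_
  rw [norm_real, Real.norm_of_nonneg ht.1.le]
  exact ht.2

theorem unitarySet_subset_closure_Dminus : unitarySet ⊆ closure Dminus := by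
  intro u hu
  have h1 : Tendsto (fun t : ℝ => (t : ℂ) • u) (𝓝[>] 1) (𝓝 (((1 : ℝ) : ℂ) • u)) :=
    ((continuous_ofReal.smul continuous_const).tendsto 1).mono_left nhdsWithin_le_nhds
  rw [ofReal_one, one_smul] at h1
  refine mem_closure_of_tendsto h1 ?_
  filter_upwards [self_mem_nhdsWithin] with t ht
  refine smul_mem_Dminus hu ?_
  have ht' : 1 < t := ht
  rw [norm_real, Real.norm_of_nonneg (by linarith)]
  exact ht'

theorem norm_apply_le_one {u : HC} (hu : u ∈ unitarySet) (i j : Fin 2) : ‖u i j‖ ≤ 1 := by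
  have hu' : u * u.conjTranspose = 1 := hu
  have h := congrFun (congrFun hu' i) i
  rw [Matrix.mul_apply, Fin.sum_univ_two, Matrix.one_apply_eq] at h
  simp only [Matrix.conjTranspose_apply, RCLike.star_def, mul_conj'] at h
  have h' : ‖u i 0‖ ^ 2 + ‖u i 1‖ ^ 2 = 1 := by exact_mod_cast h
  fin_cases j
  · change ‖u i 0‖ ≤ 1
    nlinarith [sq_nonneg ‖u i 1‖, norm_nonneg (u i 0)]
  · change ‖u i 1‖ ≤ 1
    nlinarith [sq_nonneg ‖u i 0‖, norm_nonneg (u i 1)]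

theorem isClosed_unitarySet : IsClosed unitarySet :=
  isClosed_eq (continuous_id.mul continuous_id.matrix_conjTranspose) continuous_const

section Differentiability

attribute [local instance] Matrix.normedAddCommGroup Matrix.normedSpace

theorem isCompact_unitarySet : IsCompact unitarySet := by
  have h : IsCompact (Metric.closedBall (0 : HC) 1) := isCompact_closedBall _ _
  refine h.of_isClosed_subset isClosed_unitarySet fun u hu => ?_
  rw [mem_closedBall_zero_iff, Matrix.norm_le_iff zero_le_one]
  exact norm_apply_le_one hu

theorem differentiableAt_apply (i j : Fin 2) (M : HC) :
    DifferentiableAt ℂ (fun M : HC => M i j) M :=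
  ((Matrix.entryLinearMap ℂ ℂ i j : HC →ₗ[ℂ] ℂ).toContinuousLinearMap).differentiableAt

theorem differentiableAt_N (M : HC) : DifferentiableAt ℂ N M := by
  have : N = fun M => M 0 0 * M 1 1 - M 0 1 * M 1 0 := funext N_eq
  rw [this]
  exact ((differentiableAt_apply 0 0 M).mul (differentiableAt_apply 1 1 M)).sub
    ((differentiableAt_apply 0 1 M).mul (differentiableAt_apply 1 0 M))

theorem inv_eq_smul (M : HC) : M⁻¹ = (N M)⁻¹ • !![M 1 1, -M 0 1; -M 1 0, M 0 0] := by
  rw [Matrix.inv_def, Ring.inverse_eq_inv', Matrix.adjugate_fin_two]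
  rfl

theorem differentiableAt_inv {M : HC} (h : N M ≠ 0) : DifferentiableAt ℂ (fun M : HC => M⁻¹) M := by
  have e : (fun M : HC => M⁻¹) = fun M : HC => (N M)⁻¹ • !![M 1 1, -M 0 1; -M 1 0, M 0 0] :=
    funext inv_eq_smul
  rw [e]
  refine DifferentiableAt.smul ((differentiableAt_N M).inv h) ?_
  refine differentiableAt_pi.2 fun i => differentiableAt_pi.2 fun j => ?_
  fin_cases i <;> fin_cases j
  · exact differentiableAt_apply 1 1 M
  · exact (differentiableAt_apply 0 1 M).neg
  · exact (differentiableAt_apply 1 0 M).neg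
  · exact differentiableAt_apply 0 0 M

theorem differentiableAt_cayleyMap {W : HC} (h : N (1 - W) ≠ 0) :
    DifferentiableAt ℂ cayleyMap W := by
  have h1 : DifferentiableAt ℂ (fun W : HC => (1 - W)⁻¹) W :=
    DifferentiableAt.comp (f := fun W : HC => 1 - W) (g := fun M : HC => M⁻¹) W
      (differentiableAt_inv h) (differentiableAt_id.const_sub 1)
  exact ((h1.const_smul (2 : ℂ)).sub_const 1).const_smul I

theorem differentiableAt_tubeMap {P : HC} (h : N (I • P - 1) ≠ 0) :
    DifferentiableAt ℂ tubeMap P := by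
  have h1 : DifferentiableAt ℂ (fun P : HC => (I • P - 1)⁻¹) P :=
    DifferentiableAt.comp (f := fun P : HC => I • P - 1) (g := fun M : HC => M⁻¹) P
      (differentiableAt_inv h) ((differentiableAt_id.const_smul I).sub_const 1)
  exact (h1.const_smul (2 : ℂ)).const_add 1

theorem isOpen_Dplus : IsOpen Dplus := by
  rw [isOpen_iff_mem_nhds]
  intro P hP
  have h := N_ne_zero_of_mem_Dplus hP
  have h1 : ContinuousAt (fun P : HC => N (I • P - 1)) P :=
    ((differentiableAt_N _).comp (f := fun P : HC => I • P - 1) P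
      ((differentiableAt_id.const_smul I).sub_const 1)).continuousAt
  have h2 := (differentiableAt_tubeMap h).continuousAt.preimage_mem_nhds
    (isOpen_Tplus.mem_nhds (tubeMap_mem_Tplus hP))
  filter_upwards [h1.eventually_ne h, h2] with P' h3 h4
  exact (mem_Dplus_iff_tubeMap h3).2 h4

theorem differentiableOn_cayley {φ : HC → ℂ} (hφ : DifferentiableOn ℂ φ Tplus) :
    DifferentiableOn ℂ (cayley φ) Dplus := by
  have h : DifferentiableOn ℂ (fun P => (N (I • P - 1))⁻¹ * φ (tubeMap P)) Dplus := by
    intro P hP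
    have h0 := N_ne_zero_of_mem_Dplus hP
    refine DifferentiableAt.differentiableWithinAt (DifferentiableAt.mul ?_ ?_)
    · exact DifferentiableAt.inv ((differentiableAt_N _).comp (f := fun P : HC => I • P - 1) P
        ((differentiableAt_id.const_smul I).sub_const 1)) h0
    · exact DifferentiableAt.comp P
        (hφ.differentiableAt (isOpen_Tplus.mem_nhds (tubeMap_mem_Tplus hP)))
        (differentiableAt_tubeMap h0)
  exact h.congr fun P hP => cayley_apply (N_ne_zero_of_mem_Dplus hP)

end Differentiability

end ComplexQuaternion

/-! ### Boundary values on M and their image under the degree operator. -/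

namespace ComplexQuaternion

/-- The function on Minkowski space that corresponds to the function `χ` near the unitary group. -/
noncomputable def liftBd (χ : HC → ℂ) (y : EuclideanSpace ℝ (Fin 4)) : ℂ :=
  4 / N (1 - mink y) * χ (cayleyMap (mink y))

/-- The velocity of `s ↦ cayleyMap (s W)` at `s = 1`. -/
noncomputable def cayleyVel (W : HC) : HC :=
  (2 * I / N (1 - W) ^ 2) • (W - (2 * N W) • (1 : HC) + N W • W.adjugate)

theorem N_one_sub_smul (s : ℂ) (W : HC) :
    N (1 - s • W) = 1 - s * (W 0 0 + W 1 1) + s ^ 2 * N W := by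
  simp [N_eq]; ring

section Derivatives

attribute [local instance] Matrix.normedAddCommGroup Matrix.normedSpace

theorem hasDerivAt_N_one_sub_smul (W : HC) :
    HasDerivAt (fun s : ℂ => N (1 - s • W)) (-(W 0 0 + W 1 1) + 2 * N W) 1 := by
  simp_rw [N_one_sub_smul]
  have h1 : HasDerivAt (fun s : ℂ => s * (W 0 0 + W 1 1)) (1 * (W 0 0 + W 1 1)) 1 :=
    (hasDerivAt_id (1 : ℂ)).mul_const _
  have h2 : HasDerivAt (fun s : ℂ => s ^ 2 * N W) (2 * N W) 1 := by
    simpa using ((hasDerivAt_id (1 : ℂ)).fun_pow 2).mul_const (N W)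
  refine ((h1.const_sub 1).add h2).congr_deriv ?_
  ring

theorem cayleyMap_smul (s : ℂ) (W : HC) :
    cayleyMap (s • W) = (2 * I * (N (1 - s • W))⁻¹) • (1 - s • W.adjugate) - I • (1 : HC) := by
  have h : (1 - s • W)⁻¹ = (N (1 - s • W))⁻¹ • (1 - s • W.adjugate) := by
    rw [inv_eq_smul, Matrix.adjugate_fin_two]
    congr 1
    ext i j
    fin_cases i <;> fin_cases j <;> simp
  rw [cayleyMap, h]
  module

/-- The point of the chosen form is its size: the numerator is linear in W up to factors N(W), which
are constant on the hyperboloid. With N(1 - W) in the denominator squared, the velocity is O(1/‖Y‖).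
-/
theorem hasDerivAt_cayleyMap_smul {W : HC} (h : N (1 - W) ≠ 0) :
    HasDerivAt (fun s : ℂ => cayleyMap (s • W)) (cayleyVel W) 1 := by
  have h' : N (1 - (1 : ℂ) • W) ≠ 0 := by rwa [one_smul]
  simp_rw [cayleyMap_smul]
  have h1 := ((hasDerivAt_N_one_sub_smul W).inv h').const_mul (2 * I)
  have h2 : HasDerivAt (fun s : ℂ => (1 : HC) - s • W.adjugate) (-W.adjugate) 1 := by
    have := (((hasDerivAt_id (1 : ℂ)).smul_const W.adjugate).const_sub (1 : HC))
    rwa [one_smul] at this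
  have h3 := (h1.smul h2).sub_const (I • (1 : HC))
  refine h3.congr_deriv ?_
  have hn := N_one_sub_smul 1 W
  rw [one_smul, one_mul, one_pow, one_mul] at hn
  have hadj : W + W.adjugate = (W 0 0 + W 1 1) • (1 : HC) := by
    rw [Matrix.adjugate_fin_two]
    ext i j
    fin_cases i <;> fin_cases j <;> simp
    ring
  rw [cayleyVel, eq_sub_of_add_eq' hadj]
  simp only [one_smul, Pi.inv_apply]
  -- Over the common denominator N(1 - W)² the trace terms cancel.
  have e1 : 2 * I * (N (1 - W))⁻¹ = 2 * I / N (1 - W) ^ 2 * (1 - (W 0 0 + W 1 1) + N W) := by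
    rw [← hn]; field_simp
  rw [e1]
  module

/-- The extra factor s, the 1 in `degTilde`, makes the coefficient of χ collapse to 4(1 - N(W))/N(1
- W)². On the hyperboloid this decays one order faster than 4/N(1 - W) itself. -/
theorem hasDerivAt_mul_lift {χ : HC → ℂ} {W : HC} (h : N (1 - W) ≠ 0)
    (hχ : DifferentiableAt ℂ χ (cayleyMap W)) :
    HasDerivAt (fun s : ℂ => s * (4 / N (1 - s • W) * χ (cayleyMap (s • W))))
      (4 * (1 - N W) / N (1 - W) ^ 2 * χ (cayleyMap W) +
        4 / N (1 - W) * fderiv ℂ χ (cayleyMap W) (cayleyVel W)) 1 := by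
  have h' : N (1 - (1 : ℂ) • W) ≠ 0 := by rwa [one_smul]
  have h1 : HasDerivAt (fun s : ℂ => 4 / N (1 - s • W))
      ((0 * N (1 - (1 : ℂ) • W) - 4 * (-(W 0 0 + W 1 1) + 2 * N W)) / N (1 - (1 : ℂ) • W) ^ 2) 1 :=
    (hasDerivAt_const (1 : ℂ) (4 : ℂ)).div (hasDerivAt_N_one_sub_smul W) h'
  have h2 : HasDerivAt (fun s : ℂ => χ (cayleyMap (s • W)))
      (fderiv ℂ χ (cayleyMap W) (cayleyVel W)) 1 := by
    have hχ' : HasFDerivAt χ (fderiv ℂ χ (cayleyMap W)) (cayleyMap ((1 : ℂ) • W)) := by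
      rw [one_smul]; exact hχ.hasFDerivAt
    exact HasFDerivAt.comp_hasDerivAt (1 : ℂ) hχ' (hasDerivAt_cayleyMap_smul h)
  refine ((hasDerivAt_id (1 : ℂ)).mul (h1.mul h2)).congr_deriv ?_
  have hn := N_one_sub_smul 1 W
  rw [one_smul, one_mul, one_pow, one_mul] at hn
  simp only [one_smul, Pi.mul_apply, id]
  have e : (W 0 0 + W 1 1) = 1 + N W - N (1 - W) := by rw [hn]; ring
  rw [e]
  field_simp
  ring

/-- `mink` as a real linear map. -/
noncomputable def minkLinear : EuclideanSpace ℝ (Fin 4) →ₗ[ℝ] HC where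
  toFun := mink
  map_add' x y := by simp [mink, add_smul]; abel
  map_smul' c x := by
    simp [mink, mul_smul]

theorem mink_smul (c : ℝ) (y : EuclideanSpace ℝ (Fin 4)) : mink (c • y) = (c : ℂ) • mink y := by
  simp [mink, mul_smul]

theorem differentiable_mink : Differentiable ℝ mink :=
  (LinearMap.toContinuousLinearMap minkLinear).differentiable

theorem differentiableAt_liftBd {χ : HC → ℂ} {y : EuclideanSpace ℝ (Fin 4)}
    (hχ : DifferentiableAt ℂ χ (cayleyMap (mink y))) : DifferentiableAt ℝ (liftBd χ) y := by
  have h0 := N_one_sub_mink_ne_zero y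
  have h1 : DifferentiableAt ℂ (fun W : HC => 4 / N (1 - W) * χ (cayleyMap W)) (mink y) := by
    refine DifferentiableAt.mul ?_ ?_
    · have hN : DifferentiableAt ℂ (fun W : HC => N (1 - W)) (mink y) := DifferentiableAt.comp
        (f := fun W : HC => 1 - W) (mink y) (differentiableAt_N _) (differentiableAt_id.const_sub 1)
      have := (hN.inv h0).const_mul 4
      simp only [div_eq_mul_inv]
      exact this
    · exact DifferentiableAt.comp (mink y) hχ (differentiableAt_cayleyMap h0)
  exact DifferentiableAt.comp y (h1.restrictScalars ℝ) (differentiable_mink y)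

theorem degTilde_eq (f : EuclideanSpace ℝ (Fin 4) → ℂ) (y : EuclideanSpace ℝ (Fin 4)) :
    degTilde f y = f y + fderiv ℝ f y y := by
  rw [degTilde]
  congr 1
  have h : y = ∑ i, y i • EuclideanSpace.single i (1 : ℝ) := by
    ext j
    simp [Finset.sum_apply, Pi.single_apply]
  conv_rhs => rw [h]
  rw [map_sum]
  conv_rhs => rw [← h]
  refine Finset.sum_congr rfl fun i _ => ?_
  rw [map_smul, real_smul]

/-- The operator `degTilde` is the derivative of s f(sy) at s = 1; it may be computed from any
complex-differentiable extension of this function of s. -/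
theorem degTilde_eq_of_hasDerivAt {f : EuclideanSpace ℝ (Fin 4) → ℂ}
    {y : EuclideanSpace ℝ (Fin 4)} (hf : DifferentiableAt ℝ f y) {g : ℂ → ℂ} {g' : ℂ}
    (hg : HasDerivAt g g' 1) (h : ∀ s : ℝ, g s = s * f (s • y)) : degTilde f y = g' := by
  have h1 : HasDerivAt (fun s : ℝ => s • y) y 1 := by
    simpa using (hasDerivAt_id (1 : ℝ)).smul_const y
  have h2 : HasDerivAt (fun s : ℝ => f (s • y)) (fderiv ℝ f y y) 1 := by
    have hf' : HasFDerivAt f (fderiv ℝ f y) ((1 : ℝ) • y) := by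
      rw [one_smul]; exact hf.hasFDerivAt
    exact HasFDerivAt.comp_hasDerivAt (1 : ℝ) hf' h1
  have h3 : HasDerivAt (fun s : ℝ => (s : ℂ)) 1 1 := by
    exact Complex.ofRealCLM.hasDerivAt
  have h4 := h3.mul h2
  have h5 : HasDerivAt (fun s : ℝ => g s) g' 1 := HasDerivAt.comp_ofReal (by simpa using hg)
  have h6 : (fun s : ℝ => g s) = (fun s : ℝ => (s : ℂ)) * fun s : ℝ => f (s • y) := funext h
  rw [h6] at h5
  rw [degTilde_eq, h5.unique h4]
  simp

theorem degTilde_liftBd {χ : HC → ℂ} {y : EuclideanSpace ℝ (Fin 4)}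
    (hχ : DifferentiableAt ℂ χ (cayleyMap (mink y))) :
    degTilde (liftBd χ) y =
      4 * (1 - N (mink y)) / N (1 - mink y) ^ 2 * χ (cayleyMap (mink y)) +
        4 / N (1 - mink y) * fderiv ℂ χ (cayleyMap (mink y)) (cayleyVel (mink y)) := by
  refine degTilde_eq_of_hasDerivAt (differentiableAt_liftBd hχ)
    (hasDerivAt_mul_lift (N_one_sub_mink_ne_zero y) hχ) fun s => ?_
  rw [liftBd, mink_smul]

end Derivatives

theorem measurable_degTilde {f : EuclideanSpace ℝ (Fin 4) → ℂ} (hf : Measurable f) :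
    Measurable (degTilde f) := by
  refine hf.add (Finset.measurable_fun_sum _ fun i _ => Measurable.mul ?_ ?_)
  · exact (continuous_ofReal.comp (PiLp.continuous_apply 2 _ i)).measurable
  · exact measurable_fderiv_apply_const ℝ f _

theorem eq_sum_single (V : HC) :
    V = ∑ i : Fin 2, ∑ j : Fin 2, V i j • (Matrix.single i j (1 : ℂ) : HC) := by
  ext k l
  fin_cases k <;> fin_cases l <;>
    simp [Fin.sum_univ_two, Matrix.add_apply]

theorem map_eq_sum_single (L : HC →L[ℂ] ℂ) (V : HC) :
    L V = ∑ i : Fin 2, ∑ j : Fin 2, V i j * L (Matrix.single i j (1 : ℂ)) := by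
  conv_lhs => rw [eq_sum_single V]
  simp only [map_sum, map_smul, smul_eq_mul]

/-! ### Decay on the hyperboloid and termwise integration. -/

section Bounds

variable {R : ℝ}

theorem N_mink_of_mem {y : EuclideanSpace ℝ (Fin 4)} (hy : y ∈ hyperboloid R) :
    N (mink y) = ((-R ^ 2 : ℝ) : ℂ) := hy

theorem exists_norm_cayleyVel_le (R : ℝ) : ∃ C : ℝ, 0 ≤ C ∧ ∀ y ∈ hyperboloid R, ∀ i j,
    ‖cayleyVel (mink y) i j‖ ≤ C * (1 + ‖y‖)⁻¹ := by
  obtain ⟨c, hc, h⟩ := exists_le_norm_N_one_sub_mink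
  refine ⟨2 * (2 + 4 * R ^ 2) / c ^ 2, by positivity, fun y hy i j => ?_⟩
  have h1 := h y
  have hN : ‖N (mink y)‖ = R ^ 2 := by
    rw [N_mink_of_mem hy, norm_real, norm_neg, Real.norm_of_nonneg (sq_nonneg R)]
  have hadj : ‖(mink y).adjugate i j‖ ≤ 2 * ‖y‖ := by
    rw [Matrix.adjugate_fin_two]
    fin_cases i <;> fin_cases j
    · exact norm_mink_apply_le y 1 1
    · exact (norm_neg _).trans_le (norm_mink_apply_le y 0 1)
    · exact (norm_neg _).trans_le (norm_mink_apply_le y 1 0)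
    · exact norm_mink_apply_le y 0 0
  have hone : ‖(1 : HC) i j‖ ≤ 1 := by
    rw [Matrix.one_apply]
    split_ifs <;> simp
  have hin : ‖(mink y - (2 * N (mink y)) • (1 : HC) + N (mink y) • (mink y).adjugate) i j‖ ≤
      (2 + 4 * R ^ 2) * (1 + ‖y‖) := by
    rw [Matrix.add_apply, Matrix.sub_apply, Matrix.smul_apply, Matrix.smul_apply]
    refine (norm_add_le _ _).trans ((add_le_add_left (norm_sub_le _ _) _).trans ?_)
    rw [norm_smul, norm_smul, norm_mul, hN]
    have h2 := norm_mink_apply_le y i j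
    have h3 := mul_le_mul_of_nonneg_left hadj (sq_nonneg R)
    have h4 := mul_le_mul_of_nonneg_left hone (sq_nonneg R)
    norm_num at h4 ⊢
    nlinarith [norm_nonneg y, sq_nonneg R]
  have hy0 : 0 < 1 + ‖y‖ := by positivity
  rw [cayleyVel, Matrix.smul_apply, norm_smul, norm_div, norm_pow, norm_mul, norm_I, mul_one,
    RCLike.norm_ofNat]
  calc 2 / ‖N (1 - mink y)‖ ^ 2 *
        ‖(mink y - (2 * N (mink y)) • (1 : HC) + N (mink y) • (mink y).adjugate) i j‖
      ≤ 2 / (c * (1 + ‖y‖)) ^ 2 * ((2 + 4 * R ^ 2) * (1 + ‖y‖)) := by gcongr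
    _ = _ := by field_simp

/-- One power of 1/‖Y‖ from the weight, and a second one after `degTilde`. Together with the kernels
of order -2 and -1 both integrands have order -3, with a constant linear in the size b of χ and its
derivatives. -/
theorem exists_norm_liftBd_le (R : ℝ) : ∃ C : ℝ, 0 ≤ C ∧ ∀ y ∈ hyperboloid R, ∀ (χ : HC → ℂ)
    (b : ℝ), DifferentiableAt ℂ χ (cayleyMap (mink y)) → ‖χ (cayleyMap (mink y))‖ ≤ b →
    (∀ i j, ‖fderiv ℂ χ (cayleyMap (mink y)) (Matrix.single i j (1 : ℂ))‖ ≤ b) →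
    ‖liftBd χ y‖ ≤ C * b * (1 + ‖y‖)⁻¹ ∧ ‖degTilde (liftBd χ) y‖ ≤ C * b * ((1 + ‖y‖) ^ 2)⁻¹ := by
  obtain ⟨c, hc, h⟩ := exists_le_norm_N_one_sub_mink
  obtain ⟨C, hC, hV⟩ := exists_norm_cayleyVel_le R
  refine ⟨4 / c + 4 * (1 + R ^ 2) / c ^ 2 + 16 * C / c, by positivity,
    fun y hy χ b hd hb hb' => ?_⟩
  have h1 := h y
  have hy0 : 0 < 1 + ‖y‖ := by positivity
  have hb0 : 0 ≤ b := (norm_nonneg _).trans hb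
  have e1 : ‖4 / N (1 - mink y)‖ ≤ 4 / c * (1 + ‖y‖)⁻¹ := by
    rw [norm_div, RCLike.norm_ofNat]
    calc 4 / ‖N (1 - mink y)‖ ≤ 4 / (c * (1 + ‖y‖)) := by gcongr
      _ = _ := by field_simp
  have e2 : ‖4 * (1 - N (mink y)) / N (1 - mink y) ^ 2‖ ≤
      4 * (1 + R ^ 2) / c ^ 2 * ((1 + ‖y‖) ^ 2)⁻¹ := by
    have e3 : ‖1 - N (mink y)‖ = 1 + R ^ 2 := by
      rw [N_mink_of_mem hy, show (1 : ℂ) - ((-R ^ 2 : ℝ) : ℂ) = ((1 + R ^ 2 : ℝ) : ℂ) by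
        push_cast; ring, norm_real, Real.norm_of_nonneg (by positivity)]
    rw [norm_div, norm_mul, e3, RCLike.norm_ofNat, norm_pow]
    calc 4 * (1 + R ^ 2) / ‖N (1 - mink y)‖ ^ 2
        ≤ 4 * (1 + R ^ 2) / (c * (1 + ‖y‖)) ^ 2 := by gcongr
      _ = _ := by field_simp
  constructor
  · rw [liftBd, norm_mul]
    calc ‖4 / N (1 - mink y)‖ * ‖χ (cayleyMap (mink y))‖ ≤ 4 / c * (1 + ‖y‖)⁻¹ * b := by gcongr
      _ = 4 / c * (b * (1 + ‖y‖)⁻¹) := by ring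
      _ ≤ (4 / c + 4 * (1 + R ^ 2) / c ^ 2 + 16 * C / c) * (b * (1 + ‖y‖)⁻¹) := by
          gcongr
          rw [add_assoc]
          exact le_add_of_nonneg_right (by positivity)
      _ = _ := by ring
  · have e4 : ‖fderiv ℂ χ (cayleyMap (mink y)) (cayleyVel (mink y))‖ ≤
        4 * (C * (1 + ‖y‖)⁻¹ * b) := by
      rw [map_eq_sum_single]
      calc _ ≤ ∑ i : Fin 2, ∑ j : Fin 2, C * (1 + ‖y‖)⁻¹ * b := by
            refine norm_sum_le_of_le _ fun i _ => norm_sum_le_of_le _ fun j _ => ?_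
            rw [norm_mul]
            exact mul_le_mul (hV y hy i j) (hb' i j) (norm_nonneg _) (by positivity)
        _ = _ := by simp; ring
    rw [degTilde_liftBd hd]
    refine (norm_add_le _ _).trans ?_
    rw [norm_mul, norm_mul]
    calc _ ≤ 4 * (1 + R ^ 2) / c ^ 2 * ((1 + ‖y‖) ^ 2)⁻¹ * b +
          4 / c * (1 + ‖y‖)⁻¹ * (4 * (C * (1 + ‖y‖)⁻¹ * b)) := by gcongr
      _ = (4 * (1 + R ^ 2) / c ^ 2 + 16 * C / c) * (b * ((1 + ‖y‖) ^ 2)⁻¹) := by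
          field_simp; ring
      _ ≤ (4 / c + 4 * (1 + R ^ 2) / c ^ 2 + 16 * C / c) * (b * ((1 + ‖y‖) ^ 2)⁻¹) := by
          gcongr
          have : 0 ≤ 4 / c := by positivity
          linarith
      _ = _ := by ring

/-- The integrand of the first formula. -/
noncomputable def poissonIntegrand (R : ℝ) (Z : HC) (χ : HC → ℂ) (y : EuclideanSpace ℝ (Fin 4)) :
    ℂ := poissonKernel R Z y * liftBd χ y

/-- The integrand of the second formula. -/
noncomputable def degIntegrand (Z : HC) (χ : HC → ℂ) (y : EuclideanSpace ℝ (Fin 4)) : ℂ :=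
  degTilde (liftBd χ) y / N (mink y - Z)

theorem exists_norm_integrand_le (R : ℝ) {Z : HC} (hZ : Z ∈ Tplus) :
    ∃ C : ℝ, 0 ≤ C ∧ ∀ y ∈ hyperboloid R, ∀ (χ : HC → ℂ)
    (b : ℝ), DifferentiableAt ℂ χ (cayleyMap (mink y)) → ‖χ (cayleyMap (mink y))‖ ≤ b →
    (∀ i j, ‖fderiv ℂ χ (cayleyMap (mink y)) (Matrix.single i j (1 : ℂ))‖ ≤ b) →
    ‖poissonIntegrand R Z χ y‖ ≤ C * b * ((1 + ‖y‖) ^ 3)⁻¹ ∧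
    ‖degIntegrand Z χ y‖ ≤ C * b * ((1 + ‖y‖) ^ 3)⁻¹ := by
  obtain ⟨δ, hδ, hZ'⟩ := (mem_Tplus_iff Z).1 hZ
  obtain ⟨c, hc, h⟩ := hZ'.exists_le_norm_N_mink_sub hδ
  obtain ⟨C, hC, hle⟩ := exists_norm_liftBd_le R
  refine ⟨‖(R : ℂ) ^ 2 + N Z‖ / c ^ 2 * C + C / c, by positivity, fun y hy χ b hd hb hb' => ?_⟩
  obtain ⟨h1, h2⟩ := hle y hy χ b hd hb hb'
  have hy0 : 0 < 1 + ‖y‖ := by positivity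
  have hb0 : 0 ≤ b := (norm_nonneg _).trans hb
  have h3 := h y
  constructor
  · rw [poissonIntegrand, norm_mul, poissonKernel, norm_div, norm_pow]
    calc _ ≤ ‖(R : ℂ) ^ 2 + N Z‖ / (c * (1 + ‖y‖)) ^ 2 * (C * b * (1 + ‖y‖)⁻¹) := by gcongr
      _ = ‖(R : ℂ) ^ 2 + N Z‖ / c ^ 2 * C * (b * ((1 + ‖y‖) ^ 3)⁻¹) := by field_simp
      _ ≤ (‖(R : ℂ) ^ 2 + N Z‖ / c ^ 2 * C + C / c) * (b * ((1 + ‖y‖) ^ 3)⁻¹) := by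
          gcongr
          exact le_add_of_nonneg_right (by positivity)
      _ = _ := by ring
  · rw [degIntegrand, norm_div]
    calc _ ≤ C * b * ((1 + ‖y‖) ^ 2)⁻¹ / (c * (1 + ‖y‖)) := by gcongr
      _ = C / c * (b * ((1 + ‖y‖) ^ 3)⁻¹) := by field_simp
      _ ≤ (‖(R : ℂ) ^ 2 + N Z‖ / c ^ 2 * C + C / c) * (b * ((1 + ‖y‖) ^ 3)⁻¹) := by
          gcongr
          exact le_add_of_nonneg_left (by positivity)
      _ = _ := by ring

theorem measurable_liftBd {χ : HC → ℂ} (hχ : ∀ u ∈ unitarySet, DifferentiableAt ℂ χ u) :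
    Measurable (liftBd χ) := by
  have : Differentiable ℝ (liftBd χ) := fun y =>
    differentiableAt_liftBd (hχ _ (cayleyMap_mink_mem y))
  exact this.continuous.measurable

theorem measurable_integrand {χ : HC → ℂ} (hχ : ∀ u ∈ unitarySet, DifferentiableAt ℂ χ u)
    (R : ℝ) (Z : HC) : Measurable (poissonIntegrand R Z χ) ∧ Measurable (degIntegrand Z χ) :=
  ⟨(measurable_poissonKernel R Z).mul (measurable_liftBd hχ),
    (measurable_degTilde (measurable_liftBd hχ)).div
      (continuous_N.comp (continuous_mink.sub continuous_const)).measurable⟩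

/-- Series of functions near the unitary group may be integrated termwise. -/
theorem hasSum_integral_integrand (hR : 0 < R) {Z : HC} (hZ : Z ∈ Tplus) {χ : HC → ℂ}
    {χk : ℕ → HC → ℂ} (hχ : ∀ u ∈ unitarySet, DifferentiableAt ℂ χ u)
    (hχk : ∀ k, ∀ u ∈ unitarySet, DifferentiableAt ℂ (χk k) u) {b : ℕ → ℝ} (hb : Summable b)
    (h0 : ∀ k, ∀ u ∈ unitarySet, ‖χk k u‖ ≤ b k)
    (h1 : ∀ k, ∀ u ∈ unitarySet, ∀ i j, ‖fderiv ℂ (χk k) u (Matrix.single i j (1 : ℂ))‖ ≤ b k)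
    (hs0 : ∀ u ∈ unitarySet, HasSum (fun k => χk k u) (χ u))
    (hs1 : ∀ u ∈ unitarySet, ∀ i j, HasSum
      (fun k => fderiv ℂ (χk k) u (Matrix.single i j (1 : ℂ)))
      (fderiv ℂ χ u (Matrix.single i j (1 : ℂ)))) :
    HasSum (fun k => ∫ x, sheetDiff R (poissonIntegrand R Z (χk k)) x)
      (∫ x, sheetDiff R (poissonIntegrand R Z χ) x) ∧
    HasSum (fun k => ∫ x, sheetDiff R (degIntegrand Z (χk k)) x)
      (∫ x, sheetDiff R (degIntegrand Z χ) x) := by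
  obtain ⟨C, hC, hle⟩ := exists_norm_integrand_le R hZ
  have hsum := hb.mul_left C
  constructor
  · refine hasSum_integral_sheetDiff hR (fun k => (measurable_integrand (hχk k) R Z).1) hsum
      (fun k y hy => ?_) fun y hy => ?_
    · have hu := cayleyMap_mink_mem y
      exact (hle y hy _ _ (hχk k _ hu) (h0 k _ hu) (h1 k _ hu)).1
    · exact ((hs0 _ (cayleyMap_mink_mem y)).mul_left _).mul_left _
  · refine hasSum_integral_sheetDiff hR (fun k => (measurable_integrand (hχk k) R Z).2) hsum
      (fun k y hy => ?_) fun y hy => ?_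
    · have hu := cayleyMap_mink_mem y
      exact (hle y hy _ _ (hχk k _ hu) (h0 k _ hu) (h1 k _ hu)).2
    · have hu := cayleyMap_mink_mem y
      simp only [degIntegrand]
      simp_rw [fun k => degTilde_liftBd (hχk k _ hu)]
      rw [degTilde_liftBd (hχ _ hu)]
      refine HasSum.div_const (((hs0 _ hu).mul_left _).add (HasSum.mul_left _ ?_)) _
      rw [map_eq_sum_single, funext fun k => map_eq_sum_single
        (fderiv ℂ (χk k) (cayleyMap (mink y))) (cayleyVel (mink y))]
      exact hasSum_sum fun i _ => hasSum_sum fun j _ => (hs1 _ hu i j).mul_left _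

end Bounds

end ComplexQuaternion

/-! ### Both formulas for powers of linear forms, through their generating function. -/

namespace ComplexQuaternion

/-- The linear form `(s, 1) P (t, 1)ᵀ`. -/
def linForm (s t : ℂ) (P : HC) : ℂ := s * t * P 0 0 + s * P 0 1 + t * P 1 0 + P 1 1

section Reproduced

variable {R : ℝ} {Z : HC}

theorem integrable_sheetDiff_integrand (hR : 0 < R) (hZ : Z ∈ Tplus) {χ : HC → ℂ}
    (hχ : ∀ u ∈ unitarySet, DifferentiableAt ℂ χ u) {b : ℝ}
    (h0 : ∀ u ∈ unitarySet, ‖χ u‖ ≤ b)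
    (h1 : ∀ u ∈ unitarySet, ∀ i j, ‖fderiv ℂ χ u (Matrix.single i j (1 : ℂ))‖ ≤ b) :
    Integrable (sheetDiff R (poissonIntegrand R Z χ)) ∧
      Integrable (sheetDiff R (degIntegrand Z χ)) := by
  obtain ⟨C, hC, hle⟩ := exists_norm_integrand_le R hZ
  obtain ⟨hm1, hm2⟩ := measurable_integrand hχ R Z
  have hle' := fun y hy => hle y hy χ b (hχ _ (cayleyMap_mink_mem y)) (h0 _ (cayleyMap_mink_mem y))
    (h1 _ (cayleyMap_mink_mem y))
  have hint := ((integrable_cube_bound hR).const_mul 2).const_mul (C * b)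
  exact ⟨hint.mono' (measurable_sheetDiff R hm1).aestronglyMeasurable
      (Eventually.of_forall (norm_sheetDiff_le hR hm1 fun y hy => (hle' y hy).1)),
    hint.mono' (measurable_sheetDiff R hm2).aestronglyMeasurable
      (Eventually.of_forall (norm_sheetDiff_le hR hm2 fun y hy => (hle' y hy).2))⟩

theorem sheetDiff_congr {F G : EuclideanSpace ℝ (Fin 4) → ℂ} (h : ∀ y ∈ hyperboloid R, F y = G y) :
    sheetDiff R F = sheetDiff R G := by
  ext x
  rw [sheetDiff, sheetDiff, h _ (graphMap_mem_hyperboloid x).1, h _ (graphMap_mem_hyperboloid x).2]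

/-- The function `χ` near the unitary group satisfies both reproducing formulas at `Z`. -/
structure Reproduced (R : ℝ) (Z : HC) (χ : HC → ℂ) : Prop where
  diff : ∀ u ∈ unitarySet, DifferentiableAt ℂ χ u
  int_poisson : Integrable (sheetDiff R (poissonIntegrand R Z χ))
  eq_poisson : ∫ x, sheetDiff R (poissonIntegrand R Z χ) x =
    2 * Real.pi ^ 2 * I * (4 / N (1 - Z) * χ (cayleyMap Z))
  int_deg : Integrable (sheetDiff R (degIntegrand Z χ))
  eq_deg : ∫ x, sheetDiff R (degIntegrand Z χ) x =
    -(2 * Real.pi ^ 2 * I * (4 / N (1 - Z) * χ (cayleyMap Z)))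

section Linear

theorem _root_.fderiv_sum_const_mul {E ι : Type*} [NormedAddCommGroup E] [NormedSpace ℂ E]
    (S : Finset ι) (c : ι → ℂ) (χ : ι → E → ℂ) {u : E}
    (hχ : ∀ a ∈ S, DifferentiableAt ℂ (χ a) u) :
    DifferentiableAt ℂ (fun P => ∑ a ∈ S, c a * χ a P) u ∧
    ∀ V, fderiv ℂ (fun P => ∑ a ∈ S, c a * χ a P) u V = ∑ a ∈ S, c a * fderiv ℂ (χ a) u V := by
  have h := HasFDerivAt.fun_sum fun a ha => ((hχ a ha).hasFDerivAt.const_mul (c a))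
  refine ⟨h.differentiableAt, fun V => ?_⟩
  rw [HasFDerivAt.fderiv h]
  simp

attribute [local instance] Matrix.normedAddCommGroup Matrix.normedSpace

theorem fderiv_sum_const_mul {ι : Type*} (S : Finset ι) (c : ι → ℂ) (χ : ι → HC → ℂ) {u : HC}
    (hχ : ∀ a ∈ S, DifferentiableAt ℂ (χ a) u) :
    DifferentiableAt ℂ (fun P => ∑ a ∈ S, c a * χ a P) u ∧
    ∀ V, fderiv ℂ (fun P => ∑ a ∈ S, c a * χ a P) u V = ∑ a ∈ S, c a * fderiv ℂ (χ a) u V :=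
  _root_.fderiv_sum_const_mul S c χ hχ

end Linear

theorem Reproduced.sum {ι : Type*} (S : Finset ι) (c : ι → ℂ) {χ : ι → HC → ℂ}
    (h : ∀ a ∈ S, Reproduced R Z (χ a)) : Reproduced R Z (fun P => ∑ a ∈ S, c a * χ a P) := by
  have hd : ∀ u ∈ unitarySet, ∀ a ∈ S, DifferentiableAt ℂ (χ a) u := fun u hu a ha =>
    (h a ha).diff u hu
  have e1 : sheetDiff R (poissonIntegrand R Z (fun P => ∑ a ∈ S, c a * χ a P)) =
      fun x => ∑ a ∈ S, c a * sheetDiff R (poissonIntegrand R Z (χ a)) x := by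
    ext x
    simp only [sheetDiff, poissonIntegrand, liftBd, Finset.mul_sum, Finset.sum_div]
    rw [← Finset.sum_sub_distrib]
    exact Finset.sum_congr rfl fun a _ => by ring
  have e2' : ∀ y, degIntegrand Z (fun P => ∑ a ∈ S, c a * χ a P) y =
      ∑ a ∈ S, c a * degIntegrand Z (χ a) y := by
    intro y
    have hu := cayleyMap_mink_mem y
    obtain ⟨hd1, hd2⟩ := fderiv_sum_const_mul S c χ (hd _ hu)
    rw [degIntegrand, degTilde_liftBd hd1, hd2, Finset.mul_sum, Finset.mul_sum,
      ← Finset.sum_add_distrib, Finset.sum_div]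
    refine Finset.sum_congr rfl fun a ha => ?_
    rw [degIntegrand, degTilde_liftBd (hd _ hu a ha)]
    ring
  have e2 : sheetDiff R (degIntegrand Z (fun P => ∑ a ∈ S, c a * χ a P)) =
      fun x => ∑ a ∈ S, c a * sheetDiff R (degIntegrand Z (χ a)) x := by
    ext x
    simp only [sheetDiff, e2', Finset.sum_div]
    rw [← Finset.sum_sub_distrib]
    exact Finset.sum_congr rfl fun a _ => by ring
  have i1 : ∀ a ∈ S, Integrable fun x => c a * sheetDiff R (poissonIntegrand R Z (χ a)) x :=
    fun a ha => (h a ha).int_poisson.const_mul _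
  have i2 : ∀ a ∈ S, Integrable fun x => c a * sheetDiff R (degIntegrand Z (χ a)) x :=
    fun a ha => (h a ha).int_deg.const_mul _
  refine ⟨fun u hu => (fderiv_sum_const_mul S c χ (hd u hu)).1, ?_, ?_, ?_, ?_⟩
  · rw [e1]; exact integrable_finsetSum S i1
  · rw [e1, integral_finsetSum S i1, Finset.mul_sum, Finset.mul_sum]
    refine Finset.sum_congr rfl fun a ha => ?_
    rw [integral_const_mul, (h a ha).eq_poisson]
    ring
  · rw [e2]; exact integrable_finsetSum S i2
  · rw [e2, integral_finsetSum S i2, Finset.mul_sum, Finset.mul_sum, ← Finset.sum_neg_distrib]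
    refine Finset.sum_congr rfl fun a ha => ?_
    rw [integral_const_mul, (h a ha).eq_deg]
    ring

end Reproduced

section Block

attribute [local instance] Matrix.normedAddCommGroup Matrix.normedSpace

/-- The linear form as a continuous linear map. -/
noncomputable def linFormCLM (s t : ℂ) : HC →L[ℂ] ℂ :=
  LinearMap.toContinuousLinearMap
    { toFun := linForm s t
      map_add' := fun P Q => by simp [linForm]; ring
      map_smul' := fun c P => by simp [linForm]; ring }

theorem hasFDerivAt_linForm (s t : ℂ) (P : HC) : HasFDerivAt (linForm s t) (linFormCLM s t) P :=
  (linFormCLM s t).hasFDerivAt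

theorem fderiv_comp_linForm {g : ℂ → ℂ} {g' : ℂ} {s t : ℂ} {P : HC}
    (hg : HasDerivAt g g' (linForm s t P)) :
    DifferentiableAt ℂ (fun P => g (linForm s t P)) P ∧
    ∀ V, fderiv ℂ (fun P => g (linForm s t P)) P V = g' * linForm s t V := by
  have h : HasFDerivAt (fun P => g (linForm s t P)) (g' • linFormCLM s t) P :=
    HasDerivAt.comp_hasFDerivAt P hg (hasFDerivAt_linForm s t P)
  refine ⟨h.differentiableAt, fun V => ?_⟩
  rw [HasFDerivAt.fderiv h]
  rfl

end Block

theorem hasSum_deriv_geometric {r c : ℂ} (hr : ‖c * r‖ < 1) :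
    HasSum (fun k : ℕ => c ^ k * (k * r ^ (k - 1))) (c * ((1 - c * r) ^ 2)⁻¹) := by
  have h1 := (hasSum_choose_mul_geometric_of_norm_lt_one 1 hr).mul_left c
  -- The term k = 0 vanishes, so the truncated exponent k - 1 there is harmless; the index is
  -- shifted past it.
  rw [← hasSum_nat_add_iff' 1]
  simp only [Finset.sum_range_one, pow_zero, Nat.cast_zero, zero_mul, mul_zero, sub_zero]
  rw [one_div] at h1
  refine h1.congr_fun fun k => ?_
  rw [Nat.choose_one_right, Nat.add_sub_cancel, mul_pow]
  ring

theorem eq_of_hasSum_pow_mul {a b : ℕ → ℂ} {f : ℂ → ℂ}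
    (ha : ∀ᶠ z in 𝓝 0, HasSum (fun k => z ^ k * a k) (f z))
    (hb : ∀ᶠ z in 𝓝 0, HasSum (fun k => z ^ k * b k) (f z)) : a = b := by
  have key : ∀ {c : ℕ → ℂ}, (∀ᶠ z in 𝓝 0, HasSum (fun k => z ^ k * c k) (f z)) →
      HasFPowerSeriesAt f (FormalMultilinearSeries.ofScalars ℂ c) 0 := by
    intro c hc
    rw [hasFPowerSeriesAt_iff]
    simpa [FormalMultilinearSeries.coeff_ofScalars] using hc
  have h := (key ha).eq_formalMultilinearSeries (key hb)
  ext k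
  have h2 := congrArg (fun p => FormalMultilinearSeries.coeff p k) h
  simpa [FormalMultilinearSeries.coeff_ofScalars] using h2

/-- The singularity of the image of the function `1 / (1 - lam q)`. -/
noncomputable def blockPole (s t lam : ℂ) : HC :=
  1 - (2 * I * lam / (1 + I * lam * (1 + s * t))) • !![s * t, t; s, 1]

/-- The matrix (st, t; s, 1) has rank one, so N(1 - W) changes only to first order when a multiple
of it is subtracted. The same first-order term appears in N(1 - W) times the linear form at the
Cayley image, and matching coefficients determines the pole. -/
theorem lift_block {s t lam : ℂ} {W : HC} (hW : N (1 - W) ≠ 0)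
    (hk : 1 + I * lam * (1 + s * t) ≠ 0) :
    4 / N (1 - W) * (1 - lam * linForm s t (cayleyMap W))⁻¹ =
      4 / (1 + I * lam * (1 + s * t)) * (N (W - blockPole s t lam))⁻¹ := by
  have h1 : N (1 - W) * (1 - lam * linForm s t (cayleyMap W)) =
      (1 + I * lam * (1 + s * t)) * N (W - blockPole s t lam) := by
    have e1 : N (1 - W) * linForm s t (cayleyMap W) = I * (2 * (s * t * (1 - W 1 1) + s * W 0 1 +
        t * W 1 0 + (1 - W 0 0)) - N (1 - W) * (1 + s * t)) := by
      rw [cayleyMap, inv_eq_smul]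
      simp [linForm]
      field_simp
      ring
    have e2 : N (W - blockPole s t lam) = N (1 - W) - 2 * I * lam / (1 + I * lam * (1 + s * t)) *
        (s * t * (1 - W 1 1) + s * W 0 1 + t * W 1 0 + (1 - W 0 0)) := by
      rw [blockPole]
      generalize 2 * I * lam / (1 + I * lam * (1 + s * t)) = μ
      simp [N_eq]
      ring
    rw [mul_sub, mul_one, mul_left_comm, e1, e2]
    generalize s * t * (1 - W 1 1) + s * W 0 1 + t * W 1 0 + (1 - W 0 0) = X
    have e3 := mul_div_cancel₀ (2 * I * lam) hk
    linear_combination X * e3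
  rw [← div_eq_mul_inv, ← div_eq_mul_inv, div_div, div_div, h1]

/-- With N(Y) = -R² the right-hand side is k times -- exactly -- the reproducing kernel with A in
place of Z added to the hyperboloid constant: N(A) - N(Y) = R² + N(A). Hence the second formula for
this function is the first with Z and A interchanged. -/
theorem hasDerivAt_inv_N_smul_sub {Y A : HC} (h : N (Y - A) ≠ 0) (k : ℂ) :
    HasDerivAt (fun s : ℂ => s * (k * (N (s • Y - A))⁻¹)) (k * ((N A - N Y) / N (Y - A) ^ 2)) 1 := by
  set b := Y 0 0 * A 1 1 + A 0 0 * Y 1 1 - Y 0 1 * A 1 0 - A 0 1 * Y 1 0 with hb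
  have hN : ∀ s : ℂ, N (s • Y - A) = s ^ 2 * N Y - s * b + N A := by
    intro s
    simp [N_eq, hb]
    ring
  have h1 : N ((1 : ℂ) • Y - A) ≠ 0 := by rwa [one_smul]
  have h1' := hN 1
  rw [one_smul, one_pow, one_mul, one_mul] at h1'
  have h2 : HasDerivAt (fun s : ℂ => N (s • Y - A)) (2 * N Y - b) 1 := by
    simp_rw [hN]
    have h3 : HasDerivAt (fun s : ℂ => s ^ 2 * N Y) (2 * N Y) 1 := by
      simpa using ((hasDerivAt_id (1 : ℂ)).fun_pow 2).mul_const (N Y)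
    have h4 : HasDerivAt (fun s : ℂ => s * b) (1 * b) 1 := (hasDerivAt_id (1 : ℂ)).mul_const b
    exact ((h3.sub h4).add_const (N A)).congr_deriv (by ring)
  have h5 := (hasDerivAt_id (1 : ℂ)).mul ((h2.inv h1).const_mul k)
  refine h5.congr_deriv ?_
  simp only [one_smul, id, Pi.inv_apply]
  have e : b = N Y + N A - N (Y - A) := by rw [h1']; ring
  rw [e]
  field_simp
  ring

section BlockIntegral

variable {R : ℝ} {Z : HC} {s t lam : ℂ}

theorem N_mink_sub_ne_zero {A : HC} (hA : A ∈ Tminus) (y : EuclideanSpace ℝ (Fin 4)) :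
    N (mink y - A) ≠ 0 := by
  obtain ⟨δ, hδ, h⟩ := (mem_Tminus_iff A).1 hA
  have h1 := Accretive.mink_sub (M := -A) (by rwa [neg_neg]) (-y)
  rw [show mink (-y) - -A = -(mink y - A) by rw [mink_neg]; abel] at h1
  rw [← N_neg]
  exact h1.N_ne_zero hδ

theorem liftBd_block (hk : 1 + I * lam * (1 + s * t) ≠ 0) (y : EuclideanSpace ℝ (Fin 4)) :
    liftBd (fun P => (1 - lam * linForm s t P)⁻¹) y =
      4 / (1 + I * lam * (1 + s * t)) * (N (mink y - blockPole s t lam))⁻¹ :=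
  lift_block (N_one_sub_mink_ne_zero y) hk

theorem integral_block (hR : 0 < R) (hZ : Z ∈ Tplus) (hk : 1 + I * lam * (1 + s * t) ≠ 0)
    (hA : blockPole s t lam ∈ Tminus)
    (hd : ∀ u ∈ unitarySet, DifferentiableAt ℂ (fun P => (1 - lam * linForm s t P)⁻¹) u) :
    ∫ x, sheetDiff R (poissonIntegrand R Z fun P => (1 - lam * linForm s t P)⁻¹) x =
      2 * Real.pi ^ 2 * I * (4 / N (1 - Z) * (1 - lam * linForm s t (cayleyMap Z))⁻¹) ∧
    ∫ x, sheetDiff R (degIntegrand Z fun P => (1 - lam * linForm s t P)⁻¹) x =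
      -(2 * Real.pi ^ 2 * I * (4 / N (1 - Z) * (1 - lam * linForm s t (cayleyMap Z))⁻¹)) := by
  obtain ⟨δ, hδ, hZ'⟩ := (mem_Tplus_iff Z).1 hZ
  obtain ⟨δ', hδ', hA'⟩ := (mem_Tminus_iff _).1 hA
  rw [lift_block (N_one_sub_ne_zero_of_mem_Tplus hZ) hk]
  set k := 4 / (1 + I * lam * (1 + s * t)) with hk'
  set A := blockPole s t lam with hA''
  constructor
  · have e : poissonIntegrand R Z (fun P => (1 - lam * linForm s t P)⁻¹) =
        fun y => k * (poissonKernel R Z y / N (mink y - A)) := by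
      ext y
      rw [poissonIntegrand, liftBd_block hk]
      ring
    rw [e, funext (sheetDiff_const_mul R k _), integral_const_mul,
      (integral_poissonKernel_div hR hδ hZ' hδ' hA').2]
    ring
  · have e : ∀ y ∈ hyperboloid R, degIntegrand Z (fun P => (1 - lam * linForm s t P)⁻¹) y =
        k * (poissonKernel R A y / N (mink y - Z)) := by
      intro y hy
      have h1 := degTilde_eq_of_hasDerivAt
        (differentiableAt_liftBd (hd _ (cayleyMap_mink_mem y)))
        (hasDerivAt_inv_N_smul_sub (N_mink_sub_ne_zero hA y) k) fun r => by
          rw [liftBd_block hk, mink_smul]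
      rw [degIntegrand, h1, N_mink_of_mem hy, poissonKernel]
      push_cast
      ring
    rw [sheetDiff_congr e, funext (sheetDiff_const_mul R k _), integral_const_mul,
      integral_poissonKernel_div_swap hR hδ hZ' hδ' hA']
    ring

theorem norm_linForm_le {u : HC} (hu : ∀ i j, ‖u i j‖ ≤ 1) :
    ‖linForm s t u‖ ≤ ‖s * t‖ + ‖s‖ + ‖t‖ + 1 := by
  rw [linForm]
  refine (norm_add_le _ _).trans (add_le_add ((norm_add_le _ _).trans (add_le_add
    ((norm_add_le _ _).trans (add_le_add ?_ ?_)) ?_)) (hu 1 1))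
  · rw [norm_mul]; exact mul_le_of_le_one_right (norm_nonneg _) (hu 0 0)
  · rw [norm_mul]; exact mul_le_of_le_one_right (norm_nonneg _) (hu 0 1)
  · rw [norm_mul]; exact mul_le_of_le_one_right (norm_nonneg _) (hu 1 0)

theorem norm_single_apply_le (i j k l : Fin 2) : ‖(Matrix.single i j (1 : ℂ) : HC) k l‖ ≤ 1 := by
  rw [Matrix.single_apply]
  split_ifs <;> simp

theorem isOpen_Tminus : IsOpen Tminus := by
  have : Tminus = (fun Z : HC => -Z) ⁻¹' Tplus := by
    ext Z
    exact (neg_mem_Tplus_iff Z).symm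
  rw [this]
  exact isOpen_Tplus.preimage continuous_neg

/-- At λ = 0 the pole is the identity matrix, an interior point of the lower tube. -/
theorem eventually_block (s t : ℂ) : ∀ᶠ lam : ℂ in 𝓝 0, 1 + I * lam * (1 + s * t) ≠ 0 ∧
    blockPole s t lam ∈ Tminus := by
  have h1 : ContinuousAt (fun lam : ℂ => 1 + I * lam * (1 + s * t)) 0 := by fun_prop
  have h1' : (fun lam : ℂ => 1 + I * lam * (1 + s * t)) 0 ≠ 0 := by simp
  have h2 : ContinuousAt (fun lam : ℂ => blockPole s t lam) 0 := by
    unfold blockPole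
    refine ContinuousAt.sub continuousAt_const (ContinuousAt.fun_smul ?_ continuousAt_const)
    exact ContinuousAt.div (by fun_prop) h1 h1'
  have h3 : blockPole s t 0 ∈ Tminus := by
    rw [mem_Tminus_iff]
    refine ⟨1, one_pos, ?_⟩
    have : blockPole s t 0 = 1 := by simp [blockPole]
    rw [this]
    exact accretive_one
  exact (h1.eventually_ne h1').and (h2 (isOpen_Tminus.mem_nhds h3))

/-- For small c the geometric series of 1/(1 - cq) is integrated term by term and compared with the
known value of the integral of its sum. Both are power series in c, so their coefficients agree, and
these are the formulas for q^k. -/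
theorem reproduced_linForm_pow (hR : 0 < R) (hZ : Z ∈ Tplus) (s t : ℂ) (k : ℕ) :
    Reproduced R Z (fun P => linForm s t P ^ k) := by
  set K := ‖s * t‖ + ‖s‖ + ‖t‖ + 1 with hK
  have hK1 : 1 ≤ K := by
    rw [hK]
    linarith [norm_nonneg (s * t), norm_nonneg s, norm_nonneg t]
  have hK0 : 0 < K := by linarith
  have hu : ∀ u ∈ unitarySet, ‖linForm s t u‖ ≤ K := fun u h => norm_linForm_le (norm_apply_le_one h)
  have hE : ∀ i j, ‖linForm s t (Matrix.single i j (1 : ℂ))‖ ≤ K := fun i j =>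
    norm_linForm_le (norm_single_apply_le i j)
  have hpow : ∀ (c : ℂ) (k : ℕ) (P : HC),
      DifferentiableAt ℂ (fun P => c ^ k * linForm s t P ^ k) P ∧
      ∀ V, fderiv ℂ (fun P => c ^ k * linForm s t P ^ k) P V =
        c ^ k * (k * linForm s t P ^ (k - 1)) * linForm s t V := fun c k P =>
    fderiv_comp_linForm (g := fun z => c ^ k * z ^ k) ((hasDerivAt_pow k _).const_mul _)
  -- The factor k + 1 is superfluous here but makes the same bound serve for the derivatives.
  have hb0 : ∀ (c : ℂ) (k : ℕ), ∀ u ∈ unitarySet, ‖c ^ k * linForm s t u ^ k‖ ≤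
      (k + 1) * (‖c‖ * K) ^ k := by
    intro c k u h
    rw [norm_mul, norm_pow, norm_pow, ← mul_pow]
    calc (‖c‖ * ‖linForm s t u‖) ^ k ≤ (‖c‖ * K) ^ k := by gcongr; exact hu u h
      _ ≤ _ := le_mul_of_one_le_left (by positivity) (by simp)
  have hb1 : ∀ (c : ℂ) (k : ℕ), ∀ u ∈ unitarySet, ∀ i j,
      ‖fderiv ℂ (fun P => c ^ k * linForm s t P ^ k) u (Matrix.single i j (1 : ℂ))‖ ≤
      (k + 1) * (‖c‖ * K) ^ k := by
    intro c k u h i j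
    rw [(hpow c k u).2, norm_mul, norm_mul, norm_mul, norm_pow, norm_pow, norm_natCast]
    rcases k with _ | k
    · simp
    · rw [Nat.add_sub_cancel]
      calc ‖c‖ ^ (k + 1) * (((k + 1 : ℕ) : ℝ) * ‖linForm s t u‖ ^ k) *
            ‖linForm s t (Matrix.single i j (1 : ℂ))‖
          ≤ ‖c‖ ^ (k + 1) * (((k + 1 : ℕ) : ℝ) * K ^ k) * K := by
            gcongr
            · exact hu u h
            · exact hE i j
        _ = ((k + 1 : ℕ) : ℝ) * (‖c‖ * K) ^ (k + 1) := by push_cast; ring_nf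
        _ ≤ _ := by
            gcongr
            linarith
  have hone : ∀ k : ℕ, (fun P : HC => linForm s t P ^ k) =
      fun P => (1 : ℂ) ^ k * linForm s t P ^ k := fun k => by simp
  have hdk : ∀ (k : ℕ) (P : HC), DifferentiableAt ℂ (fun P => linForm s t P ^ k) P := fun k P => by
    rw [hone]; exact (hpow 1 k P).1
  have hint : ∀ k : ℕ, Integrable (sheetDiff R (poissonIntegrand R Z fun P => linForm s t P ^ k)) ∧
      Integrable (sheetDiff R (degIntegrand Z fun P => linForm s t P ^ k)) := fun k => by
    rw [hone]
    exact integrable_sheetDiff_integrand hR hZ (fun u _ => (hpow 1 k u).1) (hb0 1 k) (hb1 1 k)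
  have hlin1 : ∀ (c : ℂ) (k : ℕ), ∫ x, sheetDiff R
      (poissonIntegrand R Z fun P => c ^ k * linForm s t P ^ k) x =
      c ^ k * ∫ x, sheetDiff R (poissonIntegrand R Z fun P => linForm s t P ^ k) x := by
    intro c k
    rw [← integral_const_mul]
    congr 1
    ext x
    rw [← sheetDiff_const_mul]
    congr 1
    ext y
    simp only [poissonIntegrand, liftBd]
    ring
  have hlin2 : ∀ (c : ℂ) (k : ℕ), ∫ x, sheetDiff R
      (degIntegrand Z fun P => c ^ k * linForm s t P ^ k) x =
      c ^ k * ∫ x, sheetDiff R (degIntegrand Z fun P => linForm s t P ^ k) x := by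
    intro c k
    rw [← integral_const_mul]
    congr 1
    ext x
    rw [← sheetDiff_const_mul]
    congr 1
    ext y
    have h1 := (hpow 1 k (cayleyMap (mink y)))
    rw [← hone] at h1
    rw [degIntegrand, degIntegrand, degTilde_liftBd (hpow c k _).1, degTilde_liftBd (hdk k _),
      (hpow c k _).2, h1.2]
    ring
  have hev : ∀ᶠ c : ℂ in 𝓝 0, (1 + I * c * (1 + s * t) ≠ 0 ∧ blockPole s t c ∈ Tminus) ∧
      ‖c‖ * K < 1 ∧ ‖c * linForm s t (cayleyMap Z)‖ < 1 := by
    refine (eventually_block s t).and (Eventually.and ?_ ?_)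
    · have : ContinuousAt (fun c : ℂ => ‖c‖ * K) 0 := by fun_prop
      exact this.eventually_lt_const (by simp)
    · have : ContinuousAt (fun c : ℂ => ‖c * linForm s t (cayleyMap Z)‖) 0 := by fun_prop
      exact this.eventually_lt_const (by simp)
  have hmain : ∀ᶠ c : ℂ in 𝓝 0,
      HasSum (fun k => c ^ k * ∫ x, sheetDiff R (poissonIntegrand R Z fun P => linForm s t P ^ k) x)
        (2 * Real.pi ^ 2 * I * (4 / N (1 - Z)) * (1 - c * linForm s t (cayleyMap Z))⁻¹) ∧
      HasSum (fun k => c ^ k * ∫ x, sheetDiff R (degIntegrand Z fun P => linForm s t P ^ k) x)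
        (-(2 * Real.pi ^ 2 * I * (4 / N (1 - Z))) * (1 - c * linForm s t (cayleyMap Z))⁻¹) ∧
      HasSum (fun k => (c * linForm s t (cayleyMap Z)) ^ k)
        (1 - c * linForm s t (cayleyMap Z))⁻¹ := by
    filter_upwards [hev] with c hc
    obtain ⟨⟨hk, hA⟩, hcK, hcZ⟩ := hc
    have hlt : ∀ u ∈ unitarySet, ‖c * linForm s t u‖ < 1 := fun u h => by
      rw [norm_mul]
      exact (mul_le_mul_of_nonneg_left (hu u h) (norm_nonneg c)).trans_lt hcK
    have hne : ∀ u ∈ unitarySet, 1 - c * linForm s t u ≠ 0 := fun u h h0 => by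
      have h1 := hlt u h
      rw [← sub_eq_zero.1 h0, norm_one] at h1
      exact lt_irrefl _ h1
    have hfd : ∀ u ∈ unitarySet, DifferentiableAt ℂ (fun P => (1 - c * linForm s t P)⁻¹) u ∧
        ∀ V, fderiv ℂ (fun P => (1 - c * linForm s t P)⁻¹) u V =
          c * ((1 - c * linForm s t u) ^ 2)⁻¹ * linForm s t V := by
      intro u h
      refine fderiv_comp_linForm (g := fun z => (1 - c * z)⁻¹) ?_
      have h1 : HasDerivAt (fun z : ℂ => 1 - c * z) (-(c * 1)) (linForm s t u) :=
        ((hasDerivAt_id _).const_mul c).const_sub 1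
      refine (h1.inv (hne u h)).congr_deriv ?_
      rw [div_eq_mul_inv]
      ring
    have hsum := hasSum_integral_integrand hR hZ (χ := fun P => (1 - c * linForm s t P)⁻¹)
      (χk := fun k P => c ^ k * linForm s t P ^ k) (fun u h => (hfd u h).1)
      (fun k u _ => (hpow c k u).1) (b := fun k => (k + 1) * (‖c‖ * K) ^ k) ?_ (hb0 c) (hb1 c) ?_ ?_
    · obtain ⟨e1, e2⟩ := integral_block hR hZ hk hA fun u h => (hfd u h).1
      rw [e1, e2] at hsum
      simp_rw [hlin1, hlin2] at hsum
      refine ⟨?_, ?_, hasSum_geometric_of_norm_lt_one hcZ⟩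
      · rw [mul_assoc]; exact hsum.1
      · rw [neg_mul, mul_assoc]; exact hsum.2
    · have hn : ‖‖c‖ * K‖ < 1 := by rwa [Real.norm_of_nonneg (by positivity)]
      have h1 := summable_pow_mul_geometric_of_norm_lt_one 1 hn
      have h2 := summable_geometric_of_norm_lt_one hn
      refine (h1.add h2).congr fun k => ?_
      rw [pow_one]; ring
    · intro u h
      simp_rw [← mul_pow]
      exact hasSum_geometric_of_norm_lt_one (hlt u h)
    · intro u h i j
      rw [(hfd u h).2]
      simp_rw [(hpow c _ u).2]
      exact (hasSum_deriv_geometric (hlt u h)).mul_right _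
  refine ⟨fun u _ => hdk k u, (hint k).1, ?_, (hint k).2, ?_⟩
  · have := eq_of_hasSum_pow_mul (hmain.mono fun c hc => hc.1)
      (b := fun k => 2 * Real.pi ^ 2 * I * (4 / N (1 - Z)) * linForm s t (cayleyMap Z) ^ k)
      (hmain.mono fun c hc => by
        refine (hc.2.2.mul_left (2 * Real.pi ^ 2 * I * (4 / N (1 - Z)))).congr_fun ?_
        intro k
        rw [mul_pow]; ring)
    rw [congrFun this k]
    ring
  · have := eq_of_hasSum_pow_mul (hmain.mono fun c hc => hc.2.1)
      (b := fun k => -(2 * Real.pi ^ 2 * I * (4 / N (1 - Z))) * linForm s t (cayleyMap Z) ^ k)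
      (hmain.mono fun c hc => by
        refine (hc.2.2.mul_left (-(2 * Real.pi ^ 2 * I * (4 / N (1 - Z))))).congr_fun ?_
        intro k
        rw [mul_pow]; ring)
    rw [congrFun this k]
    ring

end BlockIntegral

end ComplexQuaternion

/-! ### Symmetry of mixed derivatives, and the Taylor coefficients of solutions of the wave
equation. -/

section SecondDerivative

variable {E : Type*} [NormedAddCommGroup E] [NormedSpace ℂ E] [FiniteDimensional ℂ E]

theorem fderiv_fderiv_comm_of_differentiableOn {U : Set E} (hU : IsOpen U) {f : E → ℂ}
    (hf : DifferentiableOn ℂ f U) {x : E} (hx : x ∈ U) (v w : E) :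
    fderiv ℂ (fun y => fderiv ℂ f y v) x w = fderiv ℂ (fun y => fderiv ℂ f y w) x v := by
  have h1 : ContDiffAt ℂ 2 f x := (contDiffOn_nat_of_differentiableOn hU 2 hf).contDiffAt
    (hU.mem_nhds hx)
  have h2 : IsSymmSndFDerivAt ℂ f x := h1.isSymmSndFDerivAt (by simp)
  have h3 : DifferentiableAt ℂ (fderiv ℂ f) x :=
    (h1.fderiv_right (m := 1) (by norm_num)).differentiableAt one_ne_zero
  have h4 : ∀ v w, fderiv ℂ (fun y => fderiv ℂ f y v) x w = fderiv ℂ (fderiv ℂ f) x w v := by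
    intro v w
    rw [fderiv_clm_apply h3 (differentiableAt_const v)]
    simp
  rw [h4, h4]
  exact h2.eq w v

end SecondDerivative

namespace ComplexQuaternion

/-- Iterated directional derivatives. -/
noncomputable def iterD : List HC → (HC → ℂ) → HC → ℂ
  | [], f => f
  | v :: l, f => iterD l (fun x => fderiv ℂ f x v)

/-- The directions of the matrix units. -/
noncomputable def unitVec (p : Fin 2 × Fin 2) : HC := Matrix.single p.1 p.2 1

/-- The mixed second derivatives that make up the wave operator agree on `U`. -/
def HarmonicOn (f : HC → ℂ) (U : Set HC) : Prop :=
  ∀ x ∈ U, fderiv ℂ (fun y => fderiv ℂ f y (unitVec (0, 0))) x (unitVec (1, 1)) =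
    fderiv ℂ (fun y => fderiv ℂ f y (unitVec (0, 1))) x (unitVec (1, 0))

section IteratedDerivatives

attribute [local instance] Matrix.normedAddCommGroup Matrix.normedSpace

variable {U : Set HC} {f g : HC → ℂ}

theorem differentiableOn_fderiv_HC (hU : IsOpen U) (hf : DifferentiableOn ℂ f U) (v : HC) :
    DifferentiableOn ℂ (fun z => fderiv ℂ f z v) U := differentiableOn_fderiv_apply hU hf v

theorem fderiv_fderiv_comm_HC (hU : IsOpen U) (hf : DifferentiableOn ℂ f U) {x : HC} (hx : x ∈ U)
    (v w : HC) :
    fderiv ℂ (fun y => fderiv ℂ f y v) x w = fderiv ℂ (fun y => fderiv ℂ f y w) x v :=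
  fderiv_fderiv_comm_of_differentiableOn hU hf hx v w

theorem fderiv_congr_HC (hU : IsOpen U) (h : ∀ x ∈ U, f x = g x) {x : HC} (hx : x ∈ U) :
    fderiv ℂ f x = fderiv ℂ g x :=
  Filter.EventuallyEq.fderiv_eq (Filter.eventually_of_mem (hU.mem_nhds hx) h)

theorem iterD_congr (hU : IsOpen U) (l : List HC) (h : ∀ x ∈ U, f x = g x) :
    ∀ x ∈ U, iterD l f x = iterD l g x := by
  induction l generalizing f g with
  | nil => exact h
  | cons v l ih => exact ih fun x hx => by rw [fderiv_congr_HC hU h hx]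

theorem iterD_perm (hU : IsOpen U) {l l' : List HC} (hl : l.Perm l')
    (hf : DifferentiableOn ℂ f U) : ∀ x ∈ U, iterD l f x = iterD l' f x := by
  induction hl generalizing f with
  | nil => exact fun _ _ => rfl
  | cons v _ ih => exact ih (differentiableOn_fderiv_HC hU hf v)
  | swap v w l => exact iterD_congr hU l fun x hx => fderiv_fderiv_comm_HC hU hf hx w v
  | trans _ _ ih1 ih2 => exact fun x hx => (ih1 hf x hx).trans (ih2 hf x hx)

theorem iterD_append_singleton (l : List HC) (v : HC) (f : HC → ℂ) :
    iterD (l ++ [v]) f = fun x => fderiv ℂ (iterD l f) x v := by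
  induction l generalizing f with
  | nil => rfl
  | cons w l ih => exact ih _

theorem iterD_append_singleton_eq_sum (l : List HC) (V : HC) (f : HC → ℂ) (x : HC) :
    iterD (l ++ [V]) f x = ∑ i : Fin 2, ∑ j : Fin 2, V i j * iterD (l ++ [unitVec (i, j)]) f x := by
  simp only [iterD_append_singleton]
  exact map_eq_sum_single _ V

theorem iteratedDeriv_comp_smul (hU : IsOpen U) (h0 : (0 : HC) ∈ U) (P : HC) (k : ℕ)
    (hf : DifferentiableOn ℂ f U) :
    iteratedDeriv k (fun z : ℂ => f (z • P)) 0 = iterD (List.replicate k P) f 0 := by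
  induction k generalizing f with
  | zero => simp [iterD]
  | succ k ih =>
    rw [iteratedDeriv_succ', List.replicate_succ]
    refine Eq.trans ?_ (ih (differentiableOn_fderiv_HC hU hf P))
    refine Filter.EventuallyEq.iteratedDeriv_eq k ?_
    have h1 : ContinuousAt (fun z : ℂ => z • P) 0 := by fun_prop
    have h2 : ∀ᶠ z : ℂ in 𝓝 0, z • P ∈ U := h1 (hU.mem_nhds (by simpa using h0))
    filter_upwards [h2] with z hz
    have h3 : HasDerivAt (fun z : ℂ => z • P) P z := by
      have := (hasDerivAt_id z).smul_const P
      rw [one_smul] at this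
      exact this
    exact (HasFDerivAt.comp_hasDerivAt z
      (hf.differentiableAt (hU.mem_nhds hz)).hasFDerivAt h3).deriv

end IteratedDerivatives

/-! ### Homogeneous solutions of the wave equation as combinations of powers of linear forms. -/

section Counting

theorem count_length (σ : List (Fin 2 × Fin 2)) : σ.length =
    σ.count (0, 0) + σ.count (0, 1) + σ.count (1, 0) + σ.count (1, 1) := by
  induction σ with
  | nil => rfl
  | cons p σ ih =>
    obtain ⟨i, j⟩ := p
    fin_cases i <;> fin_cases j <;> simp [ih] <;> omega

/-- The weight of an index. -/
noncomputable def idxWeight (s t : ℂ) (p : Fin 2 × Fin 2) : ℂ :=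
  (if p.1 = 0 then s else 1) * (if p.2 = 0 then t else 1)

theorem prod_idxWeight (s t : ℂ) (σ : List (Fin 2 × Fin 2)) : (σ.map (idxWeight s t)).prod =
    s ^ (σ.count (0, 0) + σ.count (0, 1)) * t ^ (σ.count (0, 0) + σ.count (1, 0)) := by
  induction σ with
  | nil => simp
  | cons p σ ih =>
    obtain ⟨i, j⟩ := p
    rw [List.map_cons, List.prod_cons, ih]
    fin_cases i <;> fin_cases j <;> simp [idxWeight] <;> ring

theorem linForm_eq_sum (s t : ℂ) (P : HC) :
    linForm s t P = ∑ i : Fin 2, ∑ j : Fin 2, P i j * idxWeight s t (i, j) := by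
  simp [linForm, idxWeight, Fin.sum_univ_two]
  ring

variable {U : Set HC} {f : HC → ℂ}

/-- Each use of the wave equation trades a pair of directions (0,0), (1,1) for (0,1), (1,0); d
counts the trades, which leave the numbers of row and column indices unchanged. -/
theorem iterD_eq_of_count_add (hU : IsOpen U) (hf : DifferentiableOn ℂ f U) (hh : HarmonicOn f U)
    (d : ℕ) (σ σ' : List (Fin 2 × Fin 2)) (h00 : σ.count (0, 0) = σ'.count (0, 0) + d)
    (h11 : σ.count (1, 1) = σ'.count (1, 1) + d) (h01 : σ'.count (0, 1) = σ.count (0, 1) + d)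
    (h10 : σ'.count (1, 0) = σ.count (1, 0) + d) :
    ∀ x ∈ U, iterD (σ.map unitVec) f x = iterD (σ'.map unitVec) f x := by
  induction d generalizing σ with
  | zero =>
    refine iterD_perm hU (List.Perm.map _ (List.perm_iff_count.2 ?_)) hf
    rintro ⟨i, j⟩
    fin_cases i <;> fin_cases j
    · exact h00
    · exact h01.symm
    · exact h10.symm
    · exact h11
  | succ d ih =>
    have m00 : (0, 0) ∈ σ := List.count_pos_iff.1 (by omega)
    have p1 := List.perm_cons_erase m00
    have m11 : (1, 1) ∈ σ.erase (0, 0) := by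
      refine List.count_pos_iff.1 ?_
      rw [List.count_erase_of_ne (by decide)]
      omega
    have p2 : σ.Perm ((0, 0) :: (1, 1) :: (σ.erase (0, 0)).erase (1, 1)) :=
      p1.trans ((List.perm_cons_erase m11).cons _)
    set σ1 := (σ.erase (0, 0)).erase (1, 1) with hσ1
    have hc := fun p => p2.count_eq p
    have c00 := hc (0, 0)
    have c01 := hc (0, 1)
    have c10 := hc (1, 0)
    have c11 := hc (1, 1)
    simp at c00 c01 c10 c11
    intro x hx
    rw [iterD_perm hU (p2.map unitVec) hf x hx]
    refine Eq.trans ?_ (ih ((0, 1) :: (1, 0) :: σ1) ?_ ?_ ?_ ?_ x hx)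
    · exact iterD_congr hU (σ1.map unitVec) hh x hx
    all_goals
      simp
      omega

theorem iterD_eq_of_count (hU : IsOpen U) (hf : DifferentiableOn ℂ f U) (hh : HarmonicOn f U)
    {σ σ' : List (Fin 2 × Fin 2)} (hl : σ.length = σ'.length)
    (hr : σ.count (0, 0) + σ.count (0, 1) = σ'.count (0, 0) + σ'.count (0, 1))
    (hc : σ.count (0, 0) + σ.count (1, 0) = σ'.count (0, 0) + σ'.count (1, 0)) :
    ∀ x ∈ U, iterD (σ.map unitVec) f x = iterD (σ'.map unitVec) f x := by
  rw [count_length, count_length] at hl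
  rcases le_total (σ'.count (0, 0)) (σ.count (0, 0)) with h | h
  · exact iterD_eq_of_count_add hU hf hh (σ.count (0, 0) - σ'.count (0, 0)) σ σ' (by omega)
      (by omega) (by omega) (by omega)
  · exact fun x hx => (iterD_eq_of_count_add hU hf hh (σ'.count (0, 0) - σ.count (0, 0)) σ' σ
      (by omega) (by omega) (by omega) (by omega) x hx).symm

/-- Every array of numbers is the moment array of weights on the grid {0, …, k}²: the two
Vandermonde matrices, one in each variable, are invertible. -/
theorem exists_interpolation (k : ℕ) (m : ℕ → ℕ → ℂ) : ∃ C : Fin (k + 1) → Fin (k + 1) → ℂ,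
    ∀ r c, r ≤ k → c ≤ k → ∑ a, ∑ b, C a b * ((a : ℕ) : ℂ) ^ r * ((b : ℕ) : ℂ) ^ c = m r c := by
  set V := Matrix.vandermonde (fun a : Fin (k + 1) => ((a : ℕ) : ℂ)) with hV
  have hdet : IsUnit V.det := by
    rw [isUnit_iff_ne_zero, hV, Matrix.det_vandermonde_ne_zero_iff]
    intro a b h
    have h' : ((a : ℕ) : ℂ) = ((b : ℕ) : ℂ) := h
    exact Fin.ext (by exact_mod_cast h')
  have hdet' : IsUnit V.transpose.det := by rwa [Matrix.det_transpose]
  set M : Matrix (Fin (k + 1)) (Fin (k + 1)) ℂ := Matrix.of fun r c => m r c with hM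
  refine ⟨V.transpose⁻¹ * M * V⁻¹, fun r c hr hc => ?_⟩
  have h : V.transpose * (V.transpose⁻¹ * M * V⁻¹) * V = M := by
    rw [mul_assoc V.transpose⁻¹, Matrix.mul_nonsing_inv_cancel_left _ _ hdet', mul_assoc,
      Matrix.nonsing_inv_mul _ hdet, mul_one]
  have h1 := congrFun (congrFun h ⟨r, by omega⟩) ⟨c, by omega⟩
  generalize V.transpose⁻¹ * M * V⁻¹ = D at h1
  rw [Matrix.mul_apply] at h1
  simp only [Matrix.mul_apply, Matrix.transpose_apply, hV, Matrix.vandermonde_apply, hM,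
    Matrix.of_apply] at h1
  rw [← h1, Finset.sum_comm]
  refine Finset.sum_congr rfl fun b _ => ?_
  rw [Finset.sum_mul]
  exact Finset.sum_congr rfl fun a _ => by ring

/-- The homogeneous parts of a harmonic function are combinations of powers of linear forms. -/
theorem exists_iterD_replicate_eq_sum (hU : IsOpen U) (hf : DifferentiableOn ℂ f U)
    (hh : HarmonicOn f U) {x : HC} (hx : x ∈ U) (k : ℕ) :
    ∃ C : Fin (k + 1) → Fin (k + 1) → ℂ, ∀ P : HC, iterD (List.replicate k P) f x =
      ∑ a, ∑ b, C a b * linForm ((a : ℕ) : ℂ) ((b : ℕ) : ℂ) P ^ k := by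
  classical
  have hm : ∃ m : ℕ → ℕ → ℂ, ∀ σ : List (Fin 2 × Fin 2), σ.length = k →
      iterD (σ.map unitVec) f x = m (σ.count (0, 0) + σ.count (0, 1))
        (σ.count (0, 0) + σ.count (1, 0)) := by
    -- The derivative along any index list with r zeros among the rows and c among the columns; 0 is
    -- a default for unattainable pairs.
    refine ⟨fun r c => if h : ∃ σ : List (Fin 2 × Fin 2), σ.length = k ∧
      σ.count (0, 0) + σ.count (0, 1) = r ∧ σ.count (0, 0) + σ.count (1, 0) = c then
      iterD (h.choose.map unitVec) f x else 0, fun σ hσ => ?_⟩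
    have h : ∃ σ' : List (Fin 2 × Fin 2), σ'.length = k ∧
      σ'.count (0, 0) + σ'.count (0, 1) = σ.count (0, 0) + σ.count (0, 1) ∧
      σ'.count (0, 0) + σ'.count (1, 0) = σ.count (0, 0) + σ.count (1, 0) := ⟨σ, hσ, rfl, rfl⟩
    beta_reduce
    rw [dif_pos h]
    obtain ⟨h1, h2, h3⟩ := h.choose_spec
    exact iterD_eq_of_count hU hf hh (hσ.trans h1.symm) h2.symm h3.symm x hx
  obtain ⟨m, hm⟩ := hm
  obtain ⟨C, hC⟩ := exists_interpolation k m
  refine ⟨C, fun P => ?_⟩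
  -- Coordinate directions are replaced by P one at a time. Expanding one P in matrix units
  -- reproduces the linear form as the sum of its entries times their weights.
  have key : ∀ j, ∀ σ : List (Fin 2 × Fin 2), σ.length + j = k →
      iterD (List.replicate j P ++ σ.map unitVec) f x = ∑ a, ∑ b, C a b *
        linForm ((a : ℕ) : ℂ) ((b : ℕ) : ℂ) P ^ j *
        (σ.map (idxWeight ((a : ℕ) : ℂ) ((b : ℕ) : ℂ))).prod := by
    intro j
    induction j with
    | zero =>
      intro σ hσ
      have hlen := count_length σ
      rw [List.replicate_zero, List.nil_append, hm σ (by omega), ← hC _ _ (by omega) (by omega)]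
      refine Finset.sum_congr rfl fun a _ => Finset.sum_congr rfl fun b _ => ?_
      rw [prod_idxWeight]
      ring
    | succ j ih =>
      intro σ hσ
      have p1 : (List.replicate (j + 1) P ++ σ.map unitVec).Perm
          ((List.replicate j P ++ σ.map unitVec) ++ [P]) := by
        rw [List.replicate_succ, List.cons_append]
        exact (List.perm_append_singleton _ _).symm
      rw [iterD_perm hU p1 hf x hx, iterD_append_singleton_eq_sum]
      have p2 : ∀ i i' : Fin 2, iterD ((List.replicate j P ++ σ.map unitVec) ++ [unitVec (i, i')])
          f x = ∑ a, ∑ b, C a b * linForm ((a : ℕ) : ℂ) ((b : ℕ) : ℂ) P ^ j *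
          (idxWeight ((a : ℕ) : ℂ) ((b : ℕ) : ℂ) (i, i') *
          (σ.map (idxWeight ((a : ℕ) : ℂ) ((b : ℕ) : ℂ))).prod) := by
        intro i i'
        have p3 : ((List.replicate j P ++ σ.map unitVec) ++ [unitVec (i, i')]).Perm
            (List.replicate j P ++ ((i, i') :: σ).map unitVec) := by
          rw [List.append_assoc, List.map_cons]
          exact (List.perm_append_singleton _ _).append_left _
        rw [iterD_perm hU p3 hf x hx, ih _ (by rw [List.length_cons]; omega)]
        simp only [List.map_cons, List.prod_cons]
      simp_rw [p2, Finset.mul_sum]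
      simp only [Fin.sum_univ_two (f := fun i : Fin 2 => _)]
      simp_rw [← Finset.sum_add_distrib]
      refine Finset.sum_congr rfl fun a _ => Finset.sum_congr rfl fun b _ => ?_
      have e := linForm_eq_sum ((a : ℕ) : ℂ) ((b : ℕ) : ℂ) P
      simp only [Fin.sum_univ_two] at e
      rw [pow_succ]
      linear_combination -(C a b * linForm ((a : ℕ) : ℂ) ((b : ℕ) : ℂ) P ^ j *
        (σ.map (idxWeight ((a : ℕ) : ℂ) ((b : ℕ) : ℂ))).prod) * e
  have := key k [] (by simp)
  simpa using this

end Counting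

end ComplexQuaternion

theorem hasDerivAt_zero_of_sub_eq_smul {E : Type*} [NormedAddCommGroup E] [NormedSpace ℂ E]
    {f g : ℂ → E} (hg : ContinuousAt g 0) (h : ∀ᶠ s in 𝓝 0, f s - f 0 = s • g s) :
    HasDerivAt f (g 0) 0 := by
  rw [hasDerivAt_iff_tendsto_slope_zero]
  refine (hg.tendsto.mono_left nhdsWithin_le_nhds).congr' ?_
  filter_upwards [nhdsWithin_le_nhds h, self_mem_nhdsWithin] with s hs hs0
  have hs0' : s ≠ 0 := hs0
  rw [zero_add, hs, smul_smul, inv_mul_cancel₀ hs0', one_smul]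

namespace ComplexQuaternion

/-! ### The Cayley transform preserves solutions of the wave equation. -/

section Covariance

attribute [local instance] Matrix.normedAddCommGroup Matrix.normedSpace

/-- In the directions of the matrix units the wave operator is 4(∂₀₀∂₁₁ - ∂₀₁∂₁₀). -/
theorem harmonicOn_of_box {U : Set HC} (hU : IsOpen U) {φ : HC → ℂ} (hφ : DifferentiableOn ℂ φ U)
    (hb : ∀ Z ∈ U, box φ Z = 0) : HarmonicOn φ U := by
  intro Z hZ
  have hB : ∀ V : HC, fderiv ℂ (fun W => fderiv ℂ φ W V) Z V =
      ∑ i : Fin 2, ∑ j : Fin 2, V i j * ∑ k : Fin 2, ∑ l : Fin 2, V k l *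
        fderiv ℂ (fun W => fderiv ℂ φ W (unitVec (k, l))) Z (unitVec (i, j)) := by
    intro V
    refine (map_eq_sum_single _ V).trans ?_
    refine Finset.sum_congr rfl fun i _ => Finset.sum_congr rfl fun j _ => ?_
    congr 1
    refine (fderiv_fderiv_comm_HC hU hφ hZ V (unitVec (i, j))).trans ?_
    refine (map_eq_sum_single _ V).trans ?_
    refine Finset.sum_congr rfl fun k _ => Finset.sum_congr rfl fun l _ => ?_
    congr 1
    exact fderiv_fderiv_comm_HC hU hφ hZ _ _
  have h := hb Z hZ
  have s1 := fderiv_fderiv_comm_HC hU hφ hZ (unitVec (0, 0)) (unitVec (1, 1))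
  have s2 := fderiv_fderiv_comm_HC hU hφ hZ (unitVec (0, 1)) (unitVec (1, 0))
  simp only [box, hB] at h
  obtain ⟨B, hB'⟩ : ∃ B : Fin 2 × Fin 2 → Fin 2 × Fin 2 → ℂ, ∀ p q,
    fderiv ℂ (fun W => fderiv ℂ φ W (unitVec p)) Z (unitVec q) = B p q := ⟨_, fun _ _ => rfl⟩
  simp only [hB'] at h s1 s2 ⊢
  simp [Fin.sum_univ_four, e, ← s1, ← s2] at h
  ring_nf at h
  simp only [I_sq] at h
  linear_combination h / 4

/-- The resolvent identity exhibits the difference quotient as a function continuous at s = 0. -/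
theorem hasDerivAt_inv_line {Q : HC} (hQ : N Q ≠ 0) (E : HC) :
    HasDerivAt (fun s : ℂ => (Q + s • E)⁻¹) (-(Q⁻¹ * E * Q⁻¹)) 0 := by
  have hline : ContinuousAt (fun s : ℂ => Q + s • E) 0 := by fun_prop
  have hQ0 : N (Q + (0 : ℂ) • E) ≠ 0 := by rwa [zero_smul, add_zero]
  have hc : ContinuousAt (fun s : ℂ => (Q + s • E)⁻¹) 0 :=
    ContinuousAt.comp (f := fun s : ℂ => Q + s • E) (g := fun M : HC => M⁻¹)
      (differentiableAt_inv hQ0).continuousAt hline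
  have hne : ∀ᶠ s : ℂ in 𝓝 0, N (Q + s • E) ≠ 0 :=
    (ContinuousAt.comp (f := fun s : ℂ => Q + s • E) (g := N)
      (differentiableAt_N _).continuousAt hline).eventually_ne hQ0
  have h2 : ContinuousAt (fun s : ℂ => -((Q + s • E)⁻¹ * E * Q⁻¹)) 0 :=
    ((hc.mul continuousAt_const).mul continuousAt_const).neg
  have h3 : ∀ᶠ s : ℂ in 𝓝 0, (Q + s • E)⁻¹ - (Q + (0 : ℂ) • E)⁻¹ =
      s • -((Q + s • E)⁻¹ * E * Q⁻¹) := by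
    filter_upwards [hne] with s hs
    have h4 : (Q + s • E)⁻¹ * (Q + s • E) * Q⁻¹ = Q⁻¹ := by
      rw [(mul_inv_of_N_ne_zero hs).2, one_mul]
    rw [mul_add, add_mul, mul_assoc _ Q, (mul_inv_of_N_ne_zero hQ).1, mul_one] at h4
    rw [zero_smul, add_zero, sub_eq_iff_eq_add]
    nth_rewrite 2 [← h4]
    rw [mul_smul_comm, smul_mul_assoc, smul_neg]
    abel
  refine HasDerivAt.congr_deriv (hasDerivAt_zero_of_sub_eq_smul h2 h3) ?_
  rw [zero_smul, add_zero]

/-- The inverse of the denominator of the Cayley transform. -/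
noncomputable def cayleyInv (P : HC) : HC := (I • P - 1)⁻¹

variable {P : HC}

theorem mul_unitVec_mul (X Y : HC) (p : Fin 2 × Fin 2) (i j : Fin 2) :
    (X * unitVec p * Y) i j = X i p.1 * Y p.2 j := by
  simp [unitVec, Matrix.mul_apply, Matrix.single_apply, Finset.sum_ite_eq, ite_and]

theorem hasDerivAt_cayleyInv_line (hP : P ∈ Dplus) (p : Fin 2 × Fin 2) :
    HasDerivAt (fun s : ℂ => cayleyInv (P + s • unitVec p))
      (-(cayleyInv P * (I • unitVec p) * cayleyInv P)) 0 := by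
  have h := hasDerivAt_inv_line (N_ne_zero_of_mem_Dplus hP) (I • unitVec p)
  have e : (fun s : ℂ => cayleyInv (P + s • unitVec p)) =
      fun s : ℂ => (I • P - 1 + s • (I • unitVec p))⁻¹ := by
    ext1 s
    rw [cayleyInv]
    congr 1
    module
  rw [e]
  exact h

theorem hasDerivAt_cayleyInv_apply_line (hP : P ∈ Dplus) (p : Fin 2 × Fin 2) (i j : Fin 2) :
    HasDerivAt (fun s : ℂ => cayleyInv (P + s • unitVec p) i j)
      (-I * (cayleyInv P i p.1 * cayleyInv P p.2 j)) 0 := by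
  have h := hasDerivAt_pi.1 (hasDerivAt_pi.1 (hasDerivAt_cayleyInv_line hP p) i) j
  refine h.congr_deriv ?_
  rw [Matrix.neg_apply, mul_smul_comm, smul_mul_assoc, Matrix.smul_apply, mul_unitVec_mul,
    smul_eq_mul, neg_mul]

theorem hasDerivAt_comp_tubeMap_line (hP : P ∈ Dplus) (p : Fin 2 × Fin 2) {F : HC → ℂ}
    (hF : DifferentiableOn ℂ F Tplus) :
    HasDerivAt (fun s : ℂ => F (tubeMap (P + s • unitVec p)))
      (-2 * I * ∑ k : Fin 2, ∑ l : Fin 2, cayleyInv P k p.1 * cayleyInv P p.2 l *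
        fderiv ℂ F (tubeMap P) (unitVec (k, l))) 0 := by
  have h1 : HasDerivAt (fun s : ℂ => tubeMap (P + s • unitVec p))
      ((2 : ℂ) • -(cayleyInv P * (I • unitVec p) * cayleyInv P)) 0 :=
    ((hasDerivAt_cayleyInv_line hP p).const_smul (2 : ℂ)).const_add 1
  have h2 : HasFDerivAt F (fderiv ℂ F (tubeMap P)) (tubeMap (P + (0 : ℂ) • unitVec p)) := by
    rw [zero_smul, add_zero]
    exact (hF.differentiableAt (isOpen_Tplus.mem_nhds (tubeMap_mem_Tplus hP))).hasFDerivAt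
  refine (HasFDerivAt.comp_hasDerivAt (0 : ℂ) h2 h1).congr_deriv ?_
  refine (map_eq_sum_single _ _).trans ?_
  rw [Finset.mul_sum]
  refine Finset.sum_congr rfl fun k _ => ?_
  rw [Finset.mul_sum]
  refine Finset.sum_congr rfl fun l _ => ?_
  have e : ((2 : ℂ) • -(cayleyInv P * (I • unitVec p) * cayleyInv P)) k l =
      -2 * I * (cayleyInv P k p.1 * cayleyInv P p.2 l) := by
    rw [Matrix.smul_apply, Matrix.neg_apply, Matrix.mul_smul, Matrix.smul_mul, Matrix.smul_apply,
      mul_unitVec_mul, smul_eq_mul, smul_eq_mul]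
    ring
  rw [e, unitVec, mul_assoc]

theorem fderiv_eq_of_hasDerivAt_line {g : HC → ℂ} {P E : HC} {d : ℂ}
    (hg : DifferentiableAt ℂ g P) (h : HasDerivAt (fun s : ℂ => g (P + s • E)) d 0) :
    fderiv ℂ g P E = d := by
  have h1 : HasDerivAt (fun s : ℂ => P + s • E) E 0 := by
    have := ((hasDerivAt_id (0 : ℂ)).smul_const E).const_add P
    rw [one_smul] at this
    exact this
  have h2 : HasFDerivAt g (fderiv ℂ g P) (P + (0 : ℂ) • E) := by
    rw [zero_smul, add_zero]; exact hg.hasFDerivAt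
  exact (HasFDerivAt.comp_hasDerivAt (0 : ℂ) h2 h1).unique h

theorem eventually_line_mem (hP : P ∈ Dplus) (E : HC) : ∀ᶠ s : ℂ in 𝓝 0, P + s • E ∈ Dplus := by
  have h1 : ContinuousAt (fun s : ℂ => P + s • E) 0 := by fun_prop
  exact h1 (isOpen_Dplus.mem_nhds (by simpa using hP))

theorem cayley_eq (φ : HC → ℂ) (hP : P ∈ Dplus) :
    cayley φ P = N (cayleyInv P) * φ (tubeMap P) := by
  rw [cayley_apply (N_ne_zero_of_mem_Dplus hP), cayleyInv, N_inv]

/-- The partial derivatives of the Cayley transform of a function. -/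
theorem fderiv_cayley {φ : HC → ℂ} (hφ : DifferentiableOn ℂ φ Tplus) (hP : P ∈ Dplus)
    (p : Fin 2 × Fin 2) :
    fderiv ℂ (cayley φ) P (unitVec p) = -I * (N (cayleyInv P) * (cayleyInv P p.2 p.1 *
      φ (tubeMap P) + 2 * ∑ k : Fin 2, ∑ l : Fin 2, cayleyInv P k p.1 * cayleyInv P p.2 l *
        fderiv ℂ φ (tubeMap P) (unitVec (k, l)))) := by
  refine fderiv_eq_of_hasDerivAt_line
    ((differentiableOn_cayley hφ).differentiableAt (isOpen_Dplus.mem_nhds hP)) ?_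
  have hX := hasDerivAt_cayleyInv_apply_line hP p
  have hF := hasDerivAt_comp_tubeMap_line hP p hφ
  have h := (((hX 0 0).mul (hX 1 1)).sub ((hX 0 1).mul (hX 1 0))).mul hF
  refine (h.congr_of_eventuallyEq ?_).congr_deriv ?_
  · filter_upwards [eventually_line_mem hP (unitVec p)] with s hs
    rw [cayley_eq φ hs, N_eq]
    rfl
  · simp only [zero_smul, add_zero, N_eq, Pi.mul_apply, Pi.sub_apply]
    obtain ⟨i, j⟩ := p
    fin_cases i <;> fin_cases j <;> simp <;> ring

theorem fderiv_fderiv_cayley {φ : HC → ℂ} (hφ : DifferentiableOn ℂ φ Tplus) (hP : P ∈ Dplus)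
    (p q : Fin 2 × Fin 2) :
    HasDerivAt (fun s : ℂ => -I * (N (cayleyInv (P + s • unitVec q)) *
      (cayleyInv (P + s • unitVec q) p.2 p.1 * φ (tubeMap (P + s • unitVec q)) +
        2 * ∑ k : Fin 2, ∑ l : Fin 2, cayleyInv (P + s • unitVec q) k p.1 *
        cayleyInv (P + s • unitVec q) p.2 l *
        fderiv ℂ φ (tubeMap (P + s • unitVec q)) (unitVec (k, l)))))
      (fderiv ℂ (fun y => fderiv ℂ (cayley φ) y (unitVec p)) P (unitVec q)) 0 := by
  have h0 := differentiableOn_cayley hφ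
  have h1 := (differentiableOn_fderiv_HC isOpen_Dplus h0 (unitVec p)).differentiableAt
    (isOpen_Dplus.mem_nhds hP)
  have h2 : HasDerivAt (fun s : ℂ => P + s • unitVec q) (unitVec q) 0 := by
    have := ((hasDerivAt_id (0 : ℂ)).smul_const (unitVec q)).const_add P
    rw [one_smul] at this
    exact this
  have h3 : HasFDerivAt (fun y => fderiv ℂ (cayley φ) y (unitVec p))
      (fderiv ℂ (fun y => fderiv ℂ (cayley φ) y (unitVec p)) P) (P + (0 : ℂ) • unitVec q) := by
    rw [zero_smul, add_zero]; exact h1.hasFDerivAt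
  refine (HasFDerivAt.comp_hasDerivAt (0 : ℂ) h3 h2).congr_of_eventuallyEq ?_
  filter_upwards [eventually_line_mem hP (unitVec q)] with s hs
  exact (fderiv_cayley hφ hs p).symm

/-- The Cayley transform respects the wave equation. -/
theorem harmonicOn_cayley {φ : HC → ℂ} (hφ : DifferentiableOn ℂ φ Tplus)
    (hh : HarmonicOn φ Tplus) : HarmonicOn (cayley φ) Dplus := by
  intro P hP
  have hT := tubeMap_mem_Tplus hP
  have key : ∀ p q : Fin 2 × Fin 2, HasDerivAt (fun s : ℂ => -I * (N (cayleyInv (P + s • unitVec q)) *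
      (cayleyInv (P + s • unitVec q) p.2 p.1 * φ (tubeMap (P + s • unitVec q)) +
        2 * ∑ k : Fin 2, ∑ l : Fin 2, cayleyInv (P + s • unitVec q) k p.1 *
        cayleyInv (P + s • unitVec q) p.2 l *
        fderiv ℂ φ (tubeMap (P + s • unitVec q)) (unitVec (k, l))))) _ 0 := fun p q => by
    have hX := hasDerivAt_cayleyInv_apply_line hP q
    have hF := fun F hF => hasDerivAt_comp_tubeMap_line hP q (F := F) hF
    have hF1 := fun k l => hF _ (differentiableOn_fderiv_HC isOpen_Tplus hφ (unitVec (k, l)))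
    simp_rw [N_eq]
    exact ((((hX 0 0).fun_mul (hX 1 1)).fun_sub ((hX 0 1).fun_mul (hX 1 0))).fun_mul
      (((hX p.2 p.1).fun_mul (hF _ hφ)).fun_add ((HasDerivAt.fun_sum fun k _ =>
        HasDerivAt.fun_sum fun l _ => ((hX k p.1).fun_mul (hX p.2 l)).fun_mul (hF1 k l)).const_mul
          2))).const_mul (-I)
  rw [(fderiv_fderiv_cayley hφ hP (0, 0) (1, 1)).unique (key _ _),
    (fderiv_fderiv_cayley hφ hP (0, 1) (1, 0)).unique (key _ _)]
  simp only [Fin.sum_univ_two, zero_smul, add_zero]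
  -- Once the second derivatives of φ are symmetrized and related by the wave equation, the two
  -- mixed derivatives agree as polynomials in the entries of `cayleyInv P` and the derivatives of
  -- φ.
  have sy := fun p q => fderiv_fderiv_comm_HC isOpen_Tplus hφ hT (unitVec p) (unitVec q)
  have h0 := hh _ hT
  rw [← sy (0, 0) (0, 1), ← sy (0, 0) (1, 0), ← sy (0, 0) (1, 1), ← sy (0, 1) (1, 0),
    ← sy (0, 1) (1, 1), ← sy (1, 0) (1, 1), h0]
  ring

end Covariance

end ComplexQuaternion

/-! ### Geometric convergence of the expansion into homogeneous parts, with first derivatives. -/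

section HomogeneousExpansion

variable {E : Type*} [NormedAddCommGroup E] [NormedSpace ℂ E] [FiniteDimensional ℂ E]

/-- Uniform estimates for the expansion into homogeneous parts near a compact set. -/
theorem exists_homogeneous_expansion {K W : Set E} (hK : IsCompact K) (hW : IsOpen W)
    (hKW : ∀ u ∈ K, ∀ z : ℂ, ‖z‖ ≤ 1 → z • u ∈ W) {χ : E → ℂ} (hχ : DifferentiableOn ℂ χ W)
    {p : ℕ → E → ℂ} (hp : ∀ k, Differentiable ℂ (p k))
    (hpχ : ∀ k P, p k P = ((k.factorial : ℂ))⁻¹ * iteratedDeriv k (fun z : ℂ => χ (z • P)) 0) :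
    ∃ b : ℕ → ℝ, Summable b ∧ (∀ k, ∀ u ∈ K, ‖p k u‖ ≤ b k) ∧
      (∀ k, ∀ u ∈ K, ‖fderiv ℂ (p k) u‖ ≤ b k) ∧
      (∀ u ∈ K, HasSum (fun k => p k u) (χ u)) ∧
      ∀ u ∈ K, HasSum (fun k => fderiv ℂ (p k) u) (fderiv ℂ χ u) := by
  have : ProperSpace E := FiniteDimensional.proper ℂ E
  -- The union of the closed discs over K is compact in W, hence has a thickening of radius η in W.
  set K1 : Set E := (fun q : ℂ × E => q.1 • q.2) '' (Metric.closedBall 0 1 ×ˢ K) with hK1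
  have hK1c : IsCompact K1 := ((isCompact_closedBall 0 1).prod hK).image continuous_smul
  have hK1W : K1 ⊆ W := by
    rintro _ ⟨⟨z, u⟩, ⟨hz, hu⟩, rfl⟩
    exact hKW u hu z (mem_closedBall_zero_iff.1 hz)
  obtain ⟨η, hη, hηW⟩ := hK1c.exists_cthickening_subset_open hW hK1W
  obtain ⟨B, hB⟩ := hK.exists_bound_of_continuousOn (f := fun u : E => u) continuousOn_id
  obtain ⟨M, hM⟩ := (hK1c.cthickening (r := η)).exists_bound_of_continuousOn
    (hχ.continuousOn.mono hηW)
  set B' := |B| + 1 with hB'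
  have hB0 : 0 < B' := by positivity
  set ε := min (η / 3) 1 with hε
  have hε0 : 0 < ε := by positivity
  -- The excess of ρ over 1 is chosen so that discs of radius ρ through points within ε of K stay in
  -- the thickening. Cauchy's estimate then gives the rate ρ⁻¹ < 1 on a neighborhood of K.
  set ρ := 1 + η / (3 * B') with hρ
  have hρ1 : 1 < ρ := by rw [hρ]; linarith [show 0 < η / (3 * B') by positivity]
  have hρ0 : 0 < ρ := by linarith
  have hmem : ∀ u ∈ K, ∀ P ∈ Metric.closedBall u ε, ∀ z ∈ Metric.closedBall (0 : ℂ) ρ,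
      z • P ∈ Metric.cthickening η K1 := by
    intro u hu P hP z hz
    rw [mem_closedBall_zero_iff] at hz
    rw [mem_closedBall_iff_norm] at hP
    have hz' : ‖z / (ρ : ℂ)‖ ≤ 1 := by
      rw [norm_div, norm_real, Real.norm_of_nonneg hρ0.le, div_le_one hρ0]
      exact hz
    refine Metric.mem_cthickening_of_dist_le _ ((z / (ρ : ℂ)) • u) _ _
      ⟨(z / (ρ : ℂ), u), ⟨mem_closedBall_zero_iff.2 hz', hu⟩, rfl⟩ ?_
    have hρc : (ρ : ℂ) ≠ 0 := ofReal_ne_zero.2 hρ0.ne'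
    have e1 : z • P - (z / (ρ : ℂ)) • u =
        (z / (ρ : ℂ)) • (((ρ - 1 : ℝ) : ℂ) • P + (P - u)) := by
      have : z • P = (z / (ρ : ℂ)) • ((ρ : ℂ) • P) := by
        rw [smul_smul, div_mul_cancel₀ _ hρc]
      rw [this, ← smul_sub]
      congr 1
      push_cast
      module
    have hPn : ‖P‖ ≤ B' := by
      have h1 := norm_le_norm_add_norm_sub' P u
      have h2 := hB u hu
      have h3 : ε ≤ 1 := min_le_right _ _
      have h4 := le_abs_self B
      rw [hB']
      linarith
    have h5 : (ρ - 1) * B' = η / 3 := by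
      rw [hρ]
      field_simp
      ring
    have h6 : ε ≤ η / 3 := min_le_left _ _
    rw [dist_eq_norm, e1, norm_smul]
    refine (mul_le_of_le_one_left (norm_nonneg _) hz').trans ?_
    refine (norm_add_le _ _).trans ?_
    rw [norm_smul, norm_real, Real.norm_of_nonneg (by linarith)]
    have h7 := mul_le_mul_of_nonneg_left hPn (show 0 ≤ ρ - 1 by linarith)
    linarith
  have hline : ∀ P : E, Continuous fun z : ℂ => z • P := fun P => by fun_prop
  have hdisc : ∀ u ∈ K, ∀ P ∈ Metric.closedBall u ε, ∀ z ∈ Metric.closedBall (0 : ℂ) ρ,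
      DifferentiableAt ℂ (fun z : ℂ => χ (z • P)) z := by
    intro u hu P hP z hz
    have h1 : DifferentiableAt ℂ χ (z • P) :=
      hχ.differentiableAt (hW.mem_nhds (hηW (hmem u hu P hP z hz)))
    exact DifferentiableAt.comp z h1 (differentiableAt_id.smul_const P)
  have hbound : ∀ u ∈ K, ∀ P ∈ Metric.closedBall u ε, ∀ k, ‖p k P‖ ≤ M * (ρ⁻¹) ^ k := by
    intro u hu P hP k
    have hd := hdisc u hu P hP
    have h1 := norm_iteratedDeriv_le_of_forall_mem_sphere_norm_le (c := 0) (R := ρ) (C := M)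
      (f := fun z : ℂ => χ (z • P)) k hρ0
      ⟨fun z hz => (hd z (Metric.ball_subset_closedBall hz)).differentiableWithinAt, fun z hz => by
        rw [closure_ball _ hρ0.ne'] at hz
        exact (hd z hz).continuousAt.continuousWithinAt⟩
      (fun z hz => hM _ (hmem u hu P hP z (Metric.sphere_subset_closedBall hz)))
    rw [hpχ, norm_mul, norm_inv, norm_natCast]
    have hk : (0 : ℝ) < k.factorial := by exact_mod_cast k.factorial_pos
    rw [inv_mul_le_iff₀ hk]
    refine h1.trans (le_of_eq ?_)
    rw [inv_pow]
    ring
  have hsum : ∀ u ∈ K, ∀ P ∈ Metric.closedBall u ε, HasSum (fun k => p k P) (χ P) := by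
    intro u hu P hP
    have h1 := Complex.hasSum_taylorSeries_on_ball (c := 0) (r := ρ)
      (f := fun z : ℂ => χ (z • P)) (z := 1)
      (fun z hz => (hdisc u hu P hP z (Metric.ball_subset_closedBall hz)).differentiableWithinAt)
      (by rw [mem_ball_zero_iff, norm_one]; exact hρ1)
    simp only [one_smul, sub_zero, one_pow, smul_eq_mul, one_mul] at h1
    simp_rw [hpχ]
    exact h1
  -- Halving the radius leaves room for a second Cauchy estimate, which bounds the derivatives at
  -- the same rate.
  have hderiv : ∀ u ∈ K, ∀ P ∈ Metric.ball u (ε / 2), ∀ k,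
      ‖fderiv ℂ (p k) P‖ ≤ M * (ρ⁻¹) ^ k / (ε / 2) := by
    intro u hu P hP k
    refine norm_fderiv_le_of_forall_ball isOpen_univ (hp k).differentiableOn (half_pos hε0)
      (Set.subset_univ _) fun w hw => hbound u hu w ?_ k
    refine Metric.closedBall_subset_closedBall' ?_ hw
    have := Metric.mem_ball.1 hP
    linarith
  have hM0 : K.Nonempty → 0 ≤ M := fun ⟨u, hu⟩ =>
    (norm_nonneg _).trans (hM _ (hmem u hu u (Metric.mem_closedBall_self hε0.le) 0
      (Metric.mem_closedBall_self hρ0.le)))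
  have hgeo : Summable fun k : ℕ => M * (ρ⁻¹) ^ k :=
    (summable_geometric_of_lt_one (by positivity) (inv_lt_one_of_one_lt₀ hρ1)).mul_left M
  refine ⟨fun k => M * (ρ⁻¹) ^ k + M * (ρ⁻¹) ^ k / (ε / 2), hgeo.add (hgeo.div_const _), ?_, ?_, ?_,
    ?_⟩
  · intro k u hu
    have := hM0 ⟨u, hu⟩
    exact (hbound u hu u (Metric.mem_closedBall_self hε0.le) k).trans
      (le_add_of_nonneg_right (by positivity))
  · intro k u hu
    have := hM0 ⟨u, hu⟩
    exact (hderiv u hu u (Metric.mem_ball_self (half_pos hε0)) k).trans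
      (le_add_of_nonneg_left (by positivity))
  · exact fun u hu => hsum u hu u (Metric.mem_closedBall_self hε0.le)
  · intro u hu
    have hu0 := Metric.mem_ball_self (x := u) (half_pos hε0)
    have hsub : Metric.ball u (ε / 2) ⊆ Metric.closedBall u ε :=
      (Metric.ball_subset_closedBall).trans (Metric.closedBall_subset_closedBall (by linarith))
    have hs := hgeo.div_const (ε / 2)
    have h1 := hasFDerivAt_tsum_of_isPreconnected hs Metric.isOpen_ball
      (convex_ball u (ε / 2)).isPreconnected (f := p) (f' := fun k P => fderiv ℂ (p k) P)
      (fun k P _ => (hp k P).hasFDerivAt) (fun k P hP => hderiv u hu P hP k) hu0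
      (hsum u hu u (hsub hu0)).summable hu0
    have h2 : χ =ᶠ[𝓝 u] fun P => ∑' k, p k P := by
      filter_upwards [Metric.isOpen_ball.mem_nhds hu0] with P hP
      exact (hsum u hu P (hsub hP)).tsum_eq.symm
    rw [(h1.congr_of_eventuallyEq h2).fderiv]
    exact (Summable.of_norm_bounded hs fun k => hderiv u hu u hu0 k).hasSum

end HomogeneousExpansion

/-! ### The reproducing formulas for harmonic functions near the unitary group. -/

namespace ComplexQuaternion

open scoped ComplexOrder

theorem smul_mem_Dplus_of_norm_le_one {P : HC} (hP : P ∈ Dplus) {z : ℂ} (hz : ‖z‖ ≤ 1) :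
    z • P ∈ Dplus := by
  have hP' : (1 - P * P.conjTranspose).PosDef := hP
  change (1 - (z • P) * (z • P).conjTranspose).PosDef
  rw [Matrix.conjTranspose_smul, smul_mul_smul_comm, RCLike.star_def, mul_conj']
  have h1 : (0 : ℂ) ≤ 1 - (‖z‖ : ℂ) ^ 2 := by
    rw [show (1 : ℂ) - (‖z‖ : ℂ) ^ 2 = ((1 - ‖z‖ ^ 2 : ℝ) : ℂ) by push_cast; ring, ← ofReal_zero,
      real_le_real]
    nlinarith [norm_nonneg z]
  have h2 := hP'.add_posSemidef ((Matrix.posSemidef_self_mul_conjTranspose P).smul h1)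
  rw [sub_smul, one_smul] at h2
  rwa [sub_add_sub_cancel] at h2

theorem zero_mem_Dplus : (0 : HC) ∈ Dplus := by
  change (1 - (0 : HC) * (0 : HC).conjTranspose).PosDef
  rw [zero_mul, sub_zero]
  exact Matrix.PosDef.one

section ClassG

attribute [local instance] Matrix.normedAddCommGroup Matrix.normedSpace

theorem exists_homogeneous_expansion_HC {K W : Set HC} (hK : IsCompact K) (hW : IsOpen W)
    (hKW : ∀ u ∈ K, ∀ z : ℂ, ‖z‖ ≤ 1 → z • u ∈ W) {χ : HC → ℂ} (hχ : DifferentiableOn ℂ χ W)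
    {p : ℕ → HC → ℂ} (hp : ∀ k, Differentiable ℂ (p k))
    (hpχ : ∀ k P, p k P = ((k.factorial : ℂ))⁻¹ * iteratedDeriv k (fun z : ℂ => χ (z • P)) 0) :
    ∃ b : ℕ → ℝ, Summable b ∧ (∀ k, ∀ u ∈ K, ‖p k u‖ ≤ b k) ∧
      (∀ k, ∀ u ∈ K, ∀ i j, ‖fderiv ℂ (p k) u (Matrix.single i j (1 : ℂ))‖ ≤ b k) ∧
      (∀ u ∈ K, HasSum (fun k => p k u) (χ u)) ∧
      ∀ u ∈ K, ∀ i j, HasSum (fun k => fderiv ℂ (p k) u (Matrix.single i j (1 : ℂ)))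
        (fderiv ℂ χ u (Matrix.single i j (1 : ℂ))) := by
  obtain ⟨b, hb, h0, h1, h2, h3⟩ := exists_homogeneous_expansion hK hW hKW hχ hp hpχ
  refine ⟨b, hb, h0, fun k u hu i j => ?_, h2, fun u hu i j => ?_⟩
  · have hn : ‖(Matrix.single i j (1 : ℂ) : HC)‖ ≤ 1 := by
      rw [Matrix.norm_le_iff zero_le_one]
      exact norm_single_apply_le i j
    have h4 := ContinuousLinearMap.le_of_opNorm_le_of_le _ (h1 k u hu) hn
    rw [mul_one] at h4
    exact h4
  · exact (h3 u hu).mapL (ContinuousLinearMap.apply ℂ ℂ (Matrix.single i j (1 : ℂ) : HC))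

theorem isCompact_singleton_HC (P : HC) : IsCompact {P} := isCompact_singleton

/-- The reproducing formulas hold for harmonic functions that are holomorphic near the closed disc
over the unitary group. -/
theorem reproduced_of_harmonicOn {R : ℝ} (hR : 0 < R) {Z : HC} (hZ : Z ∈ Tplus) {W : Set HC}
    (hW : IsOpen W) (hDW : Dplus ⊆ W) (hUW : unitarySet ⊆ W) {χ : HC → ℂ}
    (hχ : DifferentiableOn ℂ χ W) (hh : HarmonicOn χ Dplus) :
    Reproduced R Z χ ∧ ∃ b : ℝ, (∀ u ∈ unitarySet, ‖χ u‖ ≤ b) ∧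
      ∀ u ∈ unitarySet, ∀ i j, ‖fderiv ℂ χ u (Matrix.single i j (1 : ℂ))‖ ≤ b := by
  have hχD : DifferentiableOn ℂ χ Dplus := hχ.mono hDW
  choose C hC using fun k =>
    exists_iterD_replicate_eq_sum isOpen_Dplus hχD hh zero_mem_Dplus k
  -- The k-th homogeneous Taylor part at 0, in the form to which the result for powers of linear
  -- forms applies.
  set p : ℕ → HC → ℂ := fun k P => ∑ q : Fin (k + 1) × Fin (k + 1),
    ((k.factorial : ℂ)⁻¹ * C k q.1 q.2) * linForm ((q.1 : ℕ) : ℂ) ((q.2 : ℕ) : ℂ) P ^ k with hp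
  have hpχ : ∀ k P, p k P =
      ((k.factorial : ℂ))⁻¹ * iteratedDeriv k (fun z : ℂ => χ (z • P)) 0 := by
    intro k P
    rw [iteratedDeriv_comp_smul isOpen_Dplus zero_mem_Dplus P k hχD, hC, ← Fintype.sum_prod_type',
      Finset.mul_sum]
    exact Finset.sum_congr rfl fun q _ => mul_assoc _ _ _
  have hrep : ∀ k, Reproduced R Z (p k) := fun k =>
    Reproduced.sum _ _ fun q _ => reproduced_linForm_pow hR hZ _ _ k
  have hpd : ∀ k, Differentiable ℂ (p k) := fun k P =>
    (fderiv_sum_const_mul Finset.univ _ _ fun q _ =>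
      (fderiv_comp_linForm (g := fun z => z ^ k) (hasDerivAt_pow k _)).1).1
  -- The open disc over a unitary matrix lies in `Dplus` and its boundary circle is unitary.
  have hcl : ∀ u ∈ unitarySet, ∀ z : ℂ, ‖z‖ ≤ 1 → z • u ∈ W := by
    intro u hu z hz
    rcases hz.lt_or_eq with h | h
    · exact hDW (smul_mem_Dplus hu h)
    · refine hUW ?_
      change (z • u) * (z • u).conjTranspose = 1
      have hu' : u * u.conjTranspose = 1 := hu
      rw [Matrix.conjTranspose_smul, smul_mul_smul_comm, hu', RCLike.star_def, mul_conj', h]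
      simp
  obtain ⟨b, hb, h0, h1, hs0, hs1⟩ :=
    exists_homogeneous_expansion_HC isCompact_unitarySet hW hcl hχ hpd hpχ
  have hZD := cayleyMap_mem_Dplus hZ
  -- The same expansion at the single interior point that corresponds to Z gives the value side of
  -- the formulas.
  obtain ⟨-, -, -, -, hsZ, -⟩ := exists_homogeneous_expansion_HC
    (isCompact_singleton_HC (cayleyMap Z)) isOpen_Dplus (by
      rintro u rfl z hz
      exact smul_mem_Dplus_of_norm_le_one hZD hz) hχD hpd hpχ
  have hsZ' := (hsZ _ (Set.mem_singleton _)).mul_left (4 / N (1 - Z))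
  have hdiff : ∀ u ∈ unitarySet, DifferentiableAt ℂ χ u := fun u hu =>
    hχ.differentiableAt (hW.mem_nhds (hUW hu))
  obtain ⟨i1, i2⟩ := hasSum_integral_integrand hR hZ hdiff (fun k u _ => hpd k u) hb h0 h1 hs0 hs1
  have hB0 : ∀ u ∈ unitarySet, ‖χ u‖ ≤ ∑' k, b k := fun u hu => by
    rw [← (hs0 u hu).tsum_eq]
    exact tsum_of_norm_bounded hb.hasSum fun k => h0 k u hu
  have hB1 : ∀ u ∈ unitarySet, ∀ i j, ‖fderiv ℂ χ u (Matrix.single i j (1 : ℂ))‖ ≤ ∑' k, b k :=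
    fun u hu i j => by
      rw [← (hs1 u hu i j).tsum_eq]
      exact tsum_of_norm_bounded hb.hasSum fun k => h1 k u hu i j
  obtain ⟨j1, j2⟩ := integrable_sheetDiff_integrand hR hZ hdiff hB0 hB1
  simp_rw [(hrep _).eq_poisson] at i1
  simp_rw [(hrep _).eq_deg] at i2
  exact ⟨⟨hdiff, j1, i1.unique (hsZ'.mul_left _), j2, i2.unique (hsZ'.mul_left _).neg⟩,
    ∑' k, b k, hB0, hB1⟩

end ClassG

end ComplexQuaternion

theorem fderiv_comp_neg_apply (𝕜 : Type*) [NontriviallyNormedField 𝕜] {E F : Type*}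
    [NormedAddCommGroup E] [NormedSpace 𝕜 E] [NormedAddCommGroup F] [NormedSpace 𝕜 F] (f : E → F)
    (x v : E) : fderiv 𝕜 (fun y => f (-y)) x v = -fderiv 𝕜 f (-x) v := by
  have h := (ContinuousLinearEquiv.neg 𝕜 (M := E)).comp_right_fderiv (f := f) (x := x)
  refine (DFunLike.congr_fun h v).trans ?_
  exact map_neg (fderiv 𝕜 f (-x)) v

/-! ### Boundary limits from the tubes. -/

namespace ComplexQuaternion

open scoped ComplexOrder

theorem mink_sub_mem_Tplus (y : EuclideanSpace ℝ (Fin 4)) {ε : ℝ} (hε : 0 < ε) :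
    mink y - (ε : ℂ) • (1 : HC) ∈ Tplus := by
  rw [mem_Tplus_iff_posDef]
  have e1 : -(mink y - (ε : ℂ) • (1 : HC) + (mink y - (ε : ℂ) • (1 : HC)).conjTranspose) =
      (2 : ℂ) • ((ε : ℂ) • (1 : HC)) := by
    rw [Matrix.conjTranspose_sub, mink_mem_Mink, Matrix.conjTranspose_smul, Matrix.conjTranspose_one,
      RCLike.star_def, conj_ofReal]
    module
  have h0 : (0 : ℂ) < (ε : ℂ) := by rw [← ofReal_zero, real_lt_real]; exact hε
  rw [e1, posDef_two_smul_iff]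
  exact Matrix.PosDef.one.smul h0

/-- Points of M are approached by subtracting εe₀ with ε > 0. Without nontriviality of this filter
the limit defining `boundaryValue` would not be determined. -/
instance neBot_nhdsWithin_Tplus (y : EuclideanSpace ℝ (Fin 4)) : (𝓝[Tplus] (mink y)).NeBot := by
  have h1 : Tendsto (fun ε : ℝ => mink y - (ε : ℂ) • (1 : HC)) (𝓝[>] 0)
      (𝓝 (mink y - ((0 : ℝ) : ℂ) • (1 : HC))) :=
    ((continuous_const.sub (continuous_ofReal.smul continuous_const)).tendsto 0).mono_left
      nhdsWithin_le_nhds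
  rw [ofReal_zero, zero_smul, sub_zero] at h1
  refine mem_closure_iff_nhdsWithin_neBot.1 (mem_closure_of_tendsto h1 ?_)
  filter_upwards [self_mem_nhdsWithin] with ε hε
  exact mink_sub_mem_Tplus y hε

theorem tendsto_neg_Tplus (y : EuclideanSpace ℝ (Fin 4)) :
    Tendsto (fun Z : HC => -Z) (𝓝[Tplus] (mink (-y))) (𝓝[Tminus] (mink y)) := by
  refine tendsto_nhdsWithin_iff.2 ⟨?_, ?_⟩
  · have h := (continuous_neg (G := HC)).tendsto (mink (-y))
    rw [mink_neg, neg_neg, ← mink_neg] at h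
    exact h.mono_left nhdsWithin_le_nhds
  · filter_upwards [self_mem_nhdsWithin] with Z hZ
    rw [← neg_mem_Tplus_iff, neg_neg]
    exact hZ

theorem tendsto_neg_Tminus (y : EuclideanSpace ℝ (Fin 4)) :
    Tendsto (fun Z : HC => -Z) (𝓝[Tminus] (mink y)) (𝓝[Tplus] (mink (-y))) := by
  refine tendsto_nhdsWithin_iff.2 ⟨?_, ?_⟩
  · have h := (continuous_neg (G := HC)).tendsto (mink y)
    rw [← mink_neg] at h
    exact h.mono_left nhdsWithin_le_nhds
  · filter_upwards [self_mem_nhdsWithin] with Z hZ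
    exact (neg_mem_Tplus_iff Z).2 hZ

instance neBot_nhdsWithin_Tminus (y : EuclideanSpace ℝ (Fin 4)) : (𝓝[Tminus] (mink y)).NeBot :=
  (tendsto_neg_Tplus y).neBot

/-- Harmonic functions on the tube whose Cayley transform extends across the unitary group. -/
structure RegularTube (φ : HC → ℂ) : Prop where
  diff : DifferentiableOn ℂ φ Tplus
  harmonic : HarmonicOn φ Tplus
  extends_across : ∃ (U : Set HC) (ψ : HC → ℂ), IsOpen U ∧ unitarySet ⊆ U ∧
    DifferentiableOn ℂ ψ U ∧ ∀ P ∈ U, P ∈ Dplus → ψ P = cayley φ P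

section Boundary

attribute [local instance] Matrix.normedAddCommGroup Matrix.normedSpace

theorem differentiableOn_union_piecewise {U V : Set HC} (hU : IsOpen U) (hV : IsOpen V)
    {f g : HC → ℂ} (hf : DifferentiableOn ℂ f U) (hg : DifferentiableOn ℂ g V)
    (h : ∀ P ∈ V, P ∈ U → g P = f P) [DecidablePred (· ∈ U)] :
    DifferentiableOn ℂ (fun P => if P ∈ U then f P else g P) (U ∪ V) := by
  rintro P (hP | hP)
  · refine DifferentiableAt.differentiableWithinAt ?_
    refine (hf.differentiableAt (hU.mem_nhds hP)).congr_of_eventuallyEq ?_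
    filter_upwards [hU.mem_nhds hP] with Q hQ
    exact if_pos hQ
  · refine DifferentiableAt.differentiableWithinAt ?_
    refine (hg.differentiableAt (hV.mem_nhds hP)).congr_of_eventuallyEq ?_
    filter_upwards [hV.mem_nhds hP] with Q hQ
    by_cases hQ' : Q ∈ U
    · exact (if_pos hQ').trans (h Q hQ hQ').symm
    · exact if_neg hQ'

/-- The Cayley transform, extended across the unitary group. -/
theorem RegularTube.exists_extension {φ : HC → ℂ} (hφ : RegularTube φ) :
    ∃ (W : Set HC) (χ : HC → ℂ), IsOpen W ∧ Dplus ⊆ W ∧ unitarySet ⊆ W ∧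
      DifferentiableOn ℂ χ W ∧ HarmonicOn χ Dplus ∧ ∀ P ∈ Dplus, χ P = cayley φ P := by
  classical
  obtain ⟨U, ψ, hU, hUU, hψ, h⟩ := hφ.extends_across
  have heq : ∀ P ∈ Dplus, (if P ∈ Dplus then cayley φ P else ψ P) = cayley φ P :=
    fun P hP => if_pos hP
  refine ⟨Dplus ∪ U, fun P => if P ∈ Dplus then cayley φ P else ψ P, isOpen_Dplus.union hU,
    Set.subset_union_left, hUU.trans Set.subset_union_right,
    differentiableOn_union_piecewise isOpen_Dplus hU (differentiableOn_cayley hφ.diff) hψ h,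
    ?_, heq⟩
  intro P hP
  have h1 := harmonicOn_cayley hφ.diff hφ.harmonic P hP
  have h2 : ∀ V : HC, ∀ Q ∈ Dplus,
      fderiv ℂ (fun P => if P ∈ Dplus then cayley φ P else ψ P) Q V = fderiv ℂ (cayley φ) Q V :=
    fun V Q hQ => by rw [fderiv_congr_HC isOpen_Dplus heq hQ]
  rw [fderiv_congr_HC isOpen_Dplus (h2 _) hP, fderiv_congr_HC isOpen_Dplus (h2 _) hP]
  exact h1

/-- On the tube φ equals 4/N(1 - W) χ(cayleyMap W), an expression that is continuous at every point
of M. -/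
theorem tendsto_liftBd {φ χ : HC → ℂ} (h : ∀ P ∈ Dplus, χ P = cayley φ P)
    {y : EuclideanSpace ℝ (Fin 4)} (hχ : DifferentiableAt ℂ χ (cayleyMap (mink y))) :
    Tendsto φ (𝓝[Tplus] (mink y)) (𝓝 (liftBd χ y)) := by
  have h0 := N_one_sub_mink_ne_zero y
  have hN : ContinuousAt (fun W : HC => N (1 - W)) (mink y) := (DifferentiableAt.comp
    (f := fun W : HC => 1 - W) (mink y) (differentiableAt_N _)
    (differentiableAt_id.const_sub 1)).continuousAt
  have hC : ContinuousAt (fun W : HC => χ (cayleyMap W)) (mink y) :=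
    ContinuousAt.comp hχ.continuousAt (differentiableAt_cayleyMap h0).continuousAt
  have h1 : ContinuousAt (fun W : HC => 4 / N (1 - W) * χ (cayleyMap W)) (mink y) :=
    (continuousAt_const.div hN h0).mul hC
  refine (h1.tendsto.mono_left nhdsWithin_le_nhds).congr' ?_
  filter_upwards [self_mem_nhdsWithin] with W hW
  rw [h _ (cayleyMap_mem_Dplus hW), ← eq_mul_cayley (N_one_sub_ne_zero_of_mem_Tplus hW)]

end Boundary

section Integrals

variable {R : ℝ}

theorem neg_mem_hyperboloid {y : EuclideanSpace ℝ (Fin 4)} (hy : y ∈ hyperboloid R) :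
    -y ∈ hyperboloid R := by
  change N (mink (-y)) = _
  rw [mink_neg, N_neg]
  exact hy

theorem integral_hyperboloidMeasure_neg_of_bound (hR : 0 < R) {F : EuclideanSpace ℝ (Fin 4) → ℂ}
    (hF : Measurable F) {C : ℝ} (hC : ∀ y ∈ hyperboloid R, ‖F y‖ ≤ C * ((1 + ‖y‖) ^ 3)⁻¹) :
    Integrable (fun y => F (-y) * oneOverNorm y) (hyperboloidMeasure R) ∧
    ∫ y, F (-y) * oneOverNorm y ∂(hyperboloidMeasure R) = -∫ x, sheetDiff R F x := by
  rw [← integral_sheetDiff_neg]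
  refine hyperboloidMeasure_integral_of_bound hR (F := fun y => F (-y))
    (hF.comp measurable_neg) (C := C) fun y hy => ?_
  have := hC (-y) (neg_mem_hyperboloid hy)
  rwa [norm_neg] at this

theorem degTilde_comp_neg (f : EuclideanSpace ℝ (Fin 4) → ℂ) (y : EuclideanSpace ℝ (Fin 4)) :
    degTilde (fun y => f (-y)) y = degTilde f (-y) := by
  rw [degTilde_eq, degTilde_eq, fderiv_comp_neg_apply, map_neg]

/-- The boundary values of a regular function on the tube, and the integrals over the
hyperboloid. -/
theorem RegularTube.main {φ : HC → ℂ} (hφ : RegularTube φ) :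
    ∃ χ : HC → ℂ, (∀ y, Tendsto φ (𝓝[Tplus] (mink y)) (𝓝 (liftBd χ y))) ∧
      Differentiable ℝ (liftBd χ) ∧ ∀ Z ∈ Tplus, ∀ R : ℝ, 0 < R →
        Measurable (poissonIntegrand R Z χ) ∧ Measurable (degIntegrand Z χ) ∧
        (∃ C : ℝ, ∀ y ∈ hyperboloid R, ‖poissonIntegrand R Z χ y‖ ≤ C * ((1 + ‖y‖) ^ 3)⁻¹ ∧
          ‖degIntegrand Z χ y‖ ≤ C * ((1 + ‖y‖) ^ 3)⁻¹) ∧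
        ∫ x, sheetDiff R (poissonIntegrand R Z χ) x = 2 * Real.pi ^ 2 * I * φ Z ∧
        ∫ x, sheetDiff R (degIntegrand Z χ) x = -(2 * Real.pi ^ 2 * I * φ Z) := by
  obtain ⟨W, χ, hW, hDW, hUW, hχ, hh, heq⟩ := hφ.exists_extension
  have hd : ∀ u ∈ unitarySet, DifferentiableAt ℂ χ u := fun u hu =>
    hχ.differentiableAt (hW.mem_nhds (hUW hu))
  refine ⟨χ, fun y => tendsto_liftBd heq (hd _ (cayleyMap_mink_mem y)),
    fun y => differentiableAt_liftBd (hd _ (cayleyMap_mink_mem y)), fun Z hZ R hR => ?_⟩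
  obtain ⟨hrep, b, hb0, hb1⟩ := reproduced_of_harmonicOn hR hZ hW hDW hUW hχ hh
  obtain ⟨m1, m2⟩ := measurable_integrand hd R Z
  obtain ⟨C, -, hC⟩ := exists_norm_integrand_le R hZ
  have hZe : φ Z = 4 / N (1 - Z) * χ (cayleyMap Z) := by
    rw [heq _ (cayleyMap_mem_Dplus hZ)]
    exact eq_mul_cayley (N_one_sub_ne_zero_of_mem_Tplus hZ)
  rw [hZe]
  exact ⟨m1, m2, ⟨C * b, fun y hy => hC y hy χ b (hd _ (cayleyMap_mink_mem y))
    (hb0 _ (cayleyMap_mink_mem y)) (hb1 _ (cayleyMap_mink_mem y))⟩, hrep.eq_poisson, hrep.eq_deg⟩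

end Integrals

theorem regularTube_of_mem_HMplus {φ : HC → ℂ} (hφ : φ ∈ HMplus) : RegularTube φ := by
  obtain ⟨h1, h2, U, ψ, hU, hDU, hψ, h⟩ := hφ
  exact ⟨h1, harmonicOn_of_box isOpen_Tplus h1 h2, U, ψ, hU,
    unitarySet_subset_closure_Dplus.trans hDU, hψ, fun P _ hP => h P hP⟩

/-! ### The reflection Z ↦ -Z, which exchanges the two tubes. -/

section Reflection

attribute [local instance] Matrix.normedAddCommGroup Matrix.normedSpace

theorem fderiv_comp_neg_HC (f : HC → ℂ) (Z V : HC) :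
    fderiv ℂ (fun W => f (-W)) Z V = -fderiv ℂ f (-Z) V :=
  fderiv_comp_neg_apply ℂ f Z V

theorem box_comp_neg (φ : HC → ℂ) (Z : HC) : box (fun W => φ (-W)) Z = box φ (-Z) := by
  refine Finset.sum_congr rfl fun j _ => ?_
  simp only [fderiv_comp_neg_HC]
  have h := fderiv_comp_neg_HC (fun W => -fderiv ℂ φ W (e j)) Z (e j)
  refine h.trans ?_
  have h2 : fderiv ℂ (fun W => -fderiv ℂ φ W (e j)) (-Z) =
    -fderiv ℂ (fun W => fderiv ℂ φ W (e j)) (-Z) := fderiv_fun_neg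
  rw [h2]
  exact neg_neg _

variable {P : HC}

theorem I_smul_neg_inv_sub_one (hP : N P ≠ 0) :
    I • (-P⁻¹) - 1 = I • ((I • P - 1) * P⁻¹) := by
  rw [sub_mul, smul_mul_assoc, (mul_inv_of_N_ne_zero hP).1, one_mul, smul_sub, smul_smul, I_mul_I]
  module

theorem tubeMap_neg_inv (hP : N P ≠ 0) (hQ : N (I • P - 1) ≠ 0) :
    tubeMap (-P⁻¹) = -tubeMap P := by
  have h1 : (I • (-P⁻¹) - 1)⁻¹ = (-I) • (P * (I • P - 1)⁻¹) := by
    rw [I_smul_neg_inv_sub_one hP]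
    refine Matrix.inv_eq_right_inv ?_
    rw [smul_mul_smul_comm, mul_assoc, ← mul_assoc P⁻¹, (mul_inv_of_N_ne_zero hP).2, one_mul,
      (mul_inv_of_N_ne_zero hQ).1, mul_neg, I_mul_I, neg_neg, one_smul]
  have h2 : (-I) • (P * (I • P - 1)⁻¹) = -1 - (I • P - 1)⁻¹ := by
    have h3 : P = (-I) • ((I • P - 1) + 1) := by
      rw [sub_add_cancel, smul_smul, neg_mul, I_mul_I, neg_neg, one_smul]
    nth_rewrite 1 [h3]
    rw [smul_mul_assoc, smul_smul, neg_mul_neg, I_mul_I, add_mul, (mul_inv_of_N_ne_zero hQ).1,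
      one_mul]
    module
  rw [tubeMap, tubeMap, h1, h2]
  module

/-- The reflection of the tube becomes P ↦ -P⁻¹, which preserves the unitary group and maps the
invertible points of `Dplus` into `Dminus`. So an extension of πφ across the unitary group from
`Dminus` yields one from `Dplus` for the reflected function. -/
theorem cayley_comp_neg {φ : HC → ℂ} (hP : N P ≠ 0) (hQ : N (I • P - 1) ≠ 0) :
    cayley (fun W => φ (-W)) P = -(N P)⁻¹ * cayley φ (-P⁻¹) := by
  have h1 : N (I • (-P⁻¹) - 1) = -(N (I • P - 1) * (N P)⁻¹) := by
    rw [I_smul_neg_inv_sub_one hP, N_smul, I_sq, neg_one_mul, ← N_inv]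
    exact congrArg Neg.neg (Matrix.det_mul _ _)
  have h2 : N (I • (-P⁻¹) - 1) ≠ 0 := by
    rw [h1]
    exact neg_ne_zero.2 (mul_ne_zero hQ (inv_ne_zero hP))
  rw [cayley_apply hQ, cayley_apply h2, tubeMap_neg_inv hP hQ, h1]
  field_simp

theorem neg_inv_mem_Dminus (hP : N P ≠ 0) (hD : P ∈ Dplus) : -P⁻¹ ∈ Dminus := by
  change ((-P⁻¹) * (-P⁻¹).conjTranspose - 1).PosDef
  have hD' : (1 - P * P.conjTranspose).PosDef := hD
  rw [← Matrix.IsUnit.posDef_star_right_conjugate_iff (isUnit_of_N_ne_zero hP)]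
  have h1 : P * ((-P⁻¹) * (-P⁻¹).conjTranspose - 1) * star P = 1 - P * P.conjTranspose := by
    have h2 : (P⁻¹).conjTranspose * P.conjTranspose = 1 := by
      rw [← Matrix.conjTranspose_mul, (mul_inv_of_N_ne_zero hP).1, Matrix.conjTranspose_one]
    rw [Matrix.star_eq_conjTranspose, Matrix.conjTranspose_neg, neg_mul_neg, mul_sub, mul_one,
      ← mul_assoc, (mul_inv_of_N_ne_zero hP).1, one_mul, sub_mul, h2]
  rwa [h1]

theorem N_ne_zero_of_mem_unitarySet (hP : P ∈ unitarySet) : N P ≠ 0 :=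
  N_ne_zero_of_isUnit (IsUnit.of_mul_eq_one _ hP)

theorem neg_inv_mem_unitarySet (hP : P ∈ unitarySet) : -P⁻¹ ∈ unitarySet := by
  have hP' : P * P.conjTranspose = 1 := hP
  change (-P⁻¹) * (-P⁻¹).conjTranspose = 1
  rw [Matrix.inv_eq_right_inv hP', Matrix.conjTranspose_neg, neg_mul_neg,
    Matrix.conjTranspose_conjTranspose]
  exact mul_eq_one_comm.1 hP'

theorem regularTube_of_mem_HMminus {φ : HC → ℂ} (hφ : φ ∈ HMminus) :
    RegularTube (fun W => φ (-W)) := by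
  obtain ⟨h1, h2, U, ψ, hU, hDU, hψ, h, -⟩ := hφ
  have hd : DifferentiableOn ℂ (fun W : HC => φ (-W)) Tplus := by
    intro W hW
    have hW' : -W ∈ Tminus := by
      rw [← neg_mem_Tplus_iff, neg_neg]; exact hW
    exact (DifferentiableAt.comp (f := fun W : HC => -W) W
      (h1.differentiableAt (isOpen_Tminus.mem_nhds hW'))
      differentiableAt_id.neg).differentiableWithinAt
  have hinv : ∀ P : HC, N P ≠ 0 → DifferentiableAt ℂ (fun P : HC => -P⁻¹) P := fun P hP =>
    (differentiableAt_inv hP).neg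
  refine ⟨hd, harmonicOn_of_box isOpen_Tplus hd fun Z hZ => ?_,
    {P | N P ≠ 0 ∧ -P⁻¹ ∈ U}, fun P => -(N P)⁻¹ * ψ (-P⁻¹), ?_, ?_, ?_, ?_⟩
  · rw [box_comp_neg]
    refine h2 _ ?_
    rw [← neg_mem_Tplus_iff, neg_neg]; exact hZ
  · rw [isOpen_iff_mem_nhds]
    rintro P ⟨hP, hPU⟩
    filter_upwards [(differentiableAt_N P).continuousAt.eventually_ne hP,
      (hinv P hP).continuousAt (hU.mem_nhds hPU)] with Q hQ hQU
    exact ⟨hQ, hQU⟩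
  · intro u hu
    exact ⟨N_ne_zero_of_mem_unitarySet hu,
      hDU (unitarySet_subset_closure_Dminus (neg_inv_mem_unitarySet hu))⟩
  · rintro P ⟨hP, hPU⟩
    exact (((differentiableAt_N P).inv hP).neg.mul (DifferentiableAt.comp P
      (hψ.differentiableAt (hU.mem_nhds hPU)) (hinv P hP))).differentiableWithinAt
  · rintro P ⟨hP, hPU⟩ hPD
    beta_reduce
    rw [cayley_comp_neg hP (N_ne_zero_of_mem_Dplus hPD), h _ (neg_inv_mem_Dminus hP hPD)]

end Reflection

end ComplexQuaternion
-- Assembly of the two cases.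
theorem mainTheorem10 :
    (∀ φ ∈ HMplus,
      (∀ y, Tendsto φ (𝓝[Tplus] (mink y)) (𝓝 (boundaryValue Tplus φ y))) ∧
      Differentiable ℝ (boundaryValue Tplus φ) ∧
      ∀ Z ∈ Tplus, ∀ R : ℝ, 0 < R →
        Integrable (fun y => ((R : ℂ) ^ 2 + N Z) / N (mink y - Z) ^ 2 *
          boundaryValue Tplus φ y * oneOverNorm y) (hyperboloidMeasure R) ∧
        Integrable (fun y => degTilde (boundaryValue Tplus φ) y / N (mink y - Z) *
          oneOverNorm y) (hyperboloidMeasure R) ∧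
        φ Z = -(I / (2 * (Real.pi : ℂ) ^ 2)) *
          ∫ y, ((R : ℂ) ^ 2 + N Z) / N (mink y - Z) ^ 2 *
            boundaryValue Tplus φ y * oneOverNorm y ∂(hyperboloidMeasure R) ∧
        φ Z = I / (2 * (Real.pi : ℂ) ^ 2) *
          ∫ y, degTilde (boundaryValue Tplus φ) y / N (mink y - Z) *
            oneOverNorm y ∂(hyperboloidMeasure R)) ∧
    (∀ φ ∈ HMminus,
      (∀ y, Tendsto φ (𝓝[Tminus] (mink y)) (𝓝 (boundaryValue Tminus φ y))) ∧
      Differentiable ℝ (boundaryValue Tminus φ) ∧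
      ∀ Z ∈ Tminus, ∀ R : ℝ, 0 < R →
        Integrable (fun y => ((R : ℂ) ^ 2 + N Z) / N (mink y - Z) ^ 2 *
          boundaryValue Tminus φ y * oneOverNorm y) (hyperboloidMeasure R) ∧
        Integrable (fun y => degTilde (boundaryValue Tminus φ) y / N (mink y - Z) *
          oneOverNorm y) (hyperboloidMeasure R) ∧
        φ Z = I / (2 * (Real.pi : ℂ) ^ 2) *
          ∫ y, ((R : ℂ) ^ 2 + N Z) / N (mink y - Z) ^ 2 *
            boundaryValue Tminus φ y * oneOverNorm y ∂(hyperboloidMeasure R) ∧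
        φ Z = -(I / (2 * (Real.pi : ℂ) ^ 2)) *
          ∫ y, degTilde (boundaryValue Tminus φ) y / N (mink y - Z) *
            oneOverNorm y ∂(hyperboloidMeasure R)) := by
  have hpi : (Real.pi : ℂ) ≠ 0 := ofReal_ne_zero.2 Real.pi_ne_zero
  -- The normalizing constant times the constant of the reproducing identity is i² = -1; this fixes
  -- the signs in both formulas.
  have hI : ∀ w : ℂ, I / (2 * (Real.pi : ℂ) ^ 2) * (2 * Real.pi ^ 2 * I * w) = -w := fun w => by
    field_simp
    linear_combination w * I_sq
  refine ⟨fun φ hφ => ?_, fun φ hφ => ?_⟩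
  · obtain ⟨χ, hlim, hdiff, hint⟩ := (regularTube_of_mem_HMplus hφ).main
    have hb : boundaryValue Tplus φ = liftBd χ := funext fun y => (hlim y).limUnder_eq
    rw [hb]
    refine ⟨hlim, hdiff, fun Z hZ R hR => ?_⟩
    obtain ⟨m1, m2, ⟨C, hC⟩, e1, e2⟩ := hint Z hZ R hR
    obtain ⟨i1, j1⟩ := hyperboloidMeasure_integral_of_bound hR m1 fun y hy => (hC y hy).1
    obtain ⟨i2, j2⟩ := hyperboloidMeasure_integral_of_bound hR m2 fun y hy => (hC y hy).2
    rw [e1] at j1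
    rw [e2] at j2
    refine ⟨i1, i2, ?_, ?_⟩
    · refine Eq.trans ?_ (congrArg _ j1.symm)
      rw [neg_mul, hI, neg_neg]
    · refine Eq.trans ?_ (congrArg _ j2.symm)
      rw [mul_neg, hI, neg_neg]
  · obtain ⟨χ, hlim, hdiff, hint⟩ := (regularTube_of_mem_HMminus hφ).main
    have hlim' : ∀ y, Tendsto φ (𝓝[Tminus] (mink y)) (𝓝 (liftBd χ (-y))) := fun y => by
      refine ((hlim (-y)).comp (tendsto_neg_Tminus y)).congr fun Z => ?_
      rw [Function.comp_apply, neg_neg]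
    have hb : boundaryValue Tminus φ = fun y => liftBd χ (-y) :=
      funext fun y => (hlim' y).limUnder_eq
    rw [hb]
    refine ⟨hlim', hdiff.comp differentiable_id.neg, fun Z hZ R hR => ?_⟩
    -- The reflected function is used at -Z, and Y ↦ -Y in the integrals reverses the orientation.
    -- This accounts for the opposite signs in the lower case.
    obtain ⟨m1, m2, ⟨C, hC⟩, e1, e2⟩ := hint (-Z) ((neg_mem_Tplus_iff Z).2 hZ) R hR
    obtain ⟨i1, j1⟩ := integral_hyperboloidMeasure_neg_of_bound hR m1 fun y hy => (hC y hy).1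
    obtain ⟨i2, j2⟩ := integral_hyperboloidMeasure_neg_of_bound hR m2 fun y hy => (hC y hy).2
    rw [e1, neg_neg] at j1
    rw [e2, neg_neg, neg_neg] at j2
    have hN : ∀ y, N (mink (-y) - -Z) = N (mink y - Z) := fun y => by
      rw [mink_neg, ← N_neg]
      congr 1
      abel
    have k1 : ∀ y, poissonIntegrand R (-Z) χ (-y) =
        ((R : ℂ) ^ 2 + N Z) / N (mink y - Z) ^ 2 * liftBd χ (-y) := fun y => by
      rw [poissonIntegrand, ComplexQuaternion.poissonKernel, hN, N_neg]
    have k2 : ∀ y, degIntegrand (-Z) χ (-y) =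
        degTilde (fun y => liftBd χ (-y)) y / N (mink y - Z) := fun y => by
      rw [degIntegrand, hN, degTilde_comp_neg]
    simp only [k1] at i1 j1
    simp only [k2] at i2 j2
    refine ⟨i1, i2, ?_, ?_⟩
    · rw [j1, mul_neg, hI, neg_neg]
    · rw [j2, neg_mul, hI, neg_neg]
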